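/- Let $K$ be a field of characteristic $p\ge 0$ and let $m\ge 1$ be an integer with $p\nmid m$, $p\neq 3$ and $3\nmid m$, such that $K$ contains a primitive $m$th root of unity. Let $G=G(m,m,3)\subset \mathbf{GL}_3(K)$ be the group of generalized permutation matrices whose nonzero entries are $m$th roots of unity with product $1$, acting on $\mathfrak h=K^3$, and let $A=\mathrm{Sym}(\mathfrak h^*)=K[x,y,z]$. A reflection is an element $s$ of finite order with $\operatorname{rank}(1-s)=1$. Let $\mathbf H=\mathbf H_{0,c}(G,\mathfrak h)$ be the rational Cherednik algebra with $\hbar=0$ and generic parameters $c$ (a class function on the reflections of $G$ whose values on the distinct classes are algebraically independent over the prime field): the quotient of $K[G]\ltimes T(\mathfrak h\oplus\mathfrak h^*)$ by $$[f,f']=0,\quad [v,v']=0,\quad [v,f]=-\sum_{s}c_s\,(v,(1-s)f)\,s\qquad (f,f'\in\mathfrak h^*,\ v,v'\in\mathfrak h),$$ the sum being over the reflections $s\in G$, graded by $\deg \mathfrak h^*=1$, $\deg\mathfrak h=-1$, $\deg G=0$. Let $\gamma_0$ be the $2$-dimensional representation of $G$ on the vectors of $Ka_1\oplus Ka_2\oplus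 Ka_3$ with coordinate sum zero, where a matrix in $G$ permutes $a_1,a_2,a_3$ through its underlying permutation, with basis $e_1=a_1-a_3$, $e_2=a_3-a_2$. Let $M(\gamma_0)=\mathbf H\otimes_{K[G]\ltimes\mathrm{Sym}(\mathfrak h)}\gamma_0$ (with $\mathfrak h$ acting on $\gamma_0$ by zero) be the Verma module, $J$ its maximal proper graded submodule, that is, the sum of all proper graded submodules, and $L_c(\gamma_0)=M(\gamma_0)/J$. Let $$Q_1=\begin{pmatrix}xyz&0\\0&xyz\end{pmatrix},\quad Q_2=\begin{pmatrix}x^m+y^m+z^m&0\\0&x^m+y^m+z^m\end{pmatrix},\quad Q_3=\begin{pmatrix}-x^m&y^m\\z^m&-x^m\end{pmatrix}.$$ Write a column $(u_1,u_2)^T$ of polynomials for the element $u_1\otimes e_1+u_2\otimes e_2$ of $M(\gamma_0)$. Then: 1. $J$ is generated, as an $A$-module, by the six columns of $Q_1,Q_2,Q_3$. 2. The matrices $Q_1,Q_2,Q_3$ commute with each other, and $\det Q_1,\det Q_2,\det Q_3$ is a regular sequence in $A$. 3. The Koszul complex $0\to A^2\to (A^2)^3\to (A^2)^3\to A^2$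 of the commuting matrices $Q_1,Q_2,Q_3$ is a minimal free resolution of the $A$-module $L_c(\gamma_0)$, with augmentation $(u_1,u_2)^T\mapsto u_1\otimes e_1+u_2\otimes e_2 \bmod J$ (minimal: all entries of the differentials have zero constant term). 4. $L_c(\gamma_0)$ is graded in nonnegative degrees with finite-dimensional graded pieces, and its Hilbert series is $2(1+t+t^2)\left(\frac{t^m-1}{t-1}\right)^2$. 5. $L_c(\gamma_0)$ is an irreducible $\mathbf H$-module. -/

import Mathlib

open scoped TensorProduct

noncomputable section

namespace Cherednik

/-! ### Reflection groups -/

section Groups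

variable {K : Type*} [Field K] {n : ℕ}

/-- A reflection: an invertible matrix `s` of finite order such that `1 - s` has rank one. -/
def IsReflection (s : GL (Fin n) K) : Prop :=
  IsOfFinOrder s ∧ (1 - (s : Matrix (Fin n) (Fin n) K)).rank = 1

/-- The set of reflections of a group `G` of matrices. -/
abbrev Reflection (G : Subgroup (GL (Fin n) K)) : Type _ :=
  {s : G // IsReflection (s : GL (Fin n) K)}

/-- The conjugacy classes of `G` that consist of reflections. -/
abbrev ReflectionClass (G : Subgroup (GL (Fin n) K)) : Type _ :=
  {C : ConjClasses G // ∃ s : Reflection G, ConjClasses.mk s.1 = C}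

/-- The conjugacy class of a reflection. -/
def Reflection.conjClass {G : Subgroup (GL (Fin n) K)} (s : Reflection G) : ReflectionClass G :=
  ⟨ConjClasses.mk s.1, s, rfl⟩

/-- The monomial matrix with entry `d j` in position `(σ j, j)` and zeros elsewhere. -/
def monomialMatrix (σ : Equiv.Perm (Fin n)) (d : Fin n → K) : Matrix (Fin n) (Fin n) K :=
  Matrix.of fun i j => if i = σ j then d j else 0

theorem monomialMatrix_mul (σ τ : Equiv.Perm (Fin n)) (d e : Fin n → K) :
    monomialMatrix σ d * monomialMatrix τ e =
      monomialMatrix (σ * τ) (fun j => d (τ j) * e j) := by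
  ext i j
  by_cases h : i = σ (τ j) <;> simp [monomialMatrix, Matrix.mul_apply, h]

theorem monomialMatrix_one : monomialMatrix (1 : Equiv.Perm (Fin n)) (fun _ => (1 : K)) = 1 := by
  ext i j
  by_cases h : i = j <;> simp [monomialMatrix, Matrix.one_apply, h]

theorem monomialMatrix_perm_injective {σ τ : Equiv.Perm (Fin n)} {d e : Fin n → K}
    (hd : ∀ j, d j ≠ 0) (h : monomialMatrix σ d = monomialMatrix τ e) : σ = τ := by
  ext j : 1
  by_contra hne
  have h1 := congrFun (congrFun h (σ j)) j
  simp [monomialMatrix, hne, hd] at h1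

/-- The group `G(m, r, n)` over `K`: the monomial matrices whose nonzero entries are `m`-th roots
of unity with product an `(m / r)`-th root of unity. It is used when `r` divides `m`. -/
def imprimitiveGroup (K : Type*) [Field K] (m r n : ℕ) : Subgroup (GL (Fin n) K) where
  carrier := {g | ∃ (σ : Equiv.Perm (Fin n)) (d : Fin n → K), (∀ j, d j ≠ 0) ∧
    (∀ j, d j ^ m = 1) ∧ (∏ j, d j) ^ (m / r) = 1 ∧
      (g : Matrix (Fin n) (Fin n) K) = monomialMatrix σ d}
  one_mem' := ⟨1, fun _ => 1, by simp, by simp, by simp, by simp [monomialMatrix_one]⟩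
  mul_mem' := by
    rintro g h ⟨σ, d, hd0, hd, hdp, hg⟩ ⟨τ, e, he0, he, hep, hh⟩
    refine ⟨σ * τ, fun j => d (τ j) * e j, fun j => mul_ne_zero (hd0 _) (he0 _), fun j => ?_, ?_, ?_⟩
    · rw [mul_pow, hd, he, one_mul]
    · rw [Finset.prod_mul_distrib, Equiv.prod_comp τ d, mul_pow, hdp, hep, one_mul]
    · rw [Units.val_mul, hg, hh, monomialMatrix_mul]
  inv_mem' := by
    rintro g ⟨σ, d, hd0, hd, hdp, hg⟩
    refine ⟨σ⁻¹, fun j => (d (σ⁻¹ j))⁻¹, fun j => inv_ne_zero (hd0 _), fun j => ?_, ?_, ?_⟩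
    · rw [inv_pow, hd, inv_one]
    · rw [Equiv.prod_comp σ⁻¹ (fun j => (d j)⁻¹), Finset.prod_inv_distrib, inv_pow, hdp, inv_one]
    · apply Units.inv_eq_of_mul_eq_one_right
      rw [hg, monomialMatrix_mul, mul_inv_cancel, ← monomialMatrix_one]
      congr 1
      funext j
      exact mul_inv_cancel₀ (hd0 _)

variable {m r : ℕ}

/-- The permutation underlying a generalized permutation matrix: `σ` for the matrix
`monomialMatrix σ d`. -/
def underlyingPerm (g : imprimitiveGroup K m r n) : Equiv.Perm (Fin n) :=
  g.2.choose

theorem underlyingPerm_eq (g : imprimitiveGroup K m r n) {σ : Equiv.Perm (Fin n)} {d : Fin n → K}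
    (hg : ((g : GL (Fin n) K) : Matrix (Fin n) (Fin n) K) = monomialMatrix σ d) :
    underlyingPerm g = σ := by
  obtain ⟨e, he, -, -, h⟩ := g.2.choose_spec
  exact monomialMatrix_perm_injective he (h.symm.trans hg)

/-- The homomorphism from `G(m, r, n)` to the symmetric group. -/
def underlyingPermHom (K : Type*) [Field K] (m r n : ℕ) :
    imprimitiveGroup K m r n →* Equiv.Perm (Fin n) where
  toFun := underlyingPerm
  map_one' := underlyingPerm_eq 1 (d := fun _ => 1) (by simp [monomialMatrix_one])
  map_mul' g h := by
    obtain ⟨d, -, -, -, hg⟩ := g.2.choose_spec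
    obtain ⟨e, -, -, -, hh⟩ := h.2.choose_spec
    refine underlyingPerm_eq (g * h) (σ := underlyingPerm g * underlyingPerm h)
      (d := fun j => d (underlyingPerm h j) * e j) ?_
    rw [Subgroup.coe_mul, Units.val_mul, hg, hh, monomialMatrix_mul]
    rfl

/-- The vectors of `K^n` whose coordinates add up to zero. -/
def sumZero (K : Type*) [Field K] (n : ℕ) : Submodule K (Fin n → K) where
  carrier := {v | ∑ i, v i = 0}
  zero_mem' := by simp
  add_mem' := by
    intro v w hv hw
    simp only [Set.mem_ofPred_eq] at hv hw ⊢
    simp [Finset.sum_add_distrib, hv, hw]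
  smul_mem' := by
    intro a v hv
    simp only [Set.mem_ofPred_eq] at hv ⊢
    simp [← Finset.mul_sum, hv]

/-- The representation of `G(m, r, n)` on `sumZero K n` through the symmetric group: if `a_j`
denotes the `j`-th standard basis vector of `K^n`, a group element with underlying permutation `σ`
sends `∑ v_j a_j` to `∑ v_j a_{σ j}`. -/
def standardRep (K : Type*) [Field K] (m r n : ℕ) :
    Representation K (imprimitiveGroup K m r n) (sumZero K n) where
  toFun g :=
    { toFun := fun v => ⟨fun i => v.1 ((underlyingPermHom K m r n g)⁻¹ i), by
        have hv : ∑ i, v.1 i = 0 := v.2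
        change ∑ i, v.1 ((underlyingPermHom K m r n g)⁻¹ i) = 0
        rw [Equiv.sum_comp (underlyingPermHom K m r n g)⁻¹ v.1, hv]⟩
      map_add' := fun _ _ => rfl
      map_smul' := fun _ _ => rfl }
  map_one' := by
    ext v i
    simp
  map_mul' g h := by
    ext v i
    simp

end Groups

/-! ### The rational Cherednik algebra -/

section Algebra

variable {K : Type*} [Field K] {n : ℕ}

/-- Generators of the Cherednik algebra: the coordinate functions `x i`, spanning the dual space
of `𝔥 = K^n`, the standard basis vectors `y i` of `𝔥`, and the elements of `G`. -/
inductive Gen (G : Subgroup (GL (Fin n) K)) : Type _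
  | x (i : Fin n)
  | y (i : Fin n)
  | g (a : G)

/-- The `(i, j)` entry of a group element. -/
def entry {G : Subgroup (GL (Fin n) K)} (a : G) (i j : Fin n) : K :=
  ((a : GL (Fin n) K) : Matrix (Fin n) (Fin n) K) i j

/-- The free algebra element of a generator. -/
abbrev fr {G : Subgroup (GL (Fin n) K)} (u : Gen G) : FreeAlgebra K (Gen G) :=
  FreeAlgebra.ι K u

/-- The defining relations of the Cherednik algebra with parameters `hbar` and `c`. An element
`a` of `G` acts on `𝔥` by `a (y j) = ∑ i, a i j • y i` and on the dual space by
`a (x i) = ∑ j, a⁻¹ i j • x j`. For a reflection `s`, if `α` spans the image of `1 - s` on the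
dual space and `(1 - s) x = (α', x) α` for all `x`, then `(y, α) (x, α') = (y, (1 - s) x)`; for
`y = y j` and `x = x i` this number is the `(i, j)` entry of `1 - s⁻¹`, which is the coefficient
of `c s` in the commutator `[y j, x i]`. -/
inductive Rel (G : Subgroup (GL (Fin n) K)) (hbar : K) (c : ReflectionClass G → K) :
    FreeAlgebra K (Gen G) → FreeAlgebra K (Gen G) → Prop
  | one : Rel G hbar c (fr (.g 1)) 1
  | mul (a b : G) : Rel G hbar c (fr (.g a) * fr (.g b)) (fr (.g (a * b)))
  | gx (a : G) (i : Fin n) :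
      Rel G hbar c (fr (.g a) * fr (.x i)) ((∑ j, entry a⁻¹ i j • fr (.x j)) * fr (.g a))
  | gy (a : G) (j : Fin n) :
      Rel G hbar c (fr (.g a) * fr (.y j)) ((∑ i, entry a i j • fr (.y i)) * fr (.g a))
  | xx (i j : Fin n) : Rel G hbar c (fr (.x i) * fr (.x j)) (fr (.x j) * fr (.x i))
  | yy (i j : Fin n) : Rel G hbar c (fr (.y i) * fr (.y j)) (fr (.y j) * fr (.y i))
  | yx (j i : Fin n) :
      Rel G hbar c (fr (.y j) * fr (.x i) - fr (.x i) * fr (.y j))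
        (algebraMap K _ (if i = j then hbar else 0) -
          ∑ᶠ s : Reflection G,
            (c s.conjClass * ((if i = j then 1 else 0) - entry (s.1)⁻¹ i j)) • fr (.g s.1))

/-- The rational Cherednik algebra of a finite group `G` of matrices acting on `𝔥 = K^n`, with
parameter `hbar` and with one parameter `c C` for every conjugacy class `C` of reflections. -/
def CherednikAlgebra (G : Subgroup (GL (Fin n) K)) (hbar : K) (c : ReflectionClass G → K) :
    Type _ :=
  RingQuot (Rel G hbar c)

variable (G : Subgroup (GL (Fin n) K)) (hbar : K) (c : ReflectionClass G → K)

instance : Ring (CherednikAlgebra G hbar c) := inferInstanceAs (Ring (RingQuot (Rel G hbar c)))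

instance : Algebra K (CherednikAlgebra G hbar c) :=
  inferInstanceAs (Algebra K (RingQuot (Rel G hbar c)))

/-- The image of a generator in the Cherednik algebra. -/
def gen (u : Gen G) : CherednikAlgebra G hbar c :=
  RingQuot.mkAlgHom K (Rel G hbar c) (fr u)

theorem gen_x_comm (i j : Fin n) :
    gen G hbar c (.x i) * gen G hbar c (.x j) = gen G hbar c (.x j) * gen G hbar c (.x i) := by
  have h := RingQuot.mkAlgHom_rel K (Rel.xx (G := G) (hbar := hbar) (c := c) i j)
  rw [map_mul, map_mul] at h
  exact h

theorem range_gen_x_comm :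
    ∀ a ∈ Set.range (fun i => gen G hbar c (.x i)), ∀ b ∈ Set.range (fun i => gen G hbar c (.x i)),
      a * b = b * a := by
  rintro _ ⟨i, rfl⟩ _ ⟨j, rfl⟩
  exact gen_x_comm G hbar c i j

open scoped IsMulCommutative in
/-- The homomorphism from the polynomial ring `Sym 𝔥* = K[x_1, …, x_n]` to the Cherednik algebra
that sends `X i` to `x i`. -/
def polyHom : MvPolynomial (Fin n) K →ₐ[K] CherednikAlgebra G hbar c :=
  haveI : IsMulCommutative (Algebra.adjoin K (Set.range fun i => gen G hbar c (.x i))) :=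
    Algebra.isMulCommutative_adjoin K (range_gen_x_comm G hbar c)
  (Algebra.adjoin K (Set.range fun i => gen G hbar c (.x i))).val.comp
    (MvPolynomial.aeval fun i =>
      (⟨gen G hbar c (.x i), Algebra.subset_adjoin ⟨i, rfl⟩⟩ :
        Algebra.adjoin K (Set.range fun i => gen G hbar c (.x i))))

theorem polyHom_X (i : Fin n) : polyHom G hbar c (MvPolynomial.X i) = gen G hbar c (.x i) := by
  simp [polyHom]

/-- The degrees of the generators: `1` for `x i`, `-1` for `y i` and `0` for group elements. -/
def Gen.degree {G : Subgroup (GL (Fin n) K)} : Gen G → ℤ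
  | .x _ => 1
  | .y _ => -1
  | .g _ => 0

/-- The degree `d` part of the Cherednik algebra. -/
def algebraPart (d : ℤ) : Submodule K (CherednikAlgebra G hbar c) :=
  Submodule.span K {h | ∃ w : List (Gen G),
    (w.map Gen.degree).sum = d ∧ h = (w.map (gen G hbar c)).prod}

end Algebra

/-! ### Verma modules and their irreducible quotients -/

section Verma

variable {K : Type*} [Field K] {n : ℕ} (G : Subgroup (GL (Fin n) K)) (hbar : K)
  (c : ReflectionClass G → K) {V : Type*} [AddCommGroup V] [Module K V]
  (τ : Representation K G V)

/-- The elements `a ⊗ v - 1 ⊗ a v` for `a ∈ G` and `y ⊗ v` for `y ∈ 𝔥`, which have to be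
factored out of `H ⊗[K] V` in order to obtain the module induced from the representation `τ` of
`K[G] ⋉ Sym 𝔥` in which `𝔥` acts by zero. -/
def vermaRelations : Set (CherednikAlgebra G hbar c ⊗[K] V) :=
  {u | ∃ (a : G) (v : V), u = gen G hbar c (.g a) ⊗ₜ[K] v - 1 ⊗ₜ[K] τ a v} ∪
    {u | ∃ (i : Fin n) (v : V), u = gen G hbar c (.y i) ⊗ₜ[K] v}

/-- The Verma module `M(τ)`, the tensor product of `H` and `τ` over `K[G] ⋉ Sym 𝔥`. -/
abbrev Verma : Type _ :=
  (CherednikAlgebra G hbar c ⊗[K] V) ⧸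
    Submodule.span (CherednikAlgebra G hbar c) (vermaRelations G hbar c τ)

/-- The class of `h ⊗ v` in the Verma module. -/
def vermaMk (h : CherednikAlgebra G hbar c) (v : V) : Verma G hbar c τ :=
  Submodule.Quotient.mk (h ⊗ₜ[K] v)

/-- The Verma module as a module over the polynomial ring. -/
instance : Module (MvPolynomial (Fin n) K) (Verma G hbar c τ) :=
  Module.compHom _ (polyHom G hbar c).toRingHom

/-- The element `f ⊗ v` of the Verma module, for a polynomial `f` and `v ∈ τ`. -/
def polyTensor (f : MvPolynomial (Fin n) K) (v : V) : Verma G hbar c τ :=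
  vermaMk G hbar c τ (polyHom G hbar c f) v

/-- The degree `d` part of the Verma module. -/
def vermaPart (d : ℤ) : Submodule K (Verma G hbar c τ) :=
  Submodule.span K {u | ∃ h ∈ algebraPart G hbar c d, ∃ v : V, u = vermaMk G hbar c τ h v}

/-- A submodule of the Verma module is graded if it is spanned by its homogeneous elements. -/
def IsGradedSubmodule (N : Submodule (CherednikAlgebra G hbar c) (Verma G hbar c τ)) : Prop :=
  N.restrictScalars K ≤ ⨆ d : ℤ, N.restrictScalars K ⊓ vermaPart G hbar c τ d

/-- The maximal proper graded submodule `J(τ)` of the Verma module: the sum of all proper graded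
submodules. -/
def maxSubmodule : Submodule (CherednikAlgebra G hbar c) (Verma G hbar c τ) :=
  sSup {N | IsGradedSubmodule G hbar c τ N ∧ N ≠ ⊤}

/-- The quotient `L(τ) = M(τ) / J(τ)`. -/
abbrev LModule : Type _ :=
  Verma G hbar c τ ⧸ maxSubmodule G hbar c τ

/-- The degree `d` part of `L(τ)`. -/
def lPart (d : ℤ) : Submodule K (LModule G hbar c τ) :=
  (vermaPart G hbar c τ d).map ((maxSubmodule G hbar c τ).mkQ.restrictScalars K)

end Verma

/-- `V` is a grading of `L` by finite-dimensional subspaces, zero in negative degrees, and `f` is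
its Hilbert series `∑ (dim V_d) t^d`. -/
def HasHilbertSeries {K L : Type*} [Field K] [AddCommGroup L] [Module K L]
    (V : ℤ → Submodule K L) (f : PowerSeries ℕ) : Prop :=
  DirectSum.IsInternal V ∧ (∀ d, Module.Finite K (V d)) ∧ (∀ d < 0, V d = ⊥) ∧
    ∀ d : ℕ, PowerSeries.coeff d f = Module.finrank K (V d)

/-! ### Koszul complexes of three matrices -/

section Koszul

variable {A : Type*} [CommRing A] {ι : Type*} [Fintype ι]

/-- The first differential `F³ → F`, `(u₀, u₁, u₂) ↦ Q₀ u₀ + Q₁ u₁ + Q₂ u₂`, where `F = A^ι`. -/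
def koszul₁ (Q : Fin 3 → Matrix ι ι A) : (Fin 3 → ι → A) →ₗ[A] (ι → A) :=
  ∑ k, (Q k).mulVecLin ∘ₗ LinearMap.proj k

/-- The second differential `F³ → F³`, in the bases `e₀ ∧ e₁, e₀ ∧ e₂, e₁ ∧ e₂` and `e₀, e₁, e₂`:
it sends `v ⊗ (eᵢ ∧ eⱼ)` to `Qᵢ v ⊗ eⱼ - Qⱼ v ⊗ eᵢ`. -/
def koszul₂ (Q : Fin 3 → Matrix ι ι A) : (Fin 3 → ι → A) →ₗ[A] (Fin 3 → ι → A) :=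
  LinearMap.pi
    ![-((Q 1).mulVecLin ∘ₗ LinearMap.proj 0) - (Q 2).mulVecLin ∘ₗ LinearMap.proj 1,
      (Q 0).mulVecLin ∘ₗ LinearMap.proj 0 - (Q 2).mulVecLin ∘ₗ LinearMap.proj 2,
      (Q 0).mulVecLin ∘ₗ LinearMap.proj 1 + (Q 1).mulVecLin ∘ₗ LinearMap.proj 2]

/-- The third differential `F → F³`, `w ↦ Q₂ w ⊗ (e₀ ∧ e₁) - Q₁ w ⊗ (e₀ ∧ e₂) +
Q₀ w ⊗ (e₁ ∧ e₂)`. -/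
def koszul₃ (Q : Fin 3 → Matrix ι ι A) : (ι → A) →ₗ[A] (Fin 3 → ι → A) :=
  LinearMap.pi ![(Q 2).mulVecLin, -(Q 1).mulVecLin, (Q 0).mulVecLin]

end Koszul

/-! ### The group `G(m, m, 3)` and its two-dimensional representation -/

section RankThree

variable (K : Type*) [Field K] (m : ℕ)

/-- The group `G(m, m, 3)`. -/
abbrev groupMM3 : Subgroup (GL (Fin 3) K) := imprimitiveGroup K m m 3

/-- The two-dimensional representation `γ₀` of `G(m, m, 3)`. -/
abbrev gamma0 : Representation K (groupMM3 K m) (sumZero K 3) := standardRep K m m 3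

/-- The basis vectors `a₁ - a₃` and `a₃ - a₂` of `γ₀`. -/
def gamma0Basis : Fin 2 → sumZero K 3 :=
  ![⟨![1, 0, -1], by change ∑ i, ![(1 : K), 0, -1] i = 0; simp [Fin.sum_univ_three]⟩,
    ⟨![0, -1, 1], by change ∑ i, ![(0 : K), -1, 1] i = 0; simp [Fin.sum_univ_three]⟩]

open MvPolynomial in
/-- The three matrices over `K[x, y, z]`, where `x, y, z` are `X 0, X 1, X 2`. -/
def matrixSeq : Fin 3 → Matrix (Fin 2) (Fin 2) (MvPolynomial (Fin 3) K) :=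
  ![!![X 0 * X 1 * X 2, 0;
       0, X 0 * X 1 * X 2],
    !![X 0 ^ m + X 1 ^ m + X 2 ^ m, 0;
       0, X 0 ^ m + X 1 ^ m + X 2 ^ m],
    !![-X 0 ^ m, X 1 ^ m;
       X 2 ^ m, -X 0 ^ m]]

variable (c : ReflectionClass (groupMM3 K m) → K)

/-- The element `u₁ ⊗ e₁ + u₂ ⊗ e₂` of the Verma module of `γ₀`, for a column `u` of
polynomials and the basis `e₁, e₂` of `γ₀`. -/
def colElement (u : Fin 2 → MvPolynomial (Fin 3) K) : Verma (groupMM3 K m) 0 c (gamma0 K m) :=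
  ∑ i, polyTensor (groupMM3 K m) 0 c (gamma0 K m) (u i) (gamma0Basis K i)

end RankThree

end Cherednik

end

open scoped TensorProduct

noncomputable section

namespace Cherednik

open MvPolynomial
open scoped Matrix

/-! ### The invariants and the regular sequence -/

section Regular

/-! Since `ħ = 0`, the Cherednik algebra acts on `A ⊗ K³ = A³` (`K³` the permutation module) by
multiplication, by the group and by Dunkl operators without derivative term, which kill every
invariant times a constant vector. Inside `A³` the Verma module is the space of vectors with
coordinate sum zero: it is spanned over `A` by `1 ⊗ γ₀` (`span_vermaMk_one`), and the resulting
surjection from `A²` becomes injective after mapping to `A³` (`gammaVec_injective`).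

All reflections of `G(m, m, 3)` are conjugate, so there is a single parameter `c₀`, and `c₀ m ≠ 0`
in `K`. Averaging over the `m` reflections that lie over one transposition leaves only exponents
divisible by `m`; hence `D_j (x_i^m ⊗ v) = c₀ m x_j^(m-1) ⊗ v'`, where `v'` is `v` with its indices
reflected by `l ↦ i + j - l` in `ℤ/3`. It follows that `xyz ⊗ v`, `(x^m + y^m + z^m) ⊗ v` and `x_i^m
⊗ v - x_j^m ⊗ (v translated by j - i)` are killed by all Dunkl operators (`dunkl_relation`). They
span over `A` an `H`-submodule `R`, and over `A` it is also spanned by the six columns.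

Modulo `R` an `m`-th power can be moved from one variable to another, and every product of all three
variables vanishes. This leaves `3 m²` normal monomials, with coefficients in `γ₀`. They are
independent because `topMap`, which collects the coefficients of the `x_i^m x_j^m` with the matching
translations, vanishes on `R` and pairs them perfectly with dual monomials. Counting degrees gives
the Hilbert series. The same pairing shows that any element outside `R` has a multiple congruent to
some `x_0^(2m) ⊗ v` with `v ≠ 0` (`exists_smul_sub_mem`). Applying `D_0` repeatedly brings it down
to degree zero with nonzero factors `± c₀ m` (`exists_constVec_mem`), and `γ₀` is irreducible
because `3 ≠ 0`. So `R` is a maximal submodule; being graded, it is `J`, and `L` is simple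
(`isCoatom_radical`, `maxSubmodule_eq_radical`).

For the resolution, two of the matrices are the scalars `p = xyz` and `q = x^m + y^m + z^m`, and the
determinant of the third is `d = x^(2m) - y^m z^m`. The sequence `p, q, d` is regular because `(p,
q)` is the intersection of the ideals `(x_j, q)`, modulo which `d` is a power of a variable that is
regular there. The adjugate then makes the third matrix injective modulo `(p, q)`, which is all that
exactness of the Koszul complex needs. -/

theorem isSMulRegular_quotient_of_forall {A : Type*} [CommRing A] {I : Ideal A} {r : A}
    (h : ∀ a, r * a ∈ I → a ∈ I) : IsSMulRegular (A ⧸ (I • ⊤ : Submodule A A)) r := by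
  rw [Ideal.smul_eq_mul, Ideal.mul_top]
  refine isSMulRegular_iff_right_eq_zero_of_smul.2 fun x hx => ?_
  obtain ⟨a, rfl⟩ := Submodule.Quotient.mk_surjective _ x
  rw [← Submodule.Quotient.mk_smul, Submodule.Quotient.mk_eq_zero] at hx
  exact (Submodule.Quotient.mk_eq_zero _).2 (h a hx)

variable {A : Type*} [CommRing A] {p q d : A}

/-- If `p, q, d` is a regular sequence then so is `p ^ 2, q ^ 2, d`. -/
theorem isWeaklyRegular_sq_sq (hp : ∀ a, p * a = 0 → a = 0) (hq : ∀ a, p ∣ q * a → p ∣ a)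
    (hd : ∀ a, d * a ∈ Ideal.span {p, q} → a ∈ Ideal.span {p, q}) :
    RingTheory.Sequence.IsWeaklyRegular A [p ^ 2, q ^ 2, d] := by
  have hp' : ∀ a b, p * a = p * b → a = b := fun a b h =>
    sub_eq_zero.1 (hp _ (by rw [mul_sub, h, sub_self]))
  have key : ∀ a b, p * a = q * b → ∃ k, a = q * k ∧ b = p * k := by
    intro a b h
    obtain ⟨k, rfl⟩ := hq b ⟨a, h.symm⟩
    exact ⟨k, hp' _ _ (by rw [h]; ring), rfl⟩
  refine ⟨fun i hi => ?_⟩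
  match i, hi with
  | 0, _ =>
    refine isSMulRegular_quotient_of_forall fun a ha => ?_
    simp only [List.take_zero, Ideal.ofList_nil, List.getElem_cons_zero, Ideal.mem_bot] at ha ⊢
    exact hp _ (hp _ (by rw [← ha]; ring))
  | 1, _ =>
    refine isSMulRegular_quotient_of_forall fun a ha => ?_
    simp only [List.take_succ_cons, List.take_zero, Ideal.ofList_singleton,
      List.getElem_cons_succ, List.getElem_cons_zero, Ideal.mem_span_singleton] at ha ⊢
    obtain ⟨f, hf⟩ := ha
    obtain ⟨b, rfl⟩ := hq a (hq _ ⟨p * f, by linear_combination hf⟩)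
    obtain ⟨k, -, h2⟩ := key f (q * b) (hp' _ _ (by linear_combination -hf))
    obtain ⟨e, rfl⟩ := hq b ⟨k, h2⟩
    exact ⟨e, by ring⟩
  | 2, _ =>
    refine isSMulRegular_quotient_of_forall fun a ha => ?_
    simp only [List.take_succ_cons, List.take_zero, Ideal.ofList_cons, Ideal.ofList_nil,
      List.getElem_cons_succ, List.getElem_cons_zero, sup_bot_eq, ← Ideal.span_insert] at ha ⊢
    rw [Ideal.mem_span_pair] at ha ⊢
    obtain ⟨f, h, hf⟩ := ha
    -- Regularity of `d` modulo `(p, q)` is used in rounds. The first gives `a` in `(p, q)`, the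
    -- second puts both coefficients in `(p, q)`; then `a` is a quadratic form in `p, q` and only
    -- the coefficient `t + s'` of `p q` is in the way.
    obtain ⟨g₁, g₂, rfl⟩ := Ideal.mem_span_pair.1 (hd a
      (Ideal.mem_span_pair.2 ⟨p * f, q * h, by rw [← hf]; ring⟩))
    obtain ⟨k, h1, h2⟩ := key (d * g₁ - p * f) (q * h - d * g₂) (by linear_combination -hf)
    obtain ⟨s, t, rfl⟩ := Ideal.mem_span_pair.1 (hd g₁
      (Ideal.mem_span_pair.2 ⟨f, k, by linear_combination -h1⟩))
    obtain ⟨s', t', rfl⟩ := Ideal.mem_span_pair.1 (hd g₂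
      (Ideal.mem_span_pair.2 ⟨-k, h, by linear_combination h2⟩))
    -- Cancelling `p` and `q` yields `d (t + s') = p w + q l'`, so `t + s'` lies in `(p, q)` and the
    -- mixed term is absorbed by the squares.
    obtain ⟨l, h3, h4⟩ := key (d * q * (t + s') - p * (f - d * s)) (q * (h - d * t'))
      (by linear_combination -hf)
    obtain ⟨l', h5⟩ := hq (h - d * t') ⟨l, h4⟩
    have h6 : p ∣ q * (d * (t + s') - l) := ⟨f - d * s, by linear_combination h3⟩
    obtain ⟨w, hw⟩ := hq _ h6
    have h7 : l = q * l' := hp' _ _ (by rw [← h4, h5]; ring)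
    obtain ⟨u, v, hu⟩ := Ideal.mem_span_pair.1 (hd (t + s')
      (Ideal.mem_span_pair.2 ⟨w, l', by linear_combination -hw - h7⟩))
    exact ⟨s + q * u, t' + p * v, by linear_combination p * q * hu⟩

end Regular

/-! ### Exactness of the Koszul complex when two of the matrices are scalar -/

section Koszul

variable {A : Type*} [CommRing A] {p q : A} {ι : Type*} [Fintype ι]
  {Q : Fin 3 → Matrix ι ι A}

theorem koszul₁_apply (Q : Fin 3 → Matrix ι ι A) (u : Fin 3 → ι → A) :
    koszul₁ Q u = Q 0 *ᵥ u 0 + Q 1 *ᵥ u 1 + Q 2 *ᵥ u 2 := by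
  simp [koszul₁, Fin.sum_univ_three]

theorem koszul₂_apply (Q : Fin 3 → Matrix ι ι A) (u : Fin 3 → ι → A) :
    koszul₂ Q u = ![-(Q 1 *ᵥ u 0) - Q 2 *ᵥ u 1, Q 0 *ᵥ u 0 - Q 2 *ᵥ u 2,
      Q 0 *ᵥ u 1 + Q 1 *ᵥ u 2] := by
  ext k : 1
  fin_cases k <;> simp [koszul₂]

theorem koszul₃_apply (Q : Fin 3 → Matrix ι ι A) (u : ι → A) :
    koszul₃ Q u = ![Q 2 *ᵥ u, -(Q 1 *ᵥ u), Q 0 *ᵥ u] := by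
  ext k : 1
  fin_cases k <;> simp [koszul₃]

variable (h0 : ∀ u, Q 0 *ᵥ u = p • u) (h1 : ∀ u, Q 1 *ᵥ u = q • u)
  (hp : ∀ a, p * a = 0 → a = 0)
include h0 hp

theorem koszul₃_injective : Function.Injective (koszul₃ Q) := by
  rw [injective_iff_map_eq_zero]
  intro u hu
  rw [koszul₃_apply, h0] at hu
  ext i
  exact hp _ (congrFun (congrFun hu 2) i)

include h1

/-- The scalar relation `p u₁ + q u₂ = 0` forces `u₂ = p w` and `u₁ = -q w`. The component with `Q
2` then follows by cancelling `p`, using only that `Q 2` commutes with scalars. -/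
theorem koszul₃_koszul₂_exact (hq : ∀ a, p ∣ q * a → p ∣ a) :
    Function.Exact (koszul₃ Q) (koszul₂ Q) := by
  have hp' : ∀ u v : ι → A, p • u = p • v → u = v := fun u v h => by
    ext i
    exact sub_eq_zero.1 (hp _ (by rw [mul_sub, sub_eq_zero]; exact congrFun h i))
  intro u
  rw [koszul₂_apply]
  simp only [h0, h1]
  constructor
  · intro h
    have e0 : -(q • u 0) - Q 2 *ᵥ u 1 = 0 := congrFun h 0
    have e1 : p • u 0 - Q 2 *ᵥ u 2 = 0 := congrFun h 1
    have e2 : p • u 1 + q • u 2 = 0 := congrFun h 2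
    have hw : ∀ i, ∃ w, u 2 i = p * w := fun i =>
      hq _ ⟨-u 1 i, by have := congrFun e2 i; simp at this; linear_combination this⟩
    choose w hw using hw
    have e3 : u 2 = p • w := funext hw
    refine ⟨w, ?_⟩
    rw [koszul₃_apply, h0, h1]
    ext k : 1
    fin_cases k
    · refine hp' _ _ ?_
      change p • (Q 2 *ᵥ w) = p • u 0
      rw [sub_eq_zero.1 e1, e3, Matrix.mulVec_smul]
    · refine hp' _ _ ?_
      change p • (-(q • w)) = p • u 1
      rw [eq_neg_of_add_eq_zero_left e2, e3, smul_neg, smul_comm]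
    · exact e3.symm
  · rintro ⟨w, rfl⟩
    rw [koszul₃_apply, h0, h1]
    ext k : 1
    fin_cases k
    · simp [Matrix.mulVec_neg, Matrix.mulVec_smul]
    · simp [Matrix.mulVec_smul]
    · simp [smul_comm p q w]

/-- A cycle satisfies `Q₂ u₂ ≡ 0` modulo `(p, q)`, so injectivity of `Q₂` there gives `u₂ = p s + q
t`. Removing the boundary determined by `s` and `t` leaves a relation between the scalars `p` and
`q` alone. -/
theorem koszul₂_koszul₁_exact (hq : ∀ a, p ∣ q * a → p ∣ a)
    (h2 : ∀ u : ι → A, (∀ i, (Q 2 *ᵥ u) i ∈ Ideal.span {p, q}) → ∀ i, u i ∈ Ideal.span {p, q}) :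
    Function.Exact (koszul₂ Q) (koszul₁ Q) := by
  have hp' : ∀ u v : ι → A, p • u = p • v → u = v := fun u v h => by
    ext i
    exact sub_eq_zero.1 (hp _ (by rw [mul_sub, sub_eq_zero]; exact congrFun h i))
  intro u
  rw [koszul₁_apply]
  simp only [h0, h1]
  constructor
  · intro h
    have hst := h2 (u 2) fun i => Ideal.mem_span_pair.2 ⟨-u 0 i, -u 1 i, by
      have := congrFun h i; simp at this; linear_combination -this⟩
    simp only [Ideal.mem_span_pair] at hst
    choose s t hst using hst
    have e2 : u 2 = p • s + q • t := by
      ext i; rw [← hst i]; simp [mul_comm]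
    have e3 : p • (u 0 + Q 2 *ᵥ s) + q • (u 1 + Q 2 *ᵥ t) = 0 := by
      rw [← h, e2, Matrix.mulVec_add, Matrix.mulVec_smul, Matrix.mulVec_smul, smul_add, smul_add]
      abel
    have hr : ∀ i, ∃ r, (u 1 + Q 2 *ᵥ t) i = p * r := fun i =>
      hq _ ⟨-(u 0 + Q 2 *ᵥ s) i, by
        have := congrFun e3 i; simp at this ⊢; linear_combination this⟩
    choose r hr using hr
    have e4 : u 1 + Q 2 *ᵥ t = p • r := funext hr
    have e5 : u 0 + Q 2 *ᵥ s = -(q • r) := by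
      refine hp' _ _ ?_
      rw [eq_neg_of_add_eq_zero_left e3, e4, smul_neg, smul_comm]
    refine ⟨![r, s, t], ?_⟩
    rw [koszul₂_apply]
    simp only [h0, h1]
    ext k : 1
    fin_cases k
    · simp [eq_sub_of_add_eq e5]
    · simp [eq_sub_of_add_eq e4]
    · simp [e2]
  · rintro ⟨w, rfl⟩
    rw [koszul₂_apply]
    simp only [h0, h1]
    simp only [Matrix.cons_val_zero, Matrix.cons_val_one, Matrix.cons_val, Matrix.mulVec_add,
      Matrix.mulVec_smul, smul_sub, smul_neg, smul_comm p q]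
    abel

end Koszul

/-! ### Regularity of xyz, x^m + y^m + z^m, x^(2m) - y^m z^m -/

section Invariants

variable (K : Type*) [Field K] (m : ℕ)

/-- The product of the coordinates. -/
def prodX : MvPolynomial (Fin 3) K := X 0 * X 1 * X 2

/-- The power sum of degree `m`. -/
def psumX : MvPolynomial (Fin 3) K := X 0 ^ m + X 1 ^ m + X 2 ^ m

variable {K m}

theorem psumX_eq_sum : psumX K m = ∑ i, X i ^ m := by
  simp [psumX, Fin.sum_univ_three]

theorem exists_three_indices {i j : Fin 3} (h : i ≠ j) :
    ∃ k, k ≠ i ∧ k ≠ j ∧ psumX K m = X i ^ m + X j ^ m + X k ^ m := by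
  fin_cases i <;> fin_cases j <;> first
    | exact absurd rfl h
    | exact ⟨0, by decide, by decide, by simp [psumX]; try ring⟩
    | exact ⟨1, by decide, by decide, by simp [psumX]; try ring⟩
    | exact ⟨2, by decide, by decide, by simp [psumX]; try ring⟩

/-- The substitution `X j = 0`. -/
def killX (K : Type*) [Field K] (j : Fin 3) :
    MvPolynomial (Fin 3) K →ₐ[K] MvPolynomial (Fin 3) K :=
  aeval fun i => if i = j then 0 else X i

theorem killX_X (j i : Fin 3) : killX K j (X i) = if i = j then 0 else X i := by simp [killX]

theorem X_dvd_sub_killX (j : Fin 3) (f : MvPolynomial (Fin 3) K) : X j ∣ f - killX K j f := by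
  induction f using MvPolynomial.induction_on with
  | C a => simp [killX]
  | add f g hf hg => rw [map_add, add_sub_add_comm]; exact dvd_add hf hg
  | mul_X f i hf =>
    have : f * X i - killX K j (f * X i) =
        (f - killX K j f) * X i + killX K j f * (X i - killX K j (X i)) := by
      rw [map_mul]; ring
    rw [this]
    refine dvd_add (dvd_mul_of_dvd_left hf _) (dvd_mul_of_dvd_right ?_ _)
    rw [killX_X]
    split_ifs with h <;> simp [h]

theorem X_not_dvd_X_pow {i k : Fin 3} (h : k ≠ i) (n : ℕ) :
    ¬ (X i : MvPolynomial (Fin 3) K) ∣ X k ^ n := by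
  intro hd
  have := (X_prime (R := K) (i := i)).dvd_of_dvd_pow hd
  rw [X_dvd_X] at this
  simp [h.symm] at this

theorem not_X_dvd_psumX (hm : m ≠ 0) (i : Fin 3) : ¬ (X i : MvPolynomial (Fin 3) K) ∣ psumX K m := by
  intro h
  have hne : i ≠ i + 1 := by clear h; revert i; decide
  obtain ⟨k, hki, hkj, e⟩ := exists_three_indices (K := K) (m := m) hne
  have h1 := map_dvd (killX K (i + 1)) h
  rw [e] at h1
  simp only [map_add, map_pow, killX_X, hne, hkj, if_true, if_false, zero_pow hm, add_zero] at h1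
  exact X_not_dvd_X_pow hki m ((dvd_add_right (dvd_pow_self _ hm)).1 h1)

/-- Setting `X j = 0` turns the power sum into `X i ^ m + X k ^ m`, which the prime `X i` does not
divide; so `X i` is regular modulo `X j` and the power sum. -/
theorem mem_span_of_X_mul_mem (hm : m ≠ 0) {i j : Fin 3} (hij : i ≠ j)
    {g : MvPolynomial (Fin 3) K} (h : X i * g ∈ Ideal.span {X j, psumX K m}) :
    g ∈ Ideal.span {X j, psumX K m} := by
  obtain ⟨k, hki, hkj, e⟩ := exists_three_indices (K := K) (m := m) hij
  obtain ⟨f, u, hf⟩ := Ideal.mem_span_pair.1 h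
  have hq : killX K j (psumX K m) = X i ^ m + X k ^ m := by
    rw [e]
    simp [killX_X, hij, hkj, hm]
  have h1 := congrArg (killX K j) hf
  simp only [map_add, map_mul, killX_X, hij, if_true, if_false, mul_zero, zero_add, hq] at h1
  have h2 : (X i : MvPolynomial (Fin 3) K) ∣ killX K j u := by
    refine (X_prime.dvd_or_dvd (Dvd.intro _ h1.symm)).resolve_right fun h3 => ?_
    exact X_not_dvd_X_pow hki m ((dvd_add_right (dvd_pow_self _ hm)).1 h3)
  obtain ⟨w, hw⟩ := h2
  have h3 : killX K j g = (X i ^ m + X k ^ m) * w := by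
    refine mul_left_cancel₀ (X_ne_zero (R := K) i) ?_
    rw [← h1, hw]; ring
  obtain ⟨v, hv⟩ := X_dvd_sub_killX j g
  rw [Ideal.mem_span_pair]
  -- With `m = n + 1`, the term `X j ^ m` lost by the substitution is `X j * X j ^ n` and goes into
  -- the coefficient of `X j`.
  obtain ⟨n, rfl⟩ : ∃ n, m = n + 1 := Nat.exists_eq_succ_of_ne_zero hm
  refine ⟨v - X j ^ n * w, w, ?_⟩
  rw [e]
  rw [h3] at hv
  linear_combination -hv

theorem mem_span_of_X_pow_mul_mem (hm : m ≠ 0) {i j : Fin 3} (hij : i ≠ j) (n : ℕ)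
    {g : MvPolynomial (Fin 3) K} (h : X i ^ n * g ∈ Ideal.span {X j, psumX K m}) :
    g ∈ Ideal.span {X j, psumX K m} := by
  induction n with
  | zero => simpa using h
  | succ n ih =>
    refine ih (mem_span_of_X_mul_mem hm hij ?_)
    rwa [← mul_assoc, ← pow_succ']

theorem prodX_ne_zero : prodX K ≠ 0 := by simp [prodX]

theorem prodX_dvd_of_dvd_psumX_mul (hm : m ≠ 0) (a : MvPolynomial (Fin 3) K)
    (h : prodX K ∣ psumX K m * a) : prodX K ∣ a := by
  have key : ∀ (i : Fin 3) (r a : MvPolynomial (Fin 3) K), X i * r ∣ psumX K m * a →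
      ∃ b, a = X i * b ∧ r ∣ psumX K m * b := by
    intro i r a h
    obtain ⟨b, rfl⟩ := (X_prime.dvd_or_dvd (dvd_of_mul_right_dvd h)).resolve_left
      (not_X_dvd_psumX hm i)
    refine ⟨b, rfl, ?_⟩
    rw [mul_left_comm] at h
    exact (mul_dvd_mul_iff_left (X_ne_zero i)).1 h
  obtain ⟨a, rfl, h₁⟩ := key 0 (X 1 * X 2) a (by rwa [← mul_assoc])
  obtain ⟨a, rfl, h₂⟩ := key 1 (X 2) a h₁
  obtain ⟨a, rfl, -⟩ := key 2 1 a (by rwa [mul_one])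
  exact ⟨a, by rw [prodX]; ring⟩

/-- The ideal `(xyz, q)` is the intersection of the three ideals `(X j, q)`: the variables are split
off one at a time, each being regular modulo the ideal that belongs to a different variable. -/
theorem mem_span_prodX_of_forall (hm : m ≠ 0) {g : MvPolynomial (Fin 3) K}
    (h : ∀ j, g ∈ Ideal.span {X j, psumX K m}) : g ∈ Ideal.span {prodX K, psumX K m} := by
  have key : ∀ (i j : Fin 3) (r g : MvPolynomial (Fin 3) K), i ≠ j →
      X i * r * g ∈ Ideal.span {X j, psumX K m} → r * g ∈ Ideal.span {X j, psumX K m} :=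
    fun i j r g hij h => mem_span_of_X_mul_mem hm hij (by rwa [← mul_assoc])
  obtain ⟨g₀, u, hg⟩ := Ideal.mem_span_pair.1 (h 0)
  have h1 : X 0 * 1 * g₀ ∈ Ideal.span {X 1, psumX K m} := by
    rw [show X 0 * 1 * g₀ = g - u * psumX K m by rw [← hg]; ring]
    exact sub_mem (h 1) (Ideal.mul_mem_left _ _ (Ideal.subset_span (by simp)))
  obtain ⟨g₁, v, hg₁⟩ := Ideal.mem_span_pair.1 (key 0 1 1 g₀ (by decide) h1)
  have h2 : X 0 * X 1 * g₁ ∈ Ideal.span {X 2, psumX K m} := by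
    rw [show X 0 * X 1 * g₁ = g - (u + X 0 * v) * psumX K m by
      rw [← hg]; linear_combination X 0 * hg₁]
    exact sub_mem (h 2) (Ideal.mul_mem_left _ _ (Ideal.subset_span (by simp)))
  obtain ⟨g₂, w, hg₂⟩ := Ideal.mem_span_pair.1
    (mem_span_of_X_mul_mem hm (by decide) (key 0 2 _ _ (by decide) h2))
  refine Ideal.mem_span_pair.2 ⟨g₂, u + X 0 * v + X 0 * X 1 * w, ?_⟩
  rw [prodX]
  linear_combination X 0 * X 1 * hg₂ + X 0 * hg₁ + hg

/-- The polynomial `X 0 ^ (2 * m) - X 1 ^ m * X 2 ^ m`. -/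
def detX (K : Type*) [Field K] (m : ℕ) : MvPolynomial (Fin 3) K :=
  X 0 ^ m * X 0 ^ m - X 1 ^ m * X 2 ^ m

/-- It suffices to work modulo `(X j, q)` for each `j`. For `j = 0` one has `X 2 ^ m ≡ -X 1 ^ m`, so
the determinant is congruent to `X 1 ^ (2 m)`; for `j = 1, 2` it is congruent to `X 0 ^ (2 m)`. Both
are regular there. -/
theorem mem_span_of_detX_mul_mem (hm : m ≠ 0) (g : MvPolynomial (Fin 3) K)
    (h : detX K m * g ∈ Ideal.span {prodX K, psumX K m}) :
    g ∈ Ideal.span {prodX K, psumX K m} := by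
  obtain ⟨f, u, hf⟩ := Ideal.mem_span_pair.1 h
  refine mem_span_prodX_of_forall hm fun j => ?_
  obtain ⟨n, rfl⟩ : ∃ n, m = n + 1 := Nat.exists_eq_succ_of_ne_zero hm
  simp only [psumX, prodX, detX] at hf
  fin_cases j
  · change g ∈ Ideal.span {X 0, _}
    refine mem_span_of_X_pow_mul_mem hm (i := 1) (by decide) (2 * (n + 1))
      (Ideal.mem_span_pair.2 ⟨f * X 1 * X 2 - X 0 ^ n * X 1 ^ (n + 1) * g - X 0 ^ n * X 0 ^ (n + 1) * g,
        u + X 1 ^ (n + 1) * g, ?_⟩)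
    simp only [psumX]
    linear_combination hf
  · change g ∈ Ideal.span {X 1, _}
    refine mem_span_of_X_pow_mul_mem hm (i := 0) (by decide) (2 * (n + 1))
      (Ideal.mem_span_pair.2 ⟨f * X 0 * X 2 + X 1 ^ n * X 2 ^ (n + 1) * g, u, ?_⟩)
    simp only [psumX]
    linear_combination hf
  · change g ∈ Ideal.span {X 2, _}
    refine mem_span_of_X_pow_mul_mem hm (i := 0) (by decide) (2 * (n + 1))
      (Ideal.mem_span_pair.2 ⟨f * X 0 * X 1 + X 2 ^ n * X 1 ^ (n + 1) * g, u, ?_⟩)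
    simp only [psumX]
    linear_combination hf

theorem matrixSeq_zero_mulVec (u : Fin 2 → MvPolynomial (Fin 3) K) :
    matrixSeq K m 0 *ᵥ u = prodX K • u := by
  ext i : 1
  fin_cases i <;> simp [matrixSeq, prodX, Matrix.mulVec, dotProduct, Fin.sum_univ_two]

theorem matrixSeq_one_mulVec (u : Fin 2 → MvPolynomial (Fin 3) K) :
    matrixSeq K m 1 *ᵥ u = psumX K m • u := by
  ext i : 1
  fin_cases i <;> simp [matrixSeq, psumX, Matrix.mulVec, dotProduct, Fin.sum_univ_two]

theorem matrixSeq_two_mulVec (u : Fin 2 → MvPolynomial (Fin 3) K) :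
    matrixSeq K m 2 *ᵥ u = ![-X 0 ^ m * u 0 + X 1 ^ m * u 1, X 2 ^ m * u 0 - X 0 ^ m * u 1] := by
  ext i : 1
  fin_cases i <;> simp [matrixSeq, Matrix.mulVec, dotProduct, Fin.sum_univ_two, sub_eq_add_neg]

/-- Multiplying by the adjugate of the third matrix replaces it by its determinant, which is regular
modulo `(xyz, q)`. -/
theorem mem_span_of_matrixSeq_two_mulVec_mem (hm : m ≠ 0) (u : Fin 2 → MvPolynomial (Fin 3) K)
    (h : ∀ i, (matrixSeq K m 2 *ᵥ u) i ∈ Ideal.span {prodX K, psumX K m}) (i : Fin 2) :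
    u i ∈ Ideal.span {prodX K, psumX K m} := by
  rw [matrixSeq_two_mulVec] at h
  have h0 := h 0
  have h1 := h 1
  simp only [Matrix.cons_val_zero, Matrix.cons_val_one] at h0 h1
  refine mem_span_of_detX_mul_mem hm _ ?_
  fin_cases i
  · change detX K m * u 0 ∈ _
    rw [show detX K m * u 0 = -X 0 ^ m * (-X 0 ^ m * u 0 + X 1 ^ m * u 1) +
      -X 1 ^ m * (X 2 ^ m * u 0 - X 0 ^ m * u 1) by rw [detX]; ring]
    exact add_mem (Ideal.mul_mem_left _ _ h0) (Ideal.mul_mem_left _ _ h1)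
  · change detX K m * u 1 ∈ _
    rw [show detX K m * u 1 = -X 2 ^ m * (-X 0 ^ m * u 0 + X 1 ^ m * u 1) +
      -X 0 ^ m * (X 2 ^ m * u 0 - X 0 ^ m * u 1) by rw [detX]; ring]
    exact add_mem (Ideal.mul_mem_left _ _ h0) (Ideal.mul_mem_left _ _ h1)

theorem matrixSeq_commute (k l : Fin 3) : Commute (matrixSeq K m k) (matrixSeq K m l) := by
  rw [commute_iff_eq]
  fin_cases k <;> fin_cases l <;>
    simp only [matrixSeq, Fin.zero_eta, Fin.mk_one, Fin.reduceFinMk, Matrix.cons_val] <;>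
    ext i j : 2 <;> fin_cases i <;> fin_cases j <;>
    simp [Matrix.mul_apply, Fin.sum_univ_two] <;> ring_nf

theorem constantCoeff_matrixSeq (hm : m ≠ 0) (k : Fin 3) (i j : Fin 2) :
    constantCoeff (matrixSeq K m k i j) = 0 := by
  fin_cases k <;> fin_cases i <;> fin_cases j <;> simp [matrixSeq, hm]

theorem matrixSeq_det_isRegular (hm : m ≠ 0) :
    RingTheory.Sequence.IsRegular (MvPolynomial (Fin 3) K)
      (List.ofFn fun k => (matrixSeq K m k).det) := by
  have e : (List.ofFn fun k => (matrixSeq K m k).det) =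
      [prodX K ^ 2, psumX K m ^ 2, detX K m] := by
    simp only [List.ofFn_succ, List.ofFn_zero, matrixSeq, Matrix.det_fin_two, prodX, psumX, detX]
    simp [pow_two]
  rw [e]
  refine ⟨isWeaklyRegular_sq_sq (fun a ha => (mul_eq_zero.1 ha).resolve_left prodX_ne_zero)
    (prodX_dvd_of_dvd_psumX_mul hm) (mem_span_of_detX_mul_mem hm), fun h => ?_⟩
  rw [Ideal.smul_eq_mul, Ideal.mul_top] at h
  have h1 : (1 : MvPolynomial (Fin 3) K) ∈ Ideal.ofList [prodX K ^ 2, psumX K m ^ 2, detX K m] := by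
    rw [← h]; trivial
  have h2 : Ideal.ofList [prodX K ^ 2, psumX K m ^ 2, detX K m] ≤
      RingHom.ker (constantCoeff : MvPolynomial (Fin 3) K →+* K) := by
    refine Ideal.span_le.2 fun f hf => ?_
    simp only [List.mem_cons, List.not_mem_nil, or_false] at hf
    rcases hf with rfl | rfl | rfl <;> simp [prodX, psumX, detX, hm]
  simpa using h2 h1

end Invariants

/-! ### Dunkl operators -/

section Reflections

variable {K : Type*} [Field K] {n : ℕ} {G : Subgroup (GL (Fin n) K)}

/-- The matrix of a group element. -/
abbrev toMat (a : G) : Matrix (Fin n) (Fin n) K := ((a : GL (Fin n) K) : Matrix (Fin n) (Fin n) K)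

theorem toMat_mul (a b : G) : toMat (a * b) = toMat a * toMat b := rfl

theorem toMat_one : toMat (1 : G) = 1 := rfl

theorem toMat_inv_mul (a : G) : toMat a⁻¹ * toMat a = 1 := by
  rw [← toMat_mul, inv_mul_cancel, toMat_one]

/-- The coefficient of `c s` in the commutator `[y j, x i]`, up to sign. -/
def reflCoeff (s : G) (i j : Fin n) : K := (1 - toMat s⁻¹) i j

theorem reflCoeff_apply (s : G) (i j : Fin n) :
    reflCoeff s i j = (if i = j then 1 else 0) - entry s⁻¹ i j := by
  rw [reflCoeff, Matrix.sub_apply, Matrix.one_apply]; rfl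

theorem exists_eq_mul_of_rank_eq_one {M : Matrix (Fin n) (Fin n) K} (h : M.rank = 1) :
    ∃ a b : Fin n → K, b ≠ 0 ∧ ∀ i j, M i j = a i * b j := by
  rw [Matrix.rank, finrank_eq_one_iff'] at h
  obtain ⟨v, hv, hs⟩ := h
  have hb : ∀ j, ∃ b : K, b • (v : Fin n → K) = M.col j := fun j => by
    obtain ⟨b, hb⟩ := hs ⟨M.col j, Pi.single j 1, by simp⟩
    exact ⟨b, congrArg Subtype.val hb⟩
  choose b hb using hb
  refine ⟨v, b, ?_, fun i j => ?_⟩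
  · rintro rfl
    obtain ⟨w, hw⟩ := v.2
    apply hv
    ext i
    have hM : M = 0 := by
      ext i j
      have := congrFun (hb j) i
      simpa using this.symm
    rw [← hw, hM]
    simp
  · have := congrFun (hb j) i
    simp only [Pi.smul_apply, smul_eq_mul, Matrix.col_apply] at this
    rw [← this, mul_comm]

/-- Because `1 - s⁻¹ = -s⁻¹ (1 - s)`, the rank one matrices of `s` and `s⁻¹` share the row factor
`b`. This common factor is what makes the Dunkl operators commute. -/
theorem Reflection.exists_eq_mul (s : Reflection G) : ∃ a a' b : Fin n → K, b ≠ 0 ∧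
    (∀ i j, (1 - toMat s.1) i j = a i * b j) ∧ ∀ i j, reflCoeff s.1 i j = a' i * b j := by
  obtain ⟨a, b, hb, h⟩ := exists_eq_mul_of_rank_eq_one s.2.2
  refine ⟨a, -(toMat s.1⁻¹ *ᵥ a), b, hb, h, fun i j => ?_⟩
  have e : 1 - toMat s.1⁻¹ = -(toMat s.1⁻¹ * (1 - toMat s.1)) := by
    rw [mul_sub, toMat_inv_mul, mul_one, neg_sub]
  rw [reflCoeff, e, Matrix.neg_apply, Matrix.mul_apply, Pi.neg_apply, Matrix.mulVec, dotProduct, neg_mul,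
    Finset.sum_mul]
  simp only [h, mul_assoc]

theorem IsReflection.conj {s : GL (Fin n) K} (h : IsReflection s) (g : GL (Fin n) K) :
    IsReflection (g * s * g⁻¹) := by
  refine ⟨(MulAut.conj g).toMonoidHom.isOfFinOrder h.1, ?_⟩
  have e : (1 - ((g * s * g⁻¹ : GL (Fin n) K) : Matrix (Fin n) (Fin n) K)) =
      (g : Matrix (Fin n) (Fin n) K) * (1 - (s : Matrix (Fin n) (Fin n) K)) *
        ((g⁻¹ : GL (Fin n) K) : Matrix (Fin n) (Fin n) K) := by
    rw [mul_sub, sub_mul, mul_one, ← Units.val_mul, mul_inv_cancel, Units.val_mul, Units.val_mul,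
      Units.val_one]
  rw [e, Matrix.rank_mul_eq_left_of_isUnit_det _ _ ((Matrix.isUnit_iff_isUnit_det _).1 (Units.isUnit _)),
    Matrix.rank_mul_eq_right_of_isUnit_det _ _ ((Matrix.isUnit_iff_isUnit_det _).1 (Units.isUnit _))]
  exact h.2

/-- Conjugation acts on the reflections. -/
def conjReflection (g : G) : Reflection G ≃ Reflection G where
  toFun s := ⟨g * s.1 * g⁻¹, s.2.conj g⟩
  invFun s := ⟨g⁻¹ * s.1 * g, by have := s.2.conj (g⁻¹ : GL (Fin n) K); rwa [inv_inv] at this⟩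
  left_inv s := by ext1; simp [mul_assoc]
  right_inv s := by ext1; simp [mul_assoc]

theorem conjClass_conjReflection (g : G) (s : Reflection G) :
    (conjReflection g s).conjClass = s.conjClass := by
  refine Subtype.ext ?_
  exact ConjClasses.mk_eq_mk_iff_isConj.2 (isConj_iff.2 ⟨g⁻¹, by simp [conjReflection, mul_assoc]⟩)

end Reflections

/-! ### Dunkl operators and the polynomial representation at ħ = 0 -/

section Dunkl

variable {K : Type*} [Field K] {n : ℕ} {G : Subgroup (GL (Fin n) K)}

/-- The action of a group element on polynomials. -/
def polyAct (a : G) : MvPolynomial (Fin n) K →ₐ[K] MvPolynomial (Fin n) K :=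
  aeval fun i => ∑ j, entry a⁻¹ i j • X j

theorem polyAct_X (a : G) (i : Fin n) : polyAct a (X i) = ∑ j, entry a⁻¹ i j • X j := by
  simp [polyAct]

theorem polyAct_mul (a b : G) : polyAct (a * b) = (polyAct a).comp (polyAct b) := by
  refine MvPolynomial.algHom_ext fun i => ?_
  simp only [AlgHom.comp_apply, polyAct_X, map_sum, map_smul, Finset.smul_sum, smul_smul]
  rw [Finset.sum_comm]
  refine Finset.sum_congr rfl fun j _ => ?_
  rw [← Finset.sum_smul]
  congr 1

theorem polyAct_one : polyAct (1 : G) = AlgHom.id K _ := by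
  refine MvPolynomial.algHom_ext fun i => ?_
  simp [polyAct_X, entry, Matrix.one_apply]

variable {ι : Type*} (π : G →* Equiv.Perm ι)

/-- The action of a group element on polynomial vectors, through a permutation representation. -/
def actOp (a : G) : Module.End K (ι → MvPolynomial (Fin n) K) where
  toFun w := fun l => polyAct a (w ((π a)⁻¹ l))
  map_add' _ _ := by ext1; simp
  map_smul' _ _ := by ext1; simp

theorem actOp_apply (a : G) (w : ι → MvPolynomial (Fin n) K) (l : ι) :
    actOp π a w l = polyAct a (w ((π a)⁻¹ l)) := rfl

theorem actOp_mul (a b : G) : actOp π (a * b) = actOp π a * actOp π b := by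
  refine LinearMap.ext fun w => funext fun l => ?_
  simp [actOp_apply, polyAct_mul]

theorem actOp_one : actOp π (1 : G) = 1 := by
  refine LinearMap.ext fun w => funext fun l => ?_
  simp [actOp_apply, polyAct_one]

theorem actOp_smul (a : G) (f : MvPolynomial (Fin n) K) (w : ι → MvPolynomial (Fin n) K) :
    actOp π a (f • w) = polyAct a f • actOp π a w := by
  ext1 l
  simp [actOp_apply]

/-- The constant polynomial vector of a vector of scalars. -/
def constVec (n : ℕ) (v : ι → K) : ι → MvPolynomial (Fin n) K := fun l => C (v l)

theorem constVec_add (v w : ι → K) : constVec n (v + w) = constVec n v + constVec n w := by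
  ext1; simp [constVec]

theorem constVec_smul (a : K) (v : ι → K) : constVec n (a • v) = a • constVec n v := by
  ext1; simp [constVec, smul_eq_C_mul]

theorem constVec_neg (v : ι → K) : constVec n (-v) = -constVec n v := by
  ext1; simp [constVec]

theorem actOp_constVec (a : G) (v : ι → K) :
    actOp π a (constVec n v) = constVec n fun l => v ((π a)⁻¹ l) := by
  ext1 l
  rw [actOp_apply, constVec, constVec]
  exact (polyAct a).commutes _

/-- Multiplication by a polynomial. -/
abbrev mulOp (ι : Type*) (f : MvPolynomial (Fin n) K) :
    Module.End K (ι → MvPolynomial (Fin n) K) :=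
  Algebra.lsmul K K (ι → MvPolynomial (Fin n) K) f

variable [Fintype ι]

theorem span_smul_constVec (w : ι → MvPolynomial (Fin n) K) :
    w ∈ Submodule.span (MvPolynomial (Fin n) K) (Set.range (constVec (K := K) (ι := ι) n)) := by
  classical
  have e : w = ∑ l, w l • constVec n (Pi.single l (1 : K)) := by
    ext1 l
    rw [Finset.sum_apply, Finset.sum_eq_single l]
    · simp [constVec]
    · intro b _ hb
      simp [constVec, hb.symm]
    · simp
  rw [e]
  exact Submodule.sum_mem _ fun l _ => Submodule.smul_mem _ _ (Submodule.subset_span ⟨_, rfl⟩)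

/-- An induction principle for polynomial vectors. -/
theorem polyVec_induction {P : (ι → MvPolynomial (Fin n) K) → Prop}
    (hC : ∀ v, P (constVec n v)) (hadd : ∀ u w, P u → P w → P (u + w))
    (hX : ∀ i w, P w → P ((X i : MvPolynomial (Fin n) K) • w)) (w) : P w := by
  have hf : ∀ (f : MvPolynomial (Fin n) K) (v : ι → K), P (f • constVec n v) := by
    intro f v
    induction f using MvPolynomial.induction_on with
    | C a =>
      rw [← algebraMap_eq, algebraMap_smul, ← constVec_smul]
      exact hC _
    | add f g hf hg => rw [add_smul]; exact hadd _ _ hf hg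
    | mul_X f i hf => rw [mul_comm, mul_smul]; exact hX _ _ hf
  induction span_smul_constVec w using Submodule.span_induction with
  | mem x hx => obtain ⟨v, rfl⟩ := hx; exact hC v
  | zero => simpa using hf 0 0
  | add x y _ _ hx hy => exact hadd _ _ hx hy
  | smul f x hx hP =>
    clear hP
    induction hx using Submodule.span_induction generalizing f with
    | mem x hx => obtain ⟨v, rfl⟩ := hx; exact hf f v
    | zero => simpa using hf 0 0
    | add x y _ _ hx hy => rw [smul_add]; exact hadd _ _ (hx f) (hy f)
    | smul g x _ hx => rw [smul_smul]; exact hx _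

/-- The identities between Dunkl operators are checked through this criterion: the difference of the
two sides kills constants, and its commutators with the variables are under control. -/
theorem end_eq_zero {E : Module.End K (ι → MvPolynomial (Fin n) K)}
    (hC : ∀ v, E (constVec n v) = 0)
    (hX : ∀ i w, E w = 0 → E ((X i : MvPolynomial (Fin n) K) • w) = 0) : E = 0 :=
  LinearMap.ext fun w => polyVec_induction (P := fun w => E w = 0) hC
    (fun u w hu hw => by rw [map_add, hu, hw, add_zero]) hX w

omit [Fintype ι] in
-- `T` is the divided difference `f ↦ (f - s f) / α` with `α = ∑ b j x j`. Divisibility holds for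
-- the variables, since `s x i = x i - a' i α`, and extends to products; linearity and the twisted
-- Leibniz rule follow by cancelling `α`.
theorem Reflection.exists_diffOp (s : Reflection G) : ∃ (a' b : Fin n → K)
    (T : MvPolynomial (Fin n) K →ₗ[K] MvPolynomial (Fin n) K),
    (∀ i j, reflCoeff s.1 i j = a' i * b j) ∧ (∀ f, polyAct s.1 f = f → T f = 0) ∧
    ∀ i f, T (X i * f) = X i * T f + a' i • polyAct s.1 f := by
  obtain ⟨-, a', b, hb, -, h⟩ := s.exists_eq_mul
  let α : MvPolynomial (Fin n) K := ∑ j, b j • X j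
  have hα : α ≠ 0 := by
    intro h0
    apply hb
    ext j
    have := congrArg (coeff (Finsupp.single j 1)) h0
    simpa [α, coeff_sum, coeff_X, Finsupp.single_left_inj] using this
  have hX : ∀ i, polyAct s.1 (X i) = X i - a' i • α := by
    intro i
    have : ∀ j, entry s.1⁻¹ i j = (if i = j then 1 else 0) - a' i * b j := fun j => by
      rw [← h, reflCoeff_apply]; ring
    simp [polyAct_X, this, α, sub_smul, Finset.smul_sum, smul_smul]
  have hd : ∀ f, α ∣ f - polyAct s.1 f := by
    intro f
    induction f using MvPolynomial.induction_on with
    | C r => rw [← algebraMap_eq, AlgHom.commutes, sub_self]; exact dvd_zero _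
    | add f g hf hg => rw [map_add, add_sub_add_comm]; exact dvd_add hf hg
    | mul_X f i hf =>
      have : f * X i - polyAct s.1 (f * X i) =
          (f - polyAct s.1 f) * X i + a' i • (polyAct s.1 f * α) := by
        rw [map_mul, hX, mul_sub, mul_smul_comm]; ring
      rw [this]
      exact dvd_add (dvd_mul_of_dvd_left hf _) (dvd_smul_of_dvd _ (dvd_mul_left _ _))
  choose T hT using hd
  refine ⟨a', b, ⟨⟨T, fun f g => mul_left_cancel₀ hα ?_⟩, fun r f => mul_left_cancel₀ hα ?_⟩, h,
    fun f hf => mul_left_cancel₀ hα ?_, fun i f => mul_left_cancel₀ hα ?_⟩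
  · rw [mul_add, ← hT, ← hT, ← hT, map_add]; ring
  · simp only [RingHom.id_apply, mul_smul_comm]
    rw [← hT, ← hT, map_smul, smul_sub]
  · change α * T f = _
    rw [← hT, hf, sub_self, mul_zero]
  · change α * T (X i * f) = α * (X i * T f + _)
    rw [mul_add, mul_left_comm, ← hT, ← hT, map_mul, hX, sub_mul, mul_smul_comm, smul_mul_assoc]
    ring

variable [Fintype (Reflection G)] (c : ReflectionClass G → K)

/-- The operator by which the commutator `[y j, x i]` acts. -/
def commOp (i j : Fin n) : Module.End K (ι → MvPolynomial (Fin n) K) :=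
  ∑ s : Reflection G, (-(c s.conjClass * reflCoeff s.1 i j)) • actOp π s.1

omit [Fintype ι] in
theorem commOp_apply (i j : Fin n) (w : ι → MvPolynomial (Fin n) K) :
    commOp π c i j w = ∑ s : Reflection G,
      (-(c s.conjClass * reflCoeff s.1 i j)) • actOp π s.1 w := by
  simp [commOp, LinearMap.sum_apply]

omit [Fintype ι] in
-- The operator is `-∑ c_s b_s(j) T_s ⊗ s`. With `ħ = 0` there is no derivative term, so it kills
-- invariants times constants. These two properties are all that is used later.
theorem exists_dunkl (j : Fin n) : ∃ D : Module.End K (ι → MvPolynomial (Fin n) K),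
    (∀ f v, (∀ a : G, polyAct a f = f) → D (f • constVec n v) = 0) ∧ ∀ i w, D ((X i : MvPolynomial (Fin n) K) • w) =
      (X i : MvPolynomial (Fin n) K) • D w + commOp π c i j w := by
  choose a' b T h hC hX using Reflection.exists_diffOp (G := G)
  let Δ : Reflection G → Module.End K (ι → MvPolynomial (Fin n) K) := fun s =>
    { toFun := fun w l => b s j • T s (w ((π s.1)⁻¹ l))
      map_add' := fun _ _ => by ext1; simp
      map_smul' := fun r w => by
        ext1 l
        rw [RingHom.id_apply, Pi.smul_apply, Pi.smul_apply, map_smul, smul_comm] }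
  have hΔ : ∀ s w l, Δ s w l = b s j • T s (w ((π s.1)⁻¹ l)) := fun _ _ _ => rfl
  refine ⟨∑ s, (-c s.conjClass) • Δ s, fun f v hf => ?_, fun i w => ?_⟩
  · simp only [LinearMap.sum_apply, LinearMap.smul_apply]
    refine Finset.sum_eq_zero fun s _ => ?_
    ext1 l
    rw [Pi.smul_apply, hΔ, Pi.smul_apply, constVec, smul_eq_mul, mul_comm, ← smul_eq_C_mul,
      map_smul, hC s f (hf s.1)]
    simp
  · simp only [commOp_apply, LinearMap.sum_apply, LinearMap.smul_apply, Finset.smul_sum]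
    rw [← Finset.sum_add_distrib]
    refine Finset.sum_congr rfl fun s _ => ?_
    ext1 l
    rw [Pi.add_apply, Pi.smul_apply, Pi.smul_apply, Pi.smul_apply, Pi.smul_apply, hΔ, hΔ,
      actOp_apply, Pi.smul_apply, smul_eq_mul, smul_eq_mul, hX, h, smul_add, smul_add,
      mul_smul_comm, mul_smul_comm, smul_smul (b s j), smul_smul (-c _) (b s j * _),
      mul_comm (b s j), neg_mul]

/-- The Dunkl operators with `hbar = 0`. -/
def dunkl (j : Fin n) : Module.End K (ι → MvPolynomial (Fin n) K) := (exists_dunkl π c j).choose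

omit [Fintype ι] in
theorem dunkl_smul_constVec (j : Fin n) {f : MvPolynomial (Fin n) K}
    (hf : ∀ a : G, polyAct a f = f) (v : ι → K) : dunkl π c j (f • constVec n v) = 0 :=
  (exists_dunkl π c j).choose_spec.1 f v hf

omit [Fintype ι] in
theorem dunkl_constVec (j : Fin n) (v : ι → K) : dunkl π c j (constVec n v) = 0 := by
  simpa using dunkl_smul_constVec π c j (fun a => map_one (polyAct a)) v

omit [Fintype ι] in
theorem dunkl_X_smul (j i : Fin n) (w : ι → MvPolynomial (Fin n) K) :
    dunkl π c j ((X i : MvPolynomial (Fin n) K) • w) =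
      (X i : MvPolynomial (Fin n) K) • dunkl π c j w + commOp π c i j w :=
  (exists_dunkl π c j).choose_spec.2 i w

omit [Fintype ι] in
-- Conjugation by `g` permutes the reflections, preserves `c`, and transforms the matrix `1 - s⁻¹`
-- by base change.
theorem actOp_commOp (g : G) (k j : Fin n) (w : ι → MvPolynomial (Fin n) K) :
    actOp π g (commOp π c k j w) =
      ∑ l, ∑ i, (entry g⁻¹ k l * entry g i j) • commOp π c l i (actOp π g w) := by
  have e : ∀ s : Reflection G, reflCoeff s.1 k j =
      ∑ l, ∑ i, (entry g⁻¹ k l * entry g i j) * reflCoeff (conjReflection g s).1 l i := by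
    intro s
    have : 1 - toMat s.1⁻¹ = toMat g⁻¹ * (1 - toMat (conjReflection g s).1⁻¹) * toMat g := by
      simp only [conjReflection, Equiv.coe_fn_mk, mul_sub, sub_mul, mul_one, toMat_inv_mul]
      rw [← toMat_mul, ← toMat_mul]
      congr 2
      group
    rw [reflCoeff, this, Matrix.mul_apply]
    simp only [Matrix.mul_apply, Finset.sum_mul]
    rw [Finset.sum_comm]
    refine Finset.sum_congr rfl fun l _ => Finset.sum_congr rfl fun i _ => ?_
    simp only [entry, reflCoeff]
    ring
  have e2 : ∀ l i, commOp π c l i (actOp π g w) = ∑ s : Reflection G,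
      (-(c s.conjClass * reflCoeff (conjReflection g s).1 l i)) •
        actOp π g (actOp π s.1 w) := by
    intro l i
    rw [commOp_apply, ← Equiv.sum_comp (conjReflection g)]
    refine Finset.sum_congr rfl fun s _ => ?_
    rw [conjClass_conjReflection, ← Module.End.mul_apply, ← Module.End.mul_apply, ← actOp_mul,
      ← actOp_mul]
    congr 3
    simp [conjReflection]
  simp only [e2, Finset.smul_sum, smul_smul]
  rw [commOp_apply, map_sum, Finset.sum_congr rfl fun l _ => Finset.sum_comm, Finset.sum_comm]
  refine Finset.sum_congr rfl fun s _ => ?_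
  rw [map_smul, e s, Finset.mul_sum, ← Finset.sum_neg_distrib, Finset.sum_smul]
  refine Finset.sum_congr rfl fun l _ => ?_
  rw [Finset.mul_sum, ← Finset.sum_neg_distrib, Finset.sum_smul]
  refine Finset.sum_congr rfl fun i _ => ?_
  congr 1
  ring

/-- Both sides kill constants, and by `actOp_commOp` they change in the same way under
multiplication by a variable. -/
theorem actOp_dunkl (g : G) (j : Fin n) (w : ι → MvPolynomial (Fin n) K) :
    actOp π g (dunkl π c j w) = ∑ i, entry g i j • dunkl π c i (actOp π g w) := by
  suffices h : actOp π g ∘ₗ dunkl π c j - ∑ i, entry g i j • (dunkl π c i ∘ₗ actOp π g) = 0 by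
    have := LinearMap.congr_fun h w
    simpa [sub_eq_zero, LinearMap.sum_apply] using this
  refine end_eq_zero (fun v => ?_) fun k w hw => ?_
  · simp [dunkl_constVec, actOp_constVec]
  · have h := actOp_commOp π c g k j w
    simp only [LinearMap.sub_apply, LinearMap.comp_apply, LinearMap.sum_apply,
      LinearMap.smul_apply] at hw ⊢
    rw [sub_eq_zero] at hw ⊢
    simp only [dunkl_X_smul, map_add, actOp_smul, polyAct_X, Finset.sum_smul, map_sum, map_smul,
      smul_add, Finset.sum_add_distrib, smul_assoc, hw, h, Finset.smul_sum]
    congr 1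
    · refine Finset.sum_congr rfl fun l _ => Finset.sum_congr rfl fun i _ => ?_
      rw [smul_comm (X i : MvPolynomial (Fin n) K) (entry g l j), smul_comm (entry g⁻¹ k i)]
    · rw [Finset.sum_comm]
      refine Finset.sum_congr rfl fun l _ => Finset.sum_congr rfl fun i _ => ?_
      rw [smul_smul, mul_comm]

/-- By equivariance `D_j s - s D_j = ∑ (1 - s)_(l j) D_l s`, so each reflection contributes with
coefficients `a'_k b_i a_l b_j`. This is symmetric in `i` and `j` thanks to the shared factor `b`.
-/
theorem commOp_dunkl_sub_symm (k i j : Fin n) (w : ι → MvPolynomial (Fin n) K) :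
    commOp π c k i (dunkl π c j w) - dunkl π c j (commOp π c k i w) =
      commOp π c k j (dunkl π c i w) - dunkl π c i (commOp π c k j w) := by
  have key : ∀ k i j, commOp π c k i (dunkl π c j w) - dunkl π c j (commOp π c k i w) =
      ∑ s : Reflection G, (c s.conjClass * reflCoeff s.1 k i) •
        ∑ l, (1 - toMat s.1) l j • dunkl π c l (actOp π s.1 w) := by
    intro k i j
    rw [commOp_apply, commOp_apply, map_sum, ← Finset.sum_sub_distrib]
    refine Finset.sum_congr rfl fun s _ => ?_
    rw [map_smul, ← smul_sub, neg_smul, ← smul_neg, neg_sub, actOp_dunkl]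
    congr 1
    simp only [Matrix.sub_apply, sub_smul, Finset.sum_sub_distrib, Matrix.one_apply, ite_smul,
      one_smul, zero_smul, Finset.sum_ite_eq', Finset.mem_univ, if_true]
    rfl
  rw [key, key]
  refine Finset.sum_congr rfl fun s _ => ?_
  obtain ⟨a, a', b, -, h1, h2⟩ := s.exists_eq_mul
  simp only [h1, h2, Finset.smul_sum, smul_smul]
  refine Finset.sum_congr rfl fun l _ => ?_
  congr 1
  ring

/-- By the Jacobi identity, the commutator of `[D_i, D_j]` with `x_k` is the difference of the two
sides of `commOp_dunkl_sub_symm`. -/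
theorem dunkl_comm (i j : Fin n) (w : ι → MvPolynomial (Fin n) K) :
    dunkl π c i (dunkl π c j w) = dunkl π c j (dunkl π c i w) := by
  suffices h : dunkl π c i ∘ₗ dunkl π c j - dunkl π c j ∘ₗ dunkl π c i = 0 by
    simpa [sub_eq_zero] using LinearMap.congr_fun h w
  refine end_eq_zero (fun v => ?_) fun k w hw => ?_
  · simp [dunkl_constVec]
  · have h := commOp_dunkl_sub_symm π c k i j w
    simp only [LinearMap.sub_apply, LinearMap.comp_apply, sub_eq_zero] at hw h ⊢
    simp only [dunkl_X_smul, map_add, hw]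
    rw [eq_comm, ← sub_eq_zero] at h
    rw [← sub_eq_zero, ← neg_eq_zero, ← h]
    abel

/-- The images of the generators under the polynomial representation. -/
def genOp : Gen G → Module.End K (ι → MvPolynomial (Fin n) K)
  | .x i => mulOp ι (X i)
  | .y j => dunkl π c j
  | .g a => actOp π a

/-- The representation of the Cherednik algebra with `hbar = 0` on polynomial vectors. -/
def dunklHom : CherednikAlgebra G 0 c →ₐ[K] Module.End K (ι → MvPolynomial (Fin n) K) :=
  RingQuot.liftAlgHom K ⟨FreeAlgebra.lift K (genOp π c), by
    intro u v h
    refine LinearMap.ext fun w => ?_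
    induction h with
    | one => simp [genOp, actOp_one]
    | mul a b => simp [genOp, actOp_mul]
    | gx a i => simp [genOp, LinearMap.sum_apply, actOp_smul, polyAct_X, Finset.sum_smul]
    | gy a j => simp [genOp, LinearMap.sum_apply, actOp_dunkl]
    | xx i j => simp [genOp, smul_smul, mul_comm]
    | yy i j => simp [genOp, dunkl_comm π c i j]
    | yx j i =>
      rw [finsum_eq_sum_of_fintype]
      simp [genOp, LinearMap.sum_apply, dunkl_X_smul, commOp_apply, reflCoeff_apply]⟩

theorem dunklHom_gen (u : Gen G) : dunklHom π c (gen G 0 c u) = genOp π c u := by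
  rw [dunklHom, gen]
  erw [RingQuot.liftAlgHom_mkAlgHom_apply]
  simp

end Dunkl

/-! ### Gradings -/

theorem finsupp_nat_induction {σ : Type*} {P : (σ →₀ ℕ) → Prop} (h0 : P 0)
    (hs : ∀ μ i, P μ → P (μ + Finsupp.single i 1)) (μ : σ →₀ ℕ) : P μ := by
  induction μ using Finsupp.induction with
  | zero => exact h0
  | single_add a b f _ _ ih =>
    clear * - ih hs
    induction b with
    | zero => simpa using ih
    | succ b ihb =>
      have := hs _ a ihb
      rwa [add_right_comm, ← Finsupp.single_add] at this

section Grading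

variable {K : Type*} [Field K] {n : ℕ} {ι : Type*}

/-- The polynomial vectors that are homogeneous of degree `d`. -/
def vecPart (K : Type*) [Field K] (n : ℕ) (ι : Type*) (d : ℤ) :
    Submodule K (ι → MvPolynomial (Fin n) K) where
  carrier := {w | ∀ l μ, (μ.degree : ℤ) ≠ d → coeff μ (w l) = 0}
  zero_mem' := by simp
  add_mem' := by
    intro u w hu hw l μ h
    rw [Pi.add_apply, coeff_add, hu l μ h, hw l μ h, add_zero]
  smul_mem' := by
    intro a w hw l μ h
    rw [Pi.smul_apply, coeff_smul, hw l μ h, smul_zero]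

theorem monomial_smul_constVec_mem (μ : Fin n →₀ ℕ) (v : ι → K) :
    (monomial μ (1 : K)) • constVec n v ∈ vecPart K n ι μ.degree := by
  intro l ν h
  rw [Pi.smul_apply, constVec, smul_eq_mul, mul_comm, C_mul_monomial, coeff_monomial, if_neg]
  rintro rfl
  exact h rfl

theorem X_smul_mem_vecPart {d : ℤ} {w : ι → MvPolynomial (Fin n) K} (hw : w ∈ vecPart K n ι d)
    (i : Fin n) : (X i : MvPolynomial (Fin n) K) • w ∈ vecPart K n ι (d + 1) := by
  intro l μ h
  rw [Pi.smul_apply, smul_eq_mul, coeff_X_mul']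
  split_ifs with hi
  · refine hw l _ fun h' => h ?_
    have : (μ - Finsupp.single i 1) + Finsupp.single i 1 = μ := by
      refine tsub_add_cancel_of_le ?_
      rw [Finsupp.single_le_iff]
      exact Nat.one_le_iff_ne_zero.2 (Finsupp.mem_support_iff.1 hi)
    rw [← this, map_add, Finsupp.degree_single, ← h']
    push_cast
    rfl
  · rfl

variable [Fintype ι]

theorem vecPart_induction {d : ℤ} {P : (ι → MvPolynomial (Fin n) K) → Prop} (h0 : P 0)
    (hadd : ∀ u w, P u → P w → P (u + w))
    (hm : ∀ (μ : Fin n →₀ ℕ) v, (μ.degree : ℤ) = d → P ((monomial μ (1 : K)) • constVec n v))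
    {w : ι → MvPolynomial (Fin n) K} (hw : w ∈ vecPart K n ι d) : P w := by
  classical
  have e : w = ∑ l, ∑ μ ∈ (w l).support,
      (monomial μ (1 : K)) • constVec n (Pi.single l (coeff μ (w l))) := by
    ext1 k
    rw [Finset.sum_apply, Finset.sum_eq_single k]
    · rw [Finset.sum_apply]
      conv_lhs => rw [(w k).as_sum]
      refine Finset.sum_congr rfl fun μ _ => ?_
      simp [constVec, mul_comm, C_mul_monomial]
    · intro b _ hb
      simp [constVec, hb.symm]
    · simp
  rw [e]
  refine Finset.sum_induction _ P hadd h0 fun l _ => Finset.sum_induction _ P hadd h0 fun μ hμ => ?_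
  refine hm μ _ ?_
  by_contra hne
  exact (mem_support_iff.1 hμ) (hw l μ hne)

theorem map_mem_vecPart {T : Module.End K (ι → MvPolynomial (Fin n) K)} {δ : ℤ}
    (h : ∀ (μ : Fin n →₀ ℕ) v, T ((monomial μ (1 : K)) • constVec n v) ∈
      vecPart K n ι (μ.degree + δ)) {d : ℤ} {w : ι → MvPolynomial (Fin n) K}
    (hw : w ∈ vecPart K n ι d) : T w ∈ vecPart K n ι (d + δ) := by
  refine vecPart_induction (P := fun w => T w ∈ vecPart K n ι (d + δ)) ?_ ?_ ?_ hw
  · rw [map_zero]; exact zero_mem _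
  · intro u w hu hw
    rw [map_add]; exact add_mem hu hw
  · rintro μ v rfl
    exact h μ v

omit [Fintype ι] in
theorem monomial_add_single_smul (μ : Fin n →₀ ℕ) (i : Fin n)
    (w : ι → MvPolynomial (Fin n) K) : (monomial (μ + Finsupp.single i 1) (1 : K)) • w =
      (X i : MvPolynomial (Fin n) K) • (monomial μ (1 : K)) • w := by
  rw [smul_smul, monomial_add_single, pow_one, mul_comm]

omit [Fintype ι] in
theorem constVec_mem (v : ι → K) : constVec n v ∈ vecPart K n ι 0 := by
  have := monomial_smul_constVec_mem (0 : Fin n →₀ ℕ) v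
  simpa using this

variable {G : Subgroup (GL (Fin n) K)} (π : G →* Equiv.Perm ι)

theorem actOp_mem_vecPart (a : G) {d : ℤ} {w : ι → MvPolynomial (Fin n) K}
    (hw : w ∈ vecPart K n ι d) : actOp π a w ∈ vecPart K n ι d := by
  have := map_mem_vecPart (T := actOp π a) (δ := 0) ?_ hw
  · rwa [add_zero] at this
  intro μ v
  rw [add_zero]
  induction μ using finsupp_nat_induction with
  | h0 =>
    simp only [monomial_zero', C_1, one_smul, actOp_constVec, map_zero, Nat.cast_zero]
    exact constVec_mem _
  | hs μ i ih =>
    rw [monomial_add_single_smul, actOp_smul, polyAct_X, Finset.sum_smul]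
    refine Submodule.sum_mem _ fun j _ => ?_
    rw [smul_assoc]
    refine Submodule.smul_mem _ _ ?_
    rw [map_add, Finsupp.degree_single]
    push_cast
    exact X_smul_mem_vecPart ih j

variable [Fintype (Reflection G)] (c : ReflectionClass G → K)

theorem dunkl_mem_vecPart (j : Fin n) {d : ℤ} {w : ι → MvPolynomial (Fin n) K}
    (hw : w ∈ vecPart K n ι d) : dunkl π c j w ∈ vecPart K n ι (d + -1) := by
  refine map_mem_vecPart (fun μ v => ?_) hw
  induction μ using finsupp_nat_induction with
  | h0 =>
    simp only [monomial_zero', C_1, one_smul, dunkl_constVec]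
    exact zero_mem _
  | hs μ i ih =>
    rw [monomial_add_single_smul, dunkl_X_smul, map_add, Finsupp.degree_single]
    push_cast
    rw [add_neg_cancel_right]
    refine add_mem ?_ ?_
    · have := X_smul_mem_vecPart ih i
      rwa [neg_add_cancel_right] at this
    · rw [commOp_apply]
      exact Submodule.sum_mem _ fun s _ => Submodule.smul_mem _ _
        (actOp_mem_vecPart π s.1 (monomial_smul_constVec_mem μ v))

theorem genOp_mem_vecPart (u : Gen G) {d : ℤ} {w : ι → MvPolynomial (Fin n) K}
    (hw : w ∈ vecPart K n ι d) : genOp π c u w ∈ vecPart K n ι (d + u.degree) := by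
  cases u with
  | x i => exact X_smul_mem_vecPart hw i
  | y j => exact dunkl_mem_vecPart π c j hw
  | g a =>
    change actOp π a w ∈ vecPart K n ι (d + 0)
    rw [add_zero]
    exact actOp_mem_vecPart π a hw

theorem dunklHom_mem_vecPart {h : CherednikAlgebra G 0 c} {e : ℤ} (hh : h ∈ algebraPart G 0 c e)
    {d : ℤ} {w : ι → MvPolynomial (Fin n) K} (hw : w ∈ vecPart K n ι d) :
    dunklHom π c h w ∈ vecPart K n ι (d + e) := by
  induction hh using Submodule.span_induction with
  | mem x hx =>
    obtain ⟨L, rfl, rfl⟩ := hx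
    induction L with
    | nil => simpa using hw
    | cons u L ih =>
      simp only [List.map_cons, List.prod_cons, List.sum_cons, map_mul, Module.End.mul_apply,
        dunklHom_gen]
      rw [add_comm u.degree, ← add_assoc]
      exact genOp_mem_vecPart π c u ih
  | zero => simp
  | add x y _ _ hx hy => rw [map_add]; exact add_mem hx hy
  | smul a x _ hx => rw [map_smul]; exact Submodule.smul_mem _ _ hx

end Grading

/-! ### The polynomial model of the Verma module -/

section Model

variable {K : Type*} [Field K] {n : ℕ} {G : Subgroup (GL (Fin n) K)}

theorem subalgebra_eq_top_of_gen_mem {hbar : K} {c : ReflectionClass G → K}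
    {S : Subalgebra K (CherednikAlgebra G hbar c)} (h : ∀ u, gen G hbar c u ∈ S) : S = ⊤ := by
  rw [eq_top_iff]
  rintro x -
  obtain ⟨y, rfl⟩ := RingQuot.mkAlgHom_surjective K (Rel G hbar c) x
  induction y using FreeAlgebra.induction with
  | grade0 r => rw [AlgHom.commutes]; exact S.algebraMap_mem r
  | grade1 u => exact h u
  | mul a b ha hb => rw [map_mul]; exact S.mul_mem ha hb
  | add a b ha hb => rw [map_add]; exact S.add_mem ha hb

/-- A subspace of a module that is stable under the generators is stable under the algebra. -/
theorem smul_mem_of_gen_smul_mem {hbar : K} {c : ReflectionClass G → K} {M : Type*}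
    [AddCommGroup M] [Module (CherednikAlgebra G hbar c) M] [Module K M]
    [IsScalarTower K (CherednikAlgebra G hbar c) M] (N : Submodule K M)
    (hN : ∀ u, ∀ w ∈ N, gen G hbar c u • w ∈ N) (h : CherednikAlgebra G hbar c) {w : M}
    (hw : w ∈ N) : h • w ∈ N := by
  let S : Subalgebra K (CherednikAlgebra G hbar c) :=
    { carrier := {h | ∀ w ∈ N, h • w ∈ N}
      mul_mem' := fun {a b} ha hb w hw => by rw [mul_smul]; exact ha _ (hb _ hw)
      add_mem' := fun {a b} ha hb w hw => by rw [add_smul]; exact N.add_mem (ha _ hw) (hb _ hw)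
      algebraMap_mem' := fun r w hw => by rw [algebraMap_smul]; exact N.smul_mem _ hw }
  have hS : h ∈ S := by
    rw [subalgebra_eq_top_of_gen_mem (S := S) hN]; trivial
  exact hS w hw

theorem gen_g_mul_polyHom {hbar : K} {c : ReflectionClass G → K} (a : G)
    (f : MvPolynomial (Fin n) K) : gen G hbar c (.g a) * polyHom G hbar c f =
      polyHom G hbar c (polyAct a f) * gen G hbar c (.g a) := by
  induction f using MvPolynomial.induction_on with
  | C r =>
    rw [← algebraMap_eq, AlgHom.commutes, AlgHom.commutes, AlgHom.commutes]
    exact (Algebra.commutes r _).symm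
  | add f g hf hg => rw [map_add, mul_add, hf, hg, map_add, map_add, add_mul]
  | mul_X f i hf =>
    have h := RingQuot.mkAlgHom_rel K (Rel.gx (G := G) (hbar := hbar) (c := c) a i)
    simp only [map_mul, map_sum, map_smul] at h
    have hX : gen G hbar c (.g a) * gen G hbar c (.x i) =
      polyHom G hbar c (polyAct a (X i)) * gen G hbar c (.g a) := by
      rw [polyAct_X, map_sum]
      simp only [map_smul, polyHom_X]
      exact h
    rw [map_mul, ← mul_assoc, hf, mul_assoc, polyHom_X, hX, map_mul, map_mul, mul_assoc]

theorem gen_y_mul_gen_x [Fintype (Reflection G)] {c : ReflectionClass G → K} (j i : Fin n) :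
    gen G 0 c (.y j) * gen G 0 c (.x i) = gen G 0 c (.x i) * gen G 0 c (.y j) +
      ∑ s : Reflection G, (-(c s.conjClass * reflCoeff s.1 i j)) • gen G 0 c (.g s.1) := by
  have h := RingQuot.mkAlgHom_rel K (Rel.yx (G := G) (hbar := 0) (c := c) j i)
  rw [finsum_eq_sum_of_fintype] at h
  simp only [map_sub, map_mul, ite_self, map_zero, zero_sub, map_neg, map_sum, map_smul] at h
  simp only [neg_smul, Finset.sum_neg_distrib, reflCoeff_apply]
  exact sub_eq_iff_eq_add'.1 h

theorem algebraPart_gen_mul {hbar : K} {c : ReflectionClass G → K} {d : ℤ}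
    {h : CherednikAlgebra G hbar c} (hh : h ∈ algebraPart G hbar c d) (u : Gen G) :
    gen G hbar c u * h ∈ algebraPart G hbar c (d + u.degree) := by
  induction hh using Submodule.span_induction with
  | mem x hx =>
    obtain ⟨L, rfl, rfl⟩ := hx
    exact Submodule.subset_span ⟨u :: L, by simp [add_comm], by simp⟩
  | zero => simp
  | add x y _ _ hx hy => rw [mul_add]; exact add_mem hx hy
  | smul a x _ hx => rw [mul_smul_comm]; exact Submodule.smul_mem _ _ hx

theorem polyHom_monomial_mem {hbar : K} {c : ReflectionClass G → K} (μ : Fin n →₀ ℕ) :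
    polyHom G hbar c (monomial μ 1) ∈ algebraPart G hbar c μ.degree := by
  induction μ using finsupp_nat_induction with
  | h0 =>
    simp only [monomial_zero', map_one, map_zero, Nat.cast_zero]
    exact Submodule.subset_span ⟨[], by simp, by simp⟩
  | hs μ i ih =>
    rw [monomial_add_single, pow_one, mul_comm, map_mul, polyHom_X, map_add, Finsupp.degree_single]
    push_cast
    exact algebraPart_gen_mul ih (.x i)

variable {ι : Type*} [Fintype ι] (π : G →* Equiv.Perm ι) [Fintype (Reflection G)]
  (c : ReflectionClass G → K)

theorem dunklHom_polyHom (f : MvPolynomial (Fin n) K) (w : ι → MvPolynomial (Fin n) K) :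
    dunklHom π c (polyHom G 0 c f) w = f • w := by
  have : (dunklHom π c).comp (polyHom G 0 c) = Algebra.lsmul K K (ι → MvPolynomial (Fin n) K) := by
    refine MvPolynomial.algHom_ext fun i => ?_
    rw [AlgHom.comp_apply, polyHom_X, dunklHom_gen]
    rfl
  exact LinearMap.congr_fun (DFunLike.congr_fun this f) w

variable {V : Type*} [AddCommGroup V] [Module K V] (τ : Representation K G V)
  (j : V →ₗ[K] (ι → K))

/-- The map from `H ⊗ V` to polynomial vectors. -/
def tensorVec : (CherednikAlgebra G 0 c ⊗[K] V) →ₛₗ[(dunklHom π c).toRingHom]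
    (ι → MvPolynomial (Fin n) K) where
  toFun := TensorProduct.lift (LinearMap.mk₂ K (fun h v => dunklHom π c h (constVec n (j v)))
    (by intros; simp) (by intros; simp) (by intros; simp [constVec_add])
    (by intros; simp [constVec_smul]))
  map_add' := map_add _
  map_smul' := by
    intro h t
    induction t with
    | zero => simp
    | tmul a v => simp [TensorProduct.smul_tmul']
    | add x y hx hy => rw [smul_add, map_add, hx, hy, map_add, smul_add]

theorem tensorVec_tmul (h : CherednikAlgebra G 0 c) (v : V) :
    tensorVec π c j (h ⊗ₜ v) = dunklHom π c h (constVec n (j v)) := by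
  exact TensorProduct.lift.tmul _ _

variable (hj : ∀ (g : G) v l, j (τ g v) l = j v ((π g)⁻¹ l))

/-- The map from the Verma module to polynomial vectors that is induced by an embedding of the
representation into a permutation representation. -/
def vermaVec : Verma G 0 c τ →ₛₗ[(dunklHom π c).toRingHom] (ι → MvPolynomial (Fin n) K) :=
  Submodule.liftQ _ (tensorVec π c j) (by
    refine Submodule.span_le.2 ?_
    rintro _ (⟨a, v, rfl⟩ | ⟨i, v, rfl⟩)
    · simp only [SetLike.mem_coe, LinearMap.mem_ker, map_sub, tensorVec_tmul, dunklHom_gen, map_one,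
        genOp, actOp_constVec, Module.End.one_apply, sub_eq_zero]
      congr 1
      ext l
      exact (hj a v l).symm
    · rw [SetLike.mem_coe, LinearMap.mem_ker, tensorVec_tmul, dunklHom_gen]
      exact dunkl_constVec π c i _)

theorem vermaVec_vermaMk (h : CherednikAlgebra G 0 c) (v : V) :
    vermaVec π c τ j hj (vermaMk G 0 c τ h v) = dunklHom π c h (constVec n (j v)) := by
  rw [vermaVec, vermaMk, Submodule.liftQ_apply, tensorVec_tmul]

theorem vermaVec_smul (h : CherednikAlgebra G 0 c) (u : Verma G 0 c τ) :
    vermaVec π c τ j hj (h • u) = dunklHom π c h (vermaVec π c τ j hj u) :=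
  (vermaVec π c τ j hj).map_smulₛₗ h u

omit [Fintype (Reflection G)] in
theorem poly_smul_eq (f : MvPolynomial (Fin n) K) (u : Verma G 0 c τ) :
    f • u = polyHom G 0 c f • u := rfl

theorem vermaVec_poly_smul (f : MvPolynomial (Fin n) K) (u : Verma G 0 c τ) :
    vermaVec π c τ j hj (f • u) = f • vermaVec π c τ j hj u := by
  rw [poly_smul_eq, vermaVec_smul, dunklHom_polyHom]

theorem vermaVec_K_smul (a : K) (u : Verma G 0 c τ) :
    vermaVec π c τ j hj (a • u) = a • vermaVec π c τ j hj u := by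
  rw [← algebraMap_smul (CherednikAlgebra G 0 c) a u, vermaVec_smul, AlgHom.commutes]
  rfl

omit [Fintype (Reflection G)] in
theorem vermaMk_eq_smul (h : CherednikAlgebra G 0 c) (v : V) :
    vermaMk G 0 c τ h v = h • vermaMk G 0 c τ 1 v := by
  rw [vermaMk, vermaMk, ← Submodule.Quotient.mk_smul, TensorProduct.smul_tmul', smul_eq_mul,
    mul_one]

omit [Fintype (Reflection G)] in
theorem gen_g_smul_vermaMk_one (a : G) (v : V) :
    gen G 0 c (.g a) • vermaMk G 0 c τ 1 v = vermaMk G 0 c τ 1 (τ a v) := by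
  rw [← vermaMk_eq_smul, vermaMk, vermaMk, Submodule.Quotient.eq]
  exact Submodule.subset_span (Or.inl ⟨a, v, rfl⟩)

omit [Fintype (Reflection G)] in
theorem gen_y_smul_vermaMk_one (i : Fin n) (v : V) :
    gen G 0 c (.y i) • vermaMk G 0 c τ 1 v = 0 := by
  rw [← vermaMk_eq_smul, vermaMk, Submodule.Quotient.mk_eq_zero]
  exact Submodule.subset_span (Or.inr ⟨i, v, rfl⟩)

/-- The Verma module is generated by `1 ⊗ V` over the polynomial ring. -/
theorem span_vermaMk_one :
    Submodule.span (MvPolynomial (Fin n) K) (Set.range (vermaMk G 0 c τ 1)) = ⊤ := by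
  set R := Submodule.span (MvPolynomial (Fin n) K) (Set.range (vermaMk G 0 c τ 1)) with hR
  have hv : ∀ v, vermaMk G 0 c τ 1 v ∈ R := fun v => Submodule.subset_span ⟨v, rfl⟩
  have hKX : ∀ (a : K) (u : Verma G 0 c τ), a • u = (C a : MvPolynomial (Fin n) K) • u := by
    intro a u
    rw [poly_smul_eq, ← algebraMap_eq, AlgHom.commutes, algebraMap_smul]
  let RK : Submodule K (Verma G 0 c τ) :=
    { R with smul_mem' := fun a u hu => by rw [hKX]; exact R.smul_mem _ hu }
  -- The spanning half of the PBW theorem: the `A`-span of `1 ⊗ V` is stable under the group, which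
  -- normalises the polynomials, and under `y_i`, because moving `y_i` past a variable only costs
  -- group elements.
  have hg : ∀ a, ∀ w ∈ R, gen G 0 c (.g a) • w ∈ R := by
    intro a w hw
    induction hw using Submodule.span_induction with
    | mem x hx => obtain ⟨v, rfl⟩ := hx; rw [gen_g_smul_vermaMk_one]; exact hv _
    | zero => rw [smul_zero]; exact zero_mem _
    | add x y _ _ hx hy => rw [smul_add]; exact add_mem hx hy
    | smul f x _ hx =>
      rw [poly_smul_eq, smul_smul, gen_g_mul_polyHom, mul_smul]
      exact R.smul_mem _ hx
  have hy : ∀ i, ∀ w ∈ R, gen G 0 c (.y i) • w ∈ R := by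
    intro i w hw
    induction hw using Submodule.span_induction with
    | mem x hx => obtain ⟨v, rfl⟩ := hx; rw [gen_y_smul_vermaMk_one]; exact zero_mem _
    | zero => rw [smul_zero]; exact zero_mem _
    | add x y _ _ hx hy => rw [smul_add]; exact add_mem hx hy
    | smul f x hxR hx =>
      induction f using MvPolynomial.induction_on generalizing x with
      | C r => rw [← hKX, smul_comm]; exact RK.smul_mem r hx
      | add f g hf hg => rw [add_smul, smul_add]; exact add_mem (hf x hxR hx) (hg x hxR hx)
      | mul_X f k hf =>
        rw [mul_comm, mul_smul, poly_smul_eq, polyHom_X, smul_smul, gen_y_mul_gen_x, add_smul,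
          mul_smul, ← polyHom_X, Finset.sum_smul]
        refine add_mem (R.smul_mem _ (hf x hxR hx)) (R.sum_mem fun s _ => ?_)
        rw [smul_assoc]
        exact RK.smul_mem _ (hg _ _ (R.smul_mem f hxR))
  rw [eq_top_iff]
  rintro u -
  obtain ⟨t, rfl⟩ := Submodule.Quotient.mk_surjective _ u
  induction t with
  | zero => exact zero_mem R
  | tmul h v =>
    change vermaMk G 0 c τ h v ∈ RK
    rw [vermaMk_eq_smul]
    refine smul_mem_of_gen_smul_mem RK (fun u w hw => ?_) h (hv v)
    cases u with
    | x i => rw [← polyHom_X]; exact R.smul_mem _ hw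
    | y i => exact hy i w hw
    | g a => exact hg a w hw
  | add x y hx hy => rw [Submodule.Quotient.mk_add]; exact add_mem hx hy

theorem vermaVec_mem_vecPart {d : ℤ} {u : Verma G 0 c τ} (hu : u ∈ vermaPart G 0 c τ d) :
    vermaVec π c τ j hj u ∈ vecPart K n ι d := by
  induction hu using Submodule.span_induction with
  | mem x hx =>
    obtain ⟨h, hh, v, rfl⟩ := hx
    rw [vermaVec_vermaMk]
    simpa using dunklHom_mem_vecPart π c hh (constVec_mem (j v))
  | zero => rw [map_zero]; exact zero_mem _
  | add x y _ _ hx hy => rw [map_add]; exact add_mem hx hy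
  | smul a x _ hx => rw [vermaVec_K_smul]; exact Submodule.smul_mem _ _ hx

end Model

/-! ### The reflections of `G(m, m, 3)` -/

section GroupMM3

variable {K : Type*} [Field K] {m : ℕ}

/-- A generalized permutation matrix as an element of `G(m, m, 3)`. -/
def monoElt (σ : Equiv.Perm (Fin 3)) (d : Fin 3 → K) (hd : ∀ j, d j ^ m = 1) (hm : m ≠ 0)
    (hp : ∏ j, d j = 1) : groupMM3 K m :=
  have h0 : ∀ j, d j ≠ 0 := fun j h => by simpa [h, hm] using hd j
  ⟨⟨monomialMatrix σ d, monomialMatrix σ⁻¹ fun j => (d (σ⁻¹ j))⁻¹, by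
      rw [monomialMatrix_mul, mul_inv_cancel, ← monomialMatrix_one]
      congr 1
      funext j
      exact mul_inv_cancel₀ (h0 _), by
      rw [monomialMatrix_mul, inv_mul_cancel, ← monomialMatrix_one]
      congr 1
      funext j
      change (d (σ.symm (σ j)))⁻¹ * d j = 1
      rw [Equiv.symm_apply_apply]
      exact inv_mul_cancel₀ (h0 _)⟩, σ, d, h0, hd, by rw [hp, one_pow], rfl⟩

theorem toMat_monoElt (σ : Equiv.Perm (Fin 3)) (d : Fin 3 → K) (hd : ∀ j, d j ^ m = 1)
    (hm : m ≠ 0) (hp : ∏ j, d j = 1) : toMat (monoElt σ d hd hm hp) = monomialMatrix σ d := rfl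

theorem underlyingPermHom_monoElt (σ : Equiv.Perm (Fin 3)) (d : Fin 3 → K) (hd : ∀ j, d j ^ m = 1)
    (hm : m ≠ 0) (hp : ∏ j, d j = 1) :
    underlyingPermHom K m m 3 (monoElt σ d hd hm hp) = σ :=
  underlyingPerm_eq _ (toMat_monoElt σ d hd hm hp)

theorem toMat_injective {n : ℕ} {G : Subgroup (GL (Fin n) K)} {a b : G}
    (h : toMat a = toMat b) : a = b :=
  Subtype.ext (Units.ext h)

theorem exists_eq_monoElt (hm : m ≠ 0) (g : groupMM3 K m) :
    ∃ σ d hd hp, g = monoElt σ d hd hm hp := by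
  obtain ⟨σ, d, h0, hd, hp, hg⟩ := g.2
  rw [Nat.div_self (Nat.pos_of_ne_zero hm), pow_one] at hp
  exact ⟨σ, d, hd, hp, toMat_injective hg⟩

theorem polyAct_monoElt_X (σ : Equiv.Perm (Fin 3)) (d : Fin 3 → K) (hd : ∀ j, d j ^ m = 1)
    (hm : m ≠ 0) (hp : ∏ j, d j = 1) (i : Fin 3) :
    polyAct (monoElt σ d hd hm hp) (X i) = (d i)⁻¹ • X (σ i) := by
  have h : ∀ j, entry (monoElt σ d hd hm hp)⁻¹ i j = if i = σ⁻¹ j then (d (σ⁻¹ j))⁻¹ else 0 :=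
    fun _ => rfl
  rw [polyAct_X]
  simp only [h, ite_smul, zero_smul]
  rw [Finset.sum_eq_single (σ i)]
  · simp
  · intro j _ hj
    rw [if_neg]
    rintro rfl
    simp at hj
  · simp

theorem actOp_monoElt_X_pow (σ : Equiv.Perm (Fin 3)) (d : Fin 3 → K) (hd : ∀ j, d j ^ m = 1)
    (hm : m ≠ 0) (hp : ∏ j, d j = 1) (i : Fin 3) (a : ℕ) (v : Fin 3 → K) :
    actOp (underlyingPermHom K m m 3) (monoElt σ d hd hm hp)
      ((X i : MvPolynomial (Fin 3) K) ^ a • constVec 3 v) =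
      (d i)⁻¹ ^ a • (X (σ i) : MvPolynomial (Fin 3) K) ^ a • constVec 3 fun l => v (σ⁻¹ l) := by
  rw [actOp_smul, actOp_constVec, map_pow, polyAct_monoElt_X, smul_pow, smul_assoc,
    underlyingPermHom_monoElt]

/-- The entries of a reflection with parameter `ζ`. -/
def reflVec (ζ : K) : Fin 3 → K := ![1, ζ, ζ⁻¹]

variable [NeZero m]

instance fintypeRootsOfUnity : Fintype (rootsOfUnity m K) := Fintype.ofFinite _

omit [NeZero m] in
theorem reflVec_pow (ζ : rootsOfUnity m K) (j : Fin 3) : reflVec ((ζ : Kˣ) : K) j ^ m = 1 := by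
  have h : ((ζ : Kˣ) : K) ^ m = 1 := by
    rw [← Units.val_pow_eq_pow_val, (mem_rootsOfUnity m _).1 ζ.2, Units.val_one]
  fin_cases j <;> simp [reflVec, h]

theorem prod_sub (f : Fin 3 → K) (k : Fin 3) : ∏ j, f (j - k) = ∏ j, f j :=
  Equiv.prod_comp (Equiv.subRight k) f

/-- The element of `G(m, m, 3)` that fixes `a_k` and exchanges the lines of the other two basis
vectors. -/
def reflElt (k : Fin 3) (ζ : rootsOfUnity m K) : groupMM3 K m :=
  monoElt (Equiv.subLeft (-k)) (fun j => reflVec ((ζ : Kˣ) : K) (j - k))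
    (fun _ => reflVec_pow ζ _) (NeZero.ne m) (by
      rw [prod_sub]
      simp [Fin.prod_univ_three, reflVec])

theorem toMat_reflElt (k : Fin 3) (ζ : rootsOfUnity m K) : toMat (reflElt k ζ) =
    monomialMatrix (Equiv.subLeft (-k)) fun j => reflVec ((ζ : Kˣ) : K) (j - k) := rfl

theorem reflVec_mul_neg {ζ : K} (h : ζ ≠ 0) (j : Fin 3) : reflVec ζ (-j) * reflVec ζ j = 1 := by
  fin_cases j
  · simp [reflVec]
  · change ζ⁻¹ * ζ = 1
    exact inv_mul_cancel₀ h
  · change ζ * ζ⁻¹ = 1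
    exact mul_inv_cancel₀ h

theorem reflElt_mul_self (k : Fin 3) (ζ : rootsOfUnity m K) : reflElt k ζ * reflElt k ζ = 1 := by
  refine toMat_injective ?_
  rw [toMat_mul, toMat_reflElt, monomialMatrix_mul, toMat_one, ← monomialMatrix_one]
  congr 1
  · ext1 j
    simp [Equiv.Perm.mul_apply]
  · funext j
    have : Equiv.subLeft (-k) j - k = -(j - k) := by
      change -k - j - k = _
      clear ζ; revert j k; decide
    rw [this]
    exact reflVec_mul_neg (Units.ne_zero _) _

theorem reflElt_inv (k : Fin 3) (ζ : rootsOfUnity m K) : (reflElt k ζ)⁻¹ = reflElt k ζ :=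
  inv_eq_of_mul_eq_one_left (reflElt_mul_self k ζ)

theorem isReflection_reflElt (k : Fin 3) (ζ : rootsOfUnity m K) :
    IsReflection (reflElt k ζ : GL (Fin 3) K) := by
  refine ⟨isOfFinOrder_iff_pow_eq_one.2 ⟨2, by norm_num, ?_⟩, ?_⟩
  · rw [pow_two]
    exact congrArg Subtype.val (reflElt_mul_self k ζ)
  · set z : K := ((ζ : Kˣ) : K) with hz
    have hz0 : z ≠ 0 := Units.ne_zero _
    have e : 1 - toMat (reflElt k ζ) = Matrix.vecMulVec
        (fun i => ![0, 1, -z] (i - k)) (fun j => ![0, 1, -z⁻¹] (j - k)) := by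
      rw [toMat_reflElt]
      ext i j
      rw [Matrix.sub_apply, Matrix.one_apply, monomialMatrix, Matrix.of_apply, Matrix.vecMulVec_apply]
      obtain ⟨i, rfl⟩ : ∃ i', i = i' + k := ⟨i - k, by simp⟩
      obtain ⟨j, rfl⟩ : ∃ j', j = j' + k := ⟨j - k, by simp⟩
      have h1 : i + k = Equiv.subLeft (-k) (j + k) ↔ i = -j := by
        change i + k = -k - (j + k) ↔ i = -j
        clear hz hz0 z ζ; revert i j k; decide
      simp only [h1, add_left_inj, add_sub_cancel_right, reflVec, ← hz]
      fin_cases i <;> fin_cases j <;> simp [hz0]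
      · decide
      · exact fun h => absurd (by decide) h
      · exact fun h => absurd (by decide) h
      · decide
    change (1 - toMat (reflElt k ζ)).rank = 1
    refine le_antisymm ?_ ?_
    · rw [e]; exact Matrix.rank_vecMulVec_le _ _
    · rw [Nat.one_le_iff_ne_zero]
      intro h
      have h1 := LinearMap.range_eq_bot.1 (Submodule.finrank_eq_zero.1 h)
      have h2 := congrFun (LinearMap.congr_fun h1 (Pi.single (1 + k) 1)) (1 + k)
      rw [e] at h2
      simp [Matrix.vecMulVec_apply] at h2

/-- The symmetric group on `ℤ/3` is its affine group. The maps `l ↦ -k - l` are the transpositions,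
with fixed point `k` because `-2 k = k`, and the translations are the rotations. -/
theorem perm_three_cases (σ : Equiv.Perm (Fin 3)) :
    (∃ k, σ = Equiv.subLeft (-k)) ∨ ∃ t, σ = Equiv.addRight t := by
  revert σ; decide

/-- Write `1 - s` as the product of a column `a` and a row `b`. Over a transposition fixing `k`, a
zero entry forces `a k = 0`, hence `d k = 1`, and the product condition fixes the last entry. A
diagonal matrix of rank one defect would have exactly one entry different from `1`, against product
one. A rotation gives entries `1, 0, 1` that no rank one matrix can have. -/
theorem exists_eq_reflElt (s : Reflection (groupMM3 K m)) : ∃ k ζ, s.1 = reflElt k ζ := by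
  obtain ⟨a, -, b, -, hab, -⟩ := s.exists_eq_mul
  obtain ⟨σ, d, hd, hp, hs⟩ := exists_eq_monoElt (NeZero.ne m) s.1
  have hrank : (1 - toMat s.1).rank = 1 := s.2.2
  have hM : toMat s.1 = monomialMatrix σ d := by rw [hs]; rfl
  have hE : ∀ i j, (if i = j then 1 else 0) - (if i = σ j then d j else 0) = a i * b j := by
    intro i j
    rw [← hab, Matrix.sub_apply, Matrix.one_apply, hM, monomialMatrix, Matrix.of_apply]
  rcases perm_three_cases σ with ⟨k, rfl⟩ | ⟨t, rfl⟩
  · have e1 := hE (k + 1) (k + 1)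
    have e2 := hE k (k + 1)
    have e3 := hE k k
    have c1 : k + 1 ≠ Equiv.subLeft (-k) (k + 1) := by
      change k + 1 ≠ -k - (k + 1); clear * -; revert k; decide
    have c2 : k ≠ Equiv.subLeft (-k) (k + 1) := by
      change k ≠ -k - (k + 1); clear * -; revert k; decide
    have c3 : k = Equiv.subLeft (-k) k := by
      change k = -k - k; clear * -; revert k; decide
    have c4 : k ≠ k + 1 := by clear * -; revert k; decide
    rw [if_pos rfl, if_neg c1, sub_zero] at e1
    rw [if_neg c4, if_neg c2, sub_zero] at e2
    rw [if_pos rfl, if_pos c3] at e3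
    have hb : b (k + 1) ≠ 0 := fun h => by simp [h] at e1
    have ha : a k = 0 := (mul_eq_zero.1 e2.symm).resolve_right hb
    rw [ha, zero_mul, sub_eq_zero] at e3
    have hdk : d (k + 1) ≠ 0 := fun h => by simpa [h, NeZero.ne m] using hd (k + 1)
    have hp' : d k * d (k + 1) * d (k + 2) = 1 := by
      rw [← hp, ← prod_sub d (-k), Fin.prod_univ_three]
      simp [add_comm]
    rw [← e3, one_mul] at hp'
    refine ⟨k, ⟨Units.mk0 (d (k + 1)) hdk, ?_⟩, ?_⟩
    · rw [mem_rootsOfUnity]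
      exact Units.ext (by simpa using hd (k + 1))
    · refine toMat_injective ?_
      rw [hM, toMat_reflElt]
      congr 1
      funext j
      obtain ⟨j, rfl⟩ : ∃ j', j = k + j' := ⟨j - k, by simp⟩
      rw [add_sub_cancel_left]
      fin_cases j
      · simpa [reflVec] using e3.symm
      · simp [reflVec]
      · simpa [reflVec] using eq_inv_of_mul_eq_one_right hp'
  · exfalso
    by_cases ht : t = 0
    · subst ht
      simp only [Equiv.coe_addRight, add_zero] at hE
      have h1 : ∀ j, d j = 1 := by
        by_contra! hne
        obtain ⟨j, hj⟩ := hne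
        have hj' := hE j j
        simp only [if_true] at hj'
        have hb : b j ≠ 0 := fun h => hj (by rw [h, mul_zero, sub_eq_zero] at hj'; exact hj'.symm)
        have ho : ∀ i, i ≠ j → d i = 1 := by
          intro i hi
          have h2 := hE i j
          rw [if_neg hi, if_neg hi, sub_zero] at h2
          have h3 := hE i i
          rw [(mul_eq_zero.1 h2.symm).resolve_right hb, zero_mul] at h3
          rw [if_pos rfl, if_pos rfl, sub_eq_zero] at h3
          exact h3.symm
        apply hj
        rw [← hp, Finset.prod_eq_single j]
        · intro i _ hi; exact ho i hi
        · simp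
      have : toMat s.1 = 1 := by
        rw [hM, ← monomialMatrix_one]
        congr 1
        · ext1 j; simp
        · funext j; exact h1 j
      rw [this, sub_self, Matrix.rank_zero] at hrank
      exact zero_ne_one hrank
    · have c1 : ∀ j : Fin 3, j ≠ Equiv.addRight t j := by
        intro j
        change j ≠ j + t
        clear * - ht; revert j t; decide
      have c2 : (0 : Fin 3) ≠ Equiv.addRight t (0 + t) := by
        change 0 ≠ 0 + t + t
        clear * - ht; revert t; decide
      have e1 := hE 0 0
      have e2 := hE 0 (0 + t)
      have e3 := hE (0 + t) (0 + t)
      rw [if_pos rfl, if_neg (c1 0), sub_zero] at e1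
      rw [if_neg (by simpa using c1 0), if_neg c2, sub_zero] at e2
      rw [if_pos rfl, if_neg (c1 _), sub_zero] at e3
      rcases mul_eq_zero.1 e2.symm with h | h
      · simp [h] at e1
      · rw [h, mul_zero] at e3
        exact one_ne_zero e3

theorem reflElt_injective {k k' : Fin 3} {ζ ζ' : rootsOfUnity m K}
    (h : reflElt k ζ = reflElt k' ζ') : k = k' ∧ ζ = ζ' := by
  have h1 := congrArg (underlyingPermHom K m m 3) h
  rw [reflElt, reflElt, underlyingPermHom_monoElt, underlyingPermHom_monoElt] at h1
  have h2 : k = k' := by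
    have := DFunLike.congr_fun h1 0
    simpa using this
  subst h2
  refine ⟨rfl, ?_⟩
  have h3 := congrArg toMat h
  rw [toMat_reflElt, toMat_reflElt] at h3
  have h4 := congrFun (congrFun h3 (Equiv.subLeft (-k) (k + 1))) (k + 1)
  simp only [monomialMatrix, Matrix.of_apply, if_true, add_sub_cancel_left] at h4
  exact Subtype.ext (Units.ext (by simpa [reflVec] using h4))

/-- The reflections of `G(m, m, 3)`. -/
def reflEquiv (K : Type*) [Field K] (m : ℕ) [NeZero m] :
    Fin 3 × rootsOfUnity m K ≃ Reflection (groupMM3 K m) :=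
  Equiv.ofBijective (fun x => ⟨reflElt x.1 x.2, isReflection_reflElt x.1 x.2⟩) <| by
    constructor
    · rintro ⟨k, ζ⟩ ⟨k', ζ'⟩ h
      obtain ⟨rfl, rfl⟩ := reflElt_injective (congrArg Subtype.val h)
      rfl
    · intro s
      obtain ⟨k, ζ, h⟩ := exists_eq_reflElt s
      exact ⟨⟨k, ζ⟩, Subtype.ext h.symm⟩

instance fintypeReflection : Fintype (Reflection (groupMM3 K m)) := Fintype.ofEquiv _ (reflEquiv K m)

theorem isConj_reflElt (k k' : Fin 3) (ζ ζ' : rootsOfUnity m K) :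
    IsConj (reflElt k ζ) (reflElt k' ζ') := by
  have hz : ∀ ζ : rootsOfUnity m K, ((ζ : Kˣ) : K) ^ m = 1 := fun ζ => by
    rw [← Units.val_pow_eq_pow_val, (mem_rootsOfUnity m _).1 ζ.2, Units.val_one]
  set z : K := ((ζ : Kˣ) : K) with hz1
  set z' : K := ((ζ' : Kˣ) : K) with hz2
  have hz0 : z ≠ 0 := Units.ne_zero _
  have hz0' : z' ≠ 0 := Units.ne_zero _
  -- The conjugation requires `d 2 * z = z' * d 1`, solved by `d 1 = z` and `d 2 = z'`. The entry on
  -- the fixed axis is free and makes the product one.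
  let d : Fin 3 → K := ![(z * z')⁻¹, z, z']
  have hd : ∀ j, d j ^ m = 1 := by
    intro j
    fin_cases j <;> simp [d, mul_pow, hz, hz1, hz2]
  have hp : ∏ j, d (j - k) = 1 := by
    rw [prod_sub]
    simp only [Fin.prod_univ_three, d, Matrix.cons_val]
    field_simp
  rw [isConj_iff]
  refine ⟨monoElt (Equiv.addRight (k' - k)) (fun j => d (j - k)) (fun _ => hd _) (NeZero.ne m) hp, ?_⟩
  rw [mul_inv_eq_iff_eq_mul]
  refine toMat_injective ?_
  rw [toMat_mul, toMat_mul, toMat_monoElt, toMat_reflElt, toMat_reflElt, monomialMatrix_mul,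
    monomialMatrix_mul]
  congr 1
  · ext1 j
    change -k - j + (k' - k) = -k' - (j + (k' - k))
    clear * -; revert j k k'; decide
  · funext j
    have e1 : Equiv.subLeft (-k) j - k = -(j - k) := by
      change -k - j - k = _
      clear * -; revert j k; decide
    have e2 : Equiv.addRight (k' - k) j - k' = j - k := by
      change j + (k' - k) - k' = _
      abel
    rw [e1, e2, ← hz1, ← hz2]
    generalize j - k = i
    fin_cases i
    · simp [d, reflVec]
    · change z' * z = z' * z; rfl
    · change z * z⁻¹ = z'⁻¹ * z'
      rw [mul_inv_cancel₀ hz0, inv_mul_cancel₀ hz0']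

theorem conjClass_eq (s t : Reflection (groupMM3 K m)) : s.conjClass = t.conjClass := by
  obtain ⟨k, ζ, hs⟩ := exists_eq_reflElt s
  obtain ⟨k', ζ', ht⟩ := exists_eq_reflElt t
  refine Subtype.ext (ConjClasses.mk_eq_mk_iff_isConj.2 ?_)
  rw [hs, ht]
  exact isConj_reflElt k k' ζ ζ'

theorem sum_rootsOfUnity_pow {ξ : K} (hξ : IsPrimitiveRoot ξ m) (a : ℕ) :
    ∑ ζ : rootsOfUnity m K, ((ζ : Kˣ) : K) ^ a = if m ∣ a then (m : K) else 0 := by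
  split_ifs with h
  · obtain ⟨b, rfl⟩ := h
    have : ∀ ζ : rootsOfUnity m K, ((ζ : Kˣ) : K) ^ (m * b) = 1 := fun ζ => by
      rw [pow_mul, ← Units.val_pow_eq_pow_val, (mem_rootsOfUnity m _).1 ζ.2, Units.val_one, one_pow]
    rw [Finset.sum_congr rfl fun ζ _ => this ζ, Finset.sum_const, Finset.card_univ,
      ← Nat.card_eq_fintype_card, hξ.card_rootsOfUnity, nsmul_one]
  · have h1 : ξ ^ a ≠ 1 := fun h1 => h (hξ.dvd_of_pow_eq_one a h1)
    let η : rootsOfUnity m K := hξ.toRootsOfUnity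
    have h2 := Equiv.sum_comp (Equiv.mulLeft η) fun ζ : rootsOfUnity m K => ((ζ : Kˣ) : K) ^ a
    simp only [Equiv.coe_mulLeft, Subgroup.coe_mul, Units.val_mul, mul_pow, ← Finset.mul_sum] at h2
    have h3 : ((η : Kˣ) : K) = ξ := by simp [η]
    rw [h3] at h2
    have h4 : (ξ ^ a - 1) * ∑ ζ : rootsOfUnity m K, ((ζ : Kˣ) : K) ^ a = 0 := by
      rw [sub_mul, h2, one_mul, sub_self]
    exact (mul_eq_zero.1 h4).resolve_left (sub_ne_zero.2 h1)

theorem sum_reflVec_pow {ξ : K} (hξ : IsPrimitiveRoot ξ m) {i : Fin 3} (hi : i ≠ 0) (a : ℕ) :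
    ∑ ζ : rootsOfUnity m K, reflVec ((ζ : Kˣ) : K) i ^ a = if m ∣ a then (m : K) else 0 := by
  fin_cases i
  · exact absurd rfl hi
  · exact sum_rootsOfUnity_pow hξ a
  · rw [← sum_rootsOfUnity_pow hξ a, ← Equiv.sum_comp (Equiv.inv _)]
    refine Finset.sum_congr rfl fun ζ _ => ?_
    simp [reflVec]

end GroupMM3

/-! ### Dunkl operators of `G(m, m, 3)` on powers of the coordinates -/

section Powers

variable {K : Type*} [Field K] {m : ℕ}

/-- The polynomial vector `x_i ^ a ⊗ v`. -/
def powVec (i : Fin 3) (a : ℕ) (v : Fin 3 → K) : Fin 3 → MvPolynomial (Fin 3) K :=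
  (X i : MvPolynomial (Fin 3) K) ^ a • constVec 3 v

theorem powVec_zero (i : Fin 3) (v : Fin 3 → K) : powVec i 0 v = constVec 3 v := by
  rw [powVec, pow_zero, one_smul]

theorem powVec_succ (i : Fin 3) (a : ℕ) (v : Fin 3 → K) :
    powVec i (a + 1) v = (X i : MvPolynomial (Fin 3) K) • powVec i a v := by
  rw [powVec, powVec, pow_succ', mul_smul]

theorem powVec_sum {ι : Type*} (s : Finset ι) (i : Fin 3) (a : ℕ) (v : ι → Fin 3 → K) :
    ∑ k ∈ s, powVec i a (v k) = powVec i a (∑ k ∈ s, v k) := by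
  simp only [powVec, ← Finset.smul_sum]
  congr 1
  ext1 l
  simp [constVec]

theorem powVec_neg (i : Fin 3) (a : ℕ) (v : Fin 3 → K) : powVec i a (-v) = -powVec i a v := by
  rw [powVec, constVec_neg, smul_neg, powVec]

/-- The vector obtained from `v` by the reflection `l ↦ i + j - l` of the indices. -/
def flip (i j : Fin 3) (v : Fin 3 → K) : Fin 3 → K := fun l => v (i + j - l)

variable [NeZero m]

theorem reflCoeff_reflElt (k : Fin 3) (ζ : rootsOfUnity m K) (i j : Fin 3) :
    reflCoeff (reflElt k ζ) i j =
      (if i = j then 1 else 0) - if i = -k - j then reflVec ((ζ : Kˣ) : K) (j - k) else 0 := by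
  rw [reflCoeff_apply, reflElt_inv]
  rfl

omit [NeZero m] in
theorem reflVec_inv (ζ : rootsOfUnity m K) (j : Fin 3) :
    (reflVec ((ζ : Kˣ) : K) j)⁻¹ = reflVec ((ζ : Kˣ) : K) (-j) :=
  (eq_inv_of_mul_eq_one_left (reflVec_mul_neg (Units.ne_zero _) j)).symm

variable (c : ReflectionClass (groupMM3 K m) → K) {c₀ : K}
  (hc : ∀ s : Reflection (groupMM3 K m), c s.conjClass = c₀)
include hc

/-- The reflections are reindexed by the image `t` of `l`: the one that fixes the index `-l - t`
sends `x_l` to a multiple of `x_t` and acts on indices by `q ↦ l + t - q`. -/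
theorem commOp_powVec (i j l : Fin 3) (a : ℕ) (v : Fin 3 → K) :
    commOp (underlyingPermHom K m m 3) c i j (powVec l a v) =
      ∑ t, (∑ ζ : rootsOfUnity m K, -(c₀ * ((if i = j then 1 else 0) -
        if i = l + t - j then reflVec ((ζ : Kˣ) : K) (j + l + t) else 0)) *
          reflVec ((ζ : Kˣ) : K) (l - t) ^ a) • powVec t a (flip l t v) := by
  rw [commOp_apply, ← Equiv.sum_comp (reflEquiv K m), Fintype.sum_prod_type,
    ← Equiv.sum_comp (Equiv.subLeft (-l))]
  refine Finset.sum_congr rfl fun t _ => ?_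
  rw [Finset.sum_smul]
  refine Finset.sum_congr rfl fun ζ _ => ?_
  rw [hc]
  change (-(c₀ * reflCoeff (reflElt (-l - t) ζ) i j)) •
    actOp (underlyingPermHom K m m 3) (reflElt (-l - t) ζ) (powVec l a v) = _
  rw [reflCoeff_reflElt, reflElt, powVec, actOp_monoElt_X_pow, smul_smul, reflVec_inv]
  have e1 : -(-l - t) - j = l + t - j := by abel
  have e2 : j - (-l - t) = j + l + t := by abel
  have e3 : -(l - (-l - t)) = l - t := by clear * -; revert l t; decide
  have e4 : Equiv.subLeft (-(-l - t)) l = t := by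
    change -(-l - t) - l = t; abel
  have e5 : (fun q => v ((Equiv.subLeft (-(-l - t)))⁻¹ q)) = flip l t v := by
    funext q
    change v (-q + -(-l - t)) = v _
    congr 1
    abel
  rw [e1, e2, e3, e4, e5, powVec]

variable {ξ : K} (hξ : IsPrimitiveRoot ξ m)
include hξ

/-- The reflections with fixed index `i` have coefficient zero. The others have diagonal coefficient
`1`, and summing `ζ ^ (± a)` over the roots of unity leaves `m` if `m ∣ a` and zero otherwise. -/
theorem commOp_self_powVec (i : Fin 3) (a : ℕ) (v : Fin 3 → K) :
    commOp (underlyingPermHom K m m 3) c i i (powVec i a v) =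
      if m ∣ a then -((c₀ * m) • ∑ j ∈ Finset.univ.erase i, powVec j a (flip i j v)) else 0 := by
  rw [commOp_powVec c hc, ← Finset.sum_erase _ (a := i)]
  · have h : ∀ t ∈ Finset.univ.erase i, (∑ ζ : rootsOfUnity m K,
        -(c₀ * ((if i = i then 1 else 0) -
          if i = i + t - i then reflVec ((ζ : Kˣ) : K) (i + i + t) else 0)) *
            reflVec ((ζ : Kˣ) : K) (i - t) ^ a) • powVec t a (flip i t v) =
        if m ∣ a then -((c₀ * m) • powVec t a (flip i t v)) else 0 := by
      intro t ht
      have hti : t ≠ i := (Finset.mem_erase.1 ht).1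
      simp only [add_sub_cancel_left, if_neg hti.symm, if_true, sub_zero, mul_one]
      rw [← Finset.mul_sum, sum_reflVec_pow hξ (sub_ne_zero.2 hti.symm)]
      split_ifs <;> simp
    rw [Finset.sum_congr rfl h]
    split_ifs
    · rw [Finset.sum_neg_distrib, Finset.smul_sum]
    · exact Finset.sum_const_zero
  · have e : i + i + i = 0 := by clear * -; revert i; decide
    simp [e, reflVec]

/-- Only the reflections exchanging `i` and `j` have a nonzero off-diagonal coefficient. It supplies
one more factor `ζ ^ (± 1)`, so the condition is on `a + 1`. -/
theorem commOp_of_ne_powVec {i j : Fin 3} (hij : i ≠ j) (a : ℕ) (v : Fin 3 → K) :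
    commOp (underlyingPermHom K m m 3) c i j (powVec i a v) =
      if m ∣ a + 1 then (c₀ * m) • powVec j a (flip i j v) else 0 := by
  rw [commOp_powVec c hc, Finset.sum_eq_single j]
  · have e : j + i + j = i - j := by clear * -; revert i j; decide
    simp only [if_neg hij, add_sub_cancel_right, if_true, zero_sub, mul_neg, neg_neg, e, mul_assoc]
    rw [← Finset.mul_sum]
    simp only [← pow_succ']
    rw [sum_reflVec_pow hξ (sub_ne_zero.2 hij)]
    split_ifs <;> simp
  · intro t _ ht
    have : i ≠ i + t - j := by clear * - ht; revert i j t; decide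
    simp [if_neg hij, if_neg this]
  · simp

omit hc hξ [NeZero m] in
theorem sum_flip_eq_zero {v : Fin 3 → K} (hv : ∑ i, v i = 0) (i : Fin 3) :
    ∑ j, flip i j v = 0 := by
  funext l
  rw [Finset.sum_apply, Pi.zero_apply, ← hv, ← Equiv.sum_comp (Equiv.addRight (i - l)) v]
  refine Finset.sum_congr rfl fun j _ => ?_
  rw [flip]
  congr 1
  simp only [Equiv.coe_addRight]
  abel

/-- For coordinate sum zero the three reflected vectors add up to zero, so the two terms with `j ≠
i` combine into minus the remaining one. This is where the restriction to `γ₀` enters the action of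
the Dunkl operators. -/
theorem commOp_self_constVec (i : Fin 3) {v : Fin 3 → K} (hv : ∑ i, v i = 0) :
    commOp (underlyingPermHom K m m 3) c i i (constVec 3 v) =
      (c₀ * m) • constVec 3 (flip i i v) := by
  have h := commOp_self_powVec c hc hξ i 0 v
  have h2 : ∑ j ∈ Finset.univ.erase i, constVec 3 (flip i j v) = -constVec 3 (flip i i v) := by
    simp only [← powVec_zero 0]
    rw [powVec_sum, ← powVec_neg]
    congr 1
    rw [← sub_eq_zero, sub_neg_eq_add, Finset.sum_erase_add _ _ (Finset.mem_univ i),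
      sum_flip_eq_zero hv]
  simp only [powVec_zero, dvd_zero, if_true] at h
  rw [h, h2, smul_neg, neg_neg]

theorem dunkl_of_ne_powVec_lt {i j : Fin 3} (hij : i ≠ j) (v : Fin 3 → K) {a : ℕ} (ha : a < m) :
    dunkl (underlyingPermHom K m m 3) c j (powVec i a v) = 0 := by
  induction a with
  | zero => rw [powVec_zero, dunkl_constVec]
  | succ a ih =>
    rw [powVec_succ, dunkl_X_smul, ih (by omega), commOp_of_ne_powVec c hc hξ hij,
      if_neg (Nat.not_dvd_of_pos_of_lt (by omega) ha), smul_zero, add_zero]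

theorem dunkl_of_ne_powVec {i j : Fin 3} (hij : i ≠ j) (v : Fin 3 → K) :
    dunkl (underlyingPermHom K m m 3) c j (powVec i m v) =
      (c₀ * m) • powVec j (m - 1) (flip i j v) := by
  have hm : m ≠ 0 := NeZero.ne m
  have e : m = m - 1 + 1 := by omega
  have e' : powVec i m v = powVec i (m - 1 + 1) v := by rw [← e]
  rw [e', powVec_succ, dunkl_X_smul, dunkl_of_ne_powVec_lt c hc hξ hij v (by omega),
    commOp_of_ne_powVec c hc hξ hij, if_pos (by rw [← e]), smul_zero, zero_add]

theorem dunkl_self_powVec_le (i : Fin 3) {v : Fin 3 → K} (hv : ∑ i, v i = 0) {a : ℕ} (ha : a < m) :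
    dunkl (underlyingPermHom K m m 3) c i (powVec i (a + 1) v) =
      (c₀ * m) • powVec i a (flip i i v) := by
  induction a with
  | zero =>
    rw [powVec_succ, dunkl_X_smul, powVec_zero, dunkl_constVec, smul_zero, zero_add, powVec_zero,
      commOp_self_constVec c hc hξ i hv]
  | succ a ih =>
    rw [powVec_succ, dunkl_X_smul, ih (by omega), commOp_self_powVec c hc hξ,
      if_neg (Nat.not_dvd_of_pos_of_lt (by omega) ha), add_zero, smul_comm, ← powVec_succ]

/-- When the exponent passes `m`, the commutator contributes a new sum over `j ≠ i`. Further factors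
`x_i` just carry it along, since the next contribution would come only beyond exponent `2 m`. -/
theorem dunkl_self_powVec_ge (i : Fin 3) {v : Fin 3 → K} (hv : ∑ i, v i = 0) {a : ℕ} (ha : a < m) :
    dunkl (underlyingPermHom K m m 3) c i (powVec i (m + a + 1) v) =
      (c₀ * m) • powVec i (m + a) (flip i i v) - (c₀ * m) • ∑ j ∈ Finset.univ.erase i,
        (X i : MvPolynomial (Fin 3) K) ^ a • powVec j m (flip i j v) := by
  have hm : m ≠ 0 := NeZero.ne m
  induction a with
  | zero =>
    obtain ⟨n, hn⟩ : ∃ n, m = n + 1 := Nat.exists_eq_succ_of_ne_zero hm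
    have h := dunkl_self_powVec_le c hc hξ i hv (show n < m by omega)
    rw [← hn] at h
    rw [add_zero, powVec_succ, dunkl_X_smul, h, commOp_self_powVec c hc hξ, if_pos dvd_rfl,
      smul_comm, ← powVec_succ, ← hn, ← sub_eq_add_neg]
    simp only [pow_zero, one_smul]
  | succ a ih =>
    have hd : ¬ m ∣ m + a + 1 := by
      rw [add_assoc, Nat.dvd_add_right dvd_rfl]
      exact Nat.not_dvd_of_pos_of_lt (by omega) ha
    rw [← add_assoc, powVec_succ, dunkl_X_smul, ih (by omega), commOp_self_powVec c hc hξ,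
      if_neg hd, add_zero, smul_sub, smul_comm (X i : MvPolynomial (Fin 3) K), ← powVec_succ,
      smul_comm (X i : MvPolynomial (Fin 3) K), Finset.smul_sum]
    simp only [smul_smul, ← pow_succ']

/-- The Dunkl operators map `x_i ^ m ⊗ v` to `x_j ^ (m - 1) ⊗ flip i j v`, up to a factor. -/
theorem dunkl_powVec (i j : Fin 3) {v : Fin 3 → K} (hv : ∑ i, v i = 0) :
    dunkl (underlyingPermHom K m m 3) c j (powVec i m v) =
      (c₀ * m) • powVec j (m - 1) (flip i j v) := by
  by_cases hij : i = j
  · subst hij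
    obtain ⟨n, hn⟩ : ∃ n, m = n + 1 := Nat.exists_eq_succ_of_ne_zero (NeZero.ne m)
    have h := dunkl_self_powVec_le c hc hξ i hv (show n < m by omega)
    rwa [← hn, show n = m - 1 by omega] at h
  · exact dunkl_of_ne_powVec c hc hξ hij v

end Powers

/-! ### The submodule of relations -/

section Relations

variable {K : Type*} [Field K] {m : ℕ}

/-- The vector obtained from `v` by the translation `l ↦ l + k` of the indices. -/
def shift (k : Fin 3) (v : Fin 3 → K) : Fin 3 → K := fun l => v (l - k)

omit [Field K] in
theorem shift_shift (k l : Fin 3) (v : Fin 3 → K) : shift k (shift l v) = shift (k + l) v := by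
  funext q
  simp only [shift, sub_sub]

omit [Field K] in
theorem shift_zero (v : Fin 3 → K) : shift 0 v = v := by
  funext q
  simp [shift]

omit [Field K] in
theorem flip_shift (i j t : Fin 3) (v : Fin 3 → K) : flip j t (shift (j - i) v) = flip i t v := by
  funext q
  simp only [shift, flip]
  congr 1
  abel

omit [Field K] in
theorem shift_flip (i j : Fin 3) (v : Fin 3 → K) : shift (i - j) (flip i j v) = flip i i v := by
  funext q
  simp only [shift, flip]
  congr 1
  abel

theorem sum_shift {v : Fin 3 → K} (hv : ∑ i, v i = 0) (k : Fin 3) : ∑ i, shift k v i = 0 := by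
  rw [← hv]
  exact Equiv.sum_comp (Equiv.subRight k) v

theorem sum_flip {v : Fin 3 → K} (hv : ∑ i, v i = 0) (i j : Fin 3) : ∑ l, flip i j v l = 0 := by
  rw [← hv]
  exact Equiv.sum_comp (Equiv.subLeft (i + j)) v

/-- The generators of the submodule of relations. -/
inductive IsRelation (K : Type*) [Field K] (m : ℕ) : (Fin 3 → MvPolynomial (Fin 3) K) → Prop
  | prod (v : Fin 3 → K) (hv : ∑ i, v i = 0) : IsRelation K m (prodX K • constVec 3 v)
  | psum (v : Fin 3 → K) (hv : ∑ i, v i = 0) : IsRelation K m (psumX K m • constVec 3 v)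
  | pow (i j : Fin 3) (v : Fin 3 → K) (hv : ∑ i, v i = 0) :
      IsRelation K m (powVec i m v - powVec j m (shift (j - i) v))

/-- The submodule of relations. -/
def relSub (K : Type*) [Field K] (m : ℕ) :
    Submodule (MvPolynomial (Fin 3) K) (Fin 3 → MvPolynomial (Fin 3) K) :=
  Submodule.span _ {w | IsRelation K m w}

theorem IsRelation.mem {w : Fin 3 → MvPolynomial (Fin 3) K} (h : IsRelation K m w) :
    w ∈ relSub K m := Submodule.subset_span h

theorem K_smul_mem {N : Submodule (MvPolynomial (Fin 3) K) (Fin 3 → MvPolynomial (Fin 3) K)}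
    (a : K) {w : Fin 3 → MvPolynomial (Fin 3) K} (hw : w ∈ N) : a • w ∈ N := by
  rw [← algebraMap_smul (MvPolynomial (Fin 3) K) a w]
  exact N.smul_mem _ hw

variable [NeZero m]

theorem polyAct_prodX (g : groupMM3 K m) : polyAct g (prodX K) = prodX K := by
  obtain ⟨σ, d, hd, hp, rfl⟩ := exists_eq_monoElt (NeZero.ne m) g
  have e : prodX K = ∏ i, X i := by simp [prodX, Fin.prod_univ_three]
  rw [e, map_prod]
  simp only [polyAct_monoElt_X]
  rw [Finset.prod_smul, Finset.prod_inv_distrib, hp, inv_one, one_smul]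
  exact Equiv.prod_comp σ fun i => (X i : MvPolynomial (Fin 3) K)

theorem polyAct_psumX (g : groupMM3 K m) : polyAct g (psumX K m) = psumX K m := by
  obtain ⟨σ, d, hd, hp, rfl⟩ := exists_eq_monoElt (NeZero.ne m) g
  rw [psumX_eq_sum, map_sum]
  simp only [map_pow, polyAct_monoElt_X, smul_pow, inv_pow, hd, inv_one, one_smul]
  exact Equiv.sum_comp σ fun i => (X i : MvPolynomial (Fin 3) K) ^ m

/-- Every permutation of `ℤ/3` is affine, so it takes translations to translations. Hence the group
permutes the relations `x_i^m ⊗ v - x_j^m ⊗ v'`. -/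
theorem perm_apply_sub (σ : Equiv.Perm (Fin 3)) (i j l : Fin 3) :
    σ.symm (l - (σ j - σ i)) = σ.symm l - (j - i) := by
  revert σ i j l; decide

theorem actOp_mem_relSub (g : groupMM3 K m) {w : Fin 3 → MvPolynomial (Fin 3) K}
    (hw : w ∈ relSub K m) : actOp (underlyingPermHom K m m 3) g w ∈ relSub K m := by
  have hs : ∀ (σ : Equiv.Perm (Fin 3)) (v : Fin 3 → K), ∑ i, v i = 0 →
      ∑ i, v (σ⁻¹ i) = 0 := fun σ v hv => by rw [← hv]; exact Equiv.sum_comp _ v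
  induction hw using Submodule.span_induction with
  | mem x hx =>
    cases hx with
    | prod v hv =>
      rw [actOp_smul, polyAct_prodX, actOp_constVec]
      exact (IsRelation.prod _ (hs _ v hv)).mem
    | psum v hv =>
      rw [actOp_smul, polyAct_psumX, actOp_constVec]
      exact (IsRelation.psum _ (hs _ v hv)).mem
    | pow i j v hv =>
      obtain ⟨σ, d, hd, hp, rfl⟩ := exists_eq_monoElt (NeZero.ne m) g
      rw [map_sub, powVec, powVec, actOp_monoElt_X_pow, actOp_monoElt_X_pow, inv_pow, inv_pow, hd,
        hd, inv_one, one_smul, one_smul]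
      have h := (IsRelation.pow (m := m) (σ i) (σ j) _ (hs σ v hv)).mem
      have e : shift (σ j - σ i) (fun l => v (σ⁻¹ l)) = fun l => shift (j - i) v (σ⁻¹ l) := by
        funext l
        exact congrArg v (perm_apply_sub σ i j l)
      rwa [e] at h
  | zero => rw [map_zero]; exact zero_mem _
  | add x y _ _ hx hy => rw [map_add]; exact add_mem hx hy
  | smul f x _ hx => rw [actOp_smul]; exact Submodule.smul_mem _ _ hx

variable (c : ReflectionClass (groupMM3 K m) → K) {c₀ : K}
  (hc : ∀ s : Reflection (groupMM3 K m), c s.conjClass = c₀)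
  {ξ : K} (hξ : IsPrimitiveRoot ξ m)
include hc hξ

/-- The first two families are invariants times constants. In the third, the image of `x_i^m ⊗ v`
depends on `i` and `v` only through `flip i j v`, which does not change when `i` and `v` are
translated together. -/
theorem dunkl_relation (j : Fin 3) {w : Fin 3 → MvPolynomial (Fin 3) K} (hw : IsRelation K m w) :
    dunkl (underlyingPermHom K m m 3) c j w = 0 := by
  cases hw with
  | prod v hv => exact dunkl_smul_constVec _ c j polyAct_prodX v
  | psum v hv => exact dunkl_smul_constVec _ c j polyAct_psumX v
  | pow i i' v hv =>
    rw [map_sub, dunkl_powVec c hc hξ i j hv, dunkl_powVec c hc hξ i' j (sum_shift hv _),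
      flip_shift, sub_self]

/-- The generators are killed, and moving a Dunkl operator past a variable only costs group
elements, under which the relations are stable. -/
theorem dunkl_mem_relSub (j : Fin 3) {w : Fin 3 → MvPolynomial (Fin 3) K}
    (hw : w ∈ relSub K m) : dunkl (underlyingPermHom K m m 3) c j w ∈ relSub K m := by
  induction hw using Submodule.span_induction with
  | mem x hx => rw [dunkl_relation c hc hξ j hx]; exact zero_mem _
  | zero => rw [map_zero]; exact zero_mem _
  | add x y _ _ hx hy => rw [map_add]; exact add_mem hx hy
  | smul f x hxN hx =>
    induction f using MvPolynomial.induction_on with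
    | C r =>
      rw [← algebraMap_eq, algebraMap_smul, map_smul]
      exact K_smul_mem r hx
    | add f g hf hg => rw [add_smul, map_add]; exact add_mem hf hg
    | mul_X f i hf =>
      rw [mul_comm, mul_smul, dunkl_X_smul, commOp_apply]
      exact add_mem (Submodule.smul_mem _ _ hf) (Submodule.sum_mem _ fun s _ =>
        K_smul_mem _ (actOp_mem_relSub s.1 (Submodule.smul_mem _ f hxN)))

omit hc hξ [NeZero m]

theorem X_mul_X_mul_X_smul_mem {i j k : Fin 3} (hij : i ≠ j) (hik : i ≠ k) (hjk : j ≠ k)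
    {v : Fin 3 → K} (hv : ∑ i, v i = 0) (f : MvPolynomial (Fin 3) K) :
    (X i * X j * X k * f) • constVec 3 v ∈ relSub K m := by
  have e : X i * X j * X k = prodX K := by
    have : ({i, j, k} : Finset (Fin 3)) = Finset.univ := by
      revert i j k; decide
    have h : ∏ l ∈ ({i, j, k} : Finset (Fin 3)), (X l : MvPolynomial (Fin 3) K) =
      X i * X j * X k := by
      rw [Finset.prod_insert (by simp [hij, hik]), Finset.prod_insert (by simp [hjk]),
        Finset.prod_singleton, mul_assoc]
    rw [← h, this, Fin.prod_univ_three, prodX]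
  rw [e, mul_comm, mul_smul]
  exact Submodule.smul_mem _ _ (IsRelation.prod v hv).mem

end Relations

/-! ### The columns of the three matrices -/

section Columns

variable {K : Type*} [Field K] {m : ℕ}

/-- The polynomial vector with coordinate sum zero that is given by a column. -/
def colVec (K : Type*) [Field K] :
    (Fin 2 → MvPolynomial (Fin 3) K) →ₗ[MvPolynomial (Fin 3) K]
      (Fin 3 → MvPolynomial (Fin 3) K) where
  toFun u := ![u 0, -u 1, u 1 - u 0]
  map_add' u w := by
    ext1 i
    fin_cases i
    · rfl
    · change -(u 1 + w 1) = -u 1 + -w 1; ring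
    · change (u 1 + w 1) - (u 0 + w 0) = (u 1 - u 0) + (w 1 - w 0); ring
  map_smul' f u := by
    ext1 i
    fin_cases i
    · rfl
    · change -(f * u 1) = f * -u 1; ring
    · change f * u 1 - f * u 0 = f * (u 1 - u 0); ring

theorem colVec_injective : Function.Injective (colVec K) := by
  rw [injective_iff_map_eq_zero]
  intro u hu
  ext1 i
  fin_cases i
  · exact congrFun hu 0
  · exact neg_eq_zero.1 (congrFun hu 1)

theorem colVec_C {v : Fin 3 → K} (hv : ∑ i, v i = 0) :
    colVec K ![C (v 0), -C (v 1)] = constVec 3 v := by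
  ext1 i
  fin_cases i
  · rfl
  · change - -C (v 1) = C (v 1); rw [neg_neg]
  · change -C (v 1) - C (v 0) = C (v 2)
    rw [← C_neg, ← C_sub]
    congr 1
    rw [Fin.sum_univ_three] at hv
    linear_combination -hv

/-- The values of the two basis vectors of `γ₀`. -/
theorem sum_gamma0Basis (i : Fin 2) : ∑ l, (gamma0Basis K i).1 l = 0 := (gamma0Basis K i).2

theorem colVec_eq_sum (u : Fin 2 → MvPolynomial (Fin 3) K) :
    colVec K u = ∑ i, u i • constVec 3 (gamma0Basis K i).1 := by
  ext1 l
  rw [Fin.sum_univ_two]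
  fin_cases l <;> (simp [colVec, gamma0Basis, constVec]; try ring)

theorem koszul₁_mem_relSub (u : Fin 3 → Fin 2 → MvPolynomial (Fin 3) K) :
    colVec K (koszul₁ (matrixSeq K m) u) ∈ relSub K m := by
  rw [koszul₁_apply, map_add, map_add, matrixSeq_zero_mulVec, matrixSeq_one_mulVec, map_smul,
    map_smul, colVec_eq_sum, colVec_eq_sum, Finset.smul_sum, Finset.smul_sum]
  refine add_mem (add_mem ?_ ?_) ?_
  · refine Submodule.sum_mem _ fun i _ => ?_
    rw [smul_comm]
    exact Submodule.smul_mem _ _ (IsRelation.prod _ (sum_gamma0Basis i)).mem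
  · refine Submodule.sum_mem _ fun i _ => ?_
    rw [smul_comm]
    exact Submodule.smul_mem _ _ (IsRelation.psum _ (sum_gamma0Basis i)).mem
  · have h1 := (IsRelation.pow (m := m) 0 2 _ (sum_gamma0Basis (K := K) 0)).mem
    have h2 := (IsRelation.pow (m := m) 0 1 _ (sum_gamma0Basis (K := K) 1)).mem
    -- Translation by `2` takes `e₁` to `e₂`, and translation by `1` takes `e₂` to `e₁`. So the
    -- columns of the third matrix are the negatives of the relations between `x_0, x_2` at `e₁` and
    -- between `x_0, x_1` at `e₂`.
    have e : colVec K (matrixSeq K m 2 *ᵥ u 2) =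
        -(u 2 0 • (powVec 0 m (gamma0Basis K 0).1 - powVec 2 m (shift (2 - 0) (gamma0Basis K 0).1))) -
        u 2 1 • (powVec 0 m (gamma0Basis K 1).1 - powVec 1 m (shift (1 - 0) (gamma0Basis K 1).1)) := by
      rw [matrixSeq_two_mulVec]
      ext1 l
      match l with
      | 0 => simp [colVec, gamma0Basis, powVec, constVec, shift]; ring
      | 1 => simp [colVec, gamma0Basis, powVec, constVec, shift]; ring
      | 2 => simp [colVec, gamma0Basis, powVec, constVec, shift]; ring
    rw [e]
    exact sub_mem (neg_mem (Submodule.smul_mem _ _ h1)) (Submodule.smul_mem _ _ h2)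

/-- It suffices to treat relations that start at index `0`: the one for `(i, j)` is the difference
of those for `(0, j)` and `(0, i)` at a translated vector. Those that are not columns of the third
matrix need a multiple of the power sum. -/
theorem relSub_le_map_range : relSub K m ≤
    Submodule.map (colVec K) (LinearMap.range (koszul₁ (matrixSeq K m))) := by
  set R := Submodule.map (colVec K) (LinearMap.range (koszul₁ (matrixSeq K m)))
  have h0 : ∀ u, prodX K • colVec K u ∈ R := fun u =>
    ⟨_, ⟨![u, 0, 0], rfl⟩, by rw [koszul₁_apply, matrixSeq_zero_mulVec]; simp⟩
  have h1 : ∀ u, psumX K m • colVec K u ∈ R := fun u =>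
    ⟨_, ⟨![0, u, 0], rfl⟩, by rw [koszul₁_apply, matrixSeq_one_mulVec]; simp⟩
  have hpow : ∀ j (v : Fin 3 → K), ∑ i, v i = 0 →
      powVec 0 m v - powVec j m (shift j v) ∈ R := by
    intro j v hv
    have hv2 : v 2 = -v 0 - v 1 := by rw [Fin.sum_univ_three] at hv; linear_combination hv
    fin_cases j
    · rw [Fin.zero_eta, shift_zero, sub_self]; exact zero_mem _
    -- Here `v = v₀ e₁ - v₁ e₂`. The relation at `e₁` is the power sum times `e₂`, minus the first
    -- column of the third matrix, plus its second column; the relation at `-e₂` is the second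
    -- column itself.
    · refine ⟨_, ⟨![0, ![0, C (v 0)], ![-C (v 0), C (v 0) + C (v 1)]], rfl⟩, ?_⟩
      rw [koszul₁_apply, matrixSeq_zero_mulVec, matrixSeq_one_mulVec, matrixSeq_two_mulVec]
      ext1 l
      match l with
      | 0 => simp [colVec, powVec, constVec, shift, psumX, show (-1 : Fin 3) = 2 from rfl, hv2]; ring
      | 1 => simp [colVec, powVec, constVec, shift, psumX]; ring
      | 2 => simp [colVec, powVec, constVec, shift, psumX, hv2]; ring
    · refine ⟨_, ⟨![0, ![-C (v 1), 0], ![-C (v 0) - C (v 1), C (v 1)]], rfl⟩, ?_⟩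
      rw [koszul₁_apply, matrixSeq_zero_mulVec, matrixSeq_one_mulVec, matrixSeq_two_mulVec]
      ext1 l
      match l with
      | 0 => simp [colVec, powVec, constVec, shift, psumX, show (-2 : Fin 3) = 1 from rfl]; ring
      | 1 => simp [colVec, powVec, constVec, shift, psumX, hv2]
      | 2 => simp [colVec, powVec, constVec, shift, psumX, hv2]; ring
  refine Submodule.span_le.2 ?_
  rintro w (⟨v, hv⟩ | ⟨v, hv⟩ | ⟨i, j, v, hv⟩)
  · rw [SetLike.mem_coe, ← colVec_C hv]; exact h0 _
  · rw [SetLike.mem_coe, ← colVec_C hv]; exact h1 _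
  · have a := hpow i (shift (-i) v) (sum_shift hv _)
    have b := hpow j (shift (-i) v) (sum_shift hv _)
    rw [shift_shift, add_neg_cancel, shift_zero] at a
    rw [shift_shift, ← sub_eq_add_neg] at b
    have := sub_mem b a
    rwa [sub_sub_sub_cancel_left] at this

end Columns

/-! ### The pairing with the top degree -/

section Top

variable {K : Type*} [Field K] {m : ℕ}

theorem coeff_mul_C_apply {n : ℕ} (μ : Fin n →₀ ℕ) (f : MvPolynomial (Fin n) K) (a : K) :
    coeff μ (f * C a) = coeff μ f * a := by
  rw [mul_comm, coeff_C_mul, mul_comm]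

/-- The exponent of `x_i ^ m * x_j ^ m`. -/
def topExp (m : ℕ) (i j : Fin 3) : Fin 3 →₀ ℕ := Finsupp.single i m + Finsupp.single j m

theorem topExp_comm (i j : Fin 3) : topExp m i j = topExp m j i := add_comm _ _

theorem exists_topExp_apply_eq_zero (i j : Fin 3) : ∃ k, topExp m i j k = 0 := by
  obtain ⟨k, h1, h2⟩ : ∃ k, i ≠ k ∧ j ≠ k := by revert i j; decide
  exact ⟨k, by simp [topExp, h1, h2]⟩

/-- The linear form with values in `K ^ 3` that reads off the part of degree `2 m`. -/
def topMap (K : Type*) [Field K] (m : ℕ) :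
    (Fin 3 → MvPolynomial (Fin 3) K) →ₗ[K] (Fin 3 → K) where
  toFun w q := coeff (topExp m 0 0) (w (q + 0 + 0)) + coeff (topExp m 1 1) (w (q + 1 + 1)) +
    coeff (topExp m 2 2) (w (q + 2 + 2)) + coeff (topExp m 0 1) (w (q + 0 + 1)) +
    coeff (topExp m 0 2) (w (q + 0 + 2)) + coeff (topExp m 1 2) (w (q + 1 + 2))
  map_add' u w := by funext q; simp only [Pi.add_apply, coeff_add]; ring
  map_smul' a w := by
    funext q; simp only [Pi.smul_apply, coeff_smul, RingHom.id_apply, smul_eq_mul]; ring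

theorem topMap_apply (w : Fin 3 → MvPolynomial (Fin 3) K) (q : Fin 3) :
    topMap K m w q = coeff (topExp m 0 0) (w (q + 0 + 0)) + coeff (topExp m 1 1) (w (q + 1 + 1)) +
    coeff (topExp m 2 2) (w (q + 2 + 2)) + coeff (topExp m 0 1) (w (q + 0 + 1)) +
    coeff (topExp m 0 2) (w (q + 0 + 2)) + coeff (topExp m 1 2) (w (q + 1 + 2)) := rfl

theorem topMap_eq_zero {w : Fin 3 → MvPolynomial (Fin 3) K}
    (h : ∀ l i j, coeff (topExp m i j) (w l) = 0) : topMap K m w = 0 := by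
  funext q
  simp [topMap_apply, h]

theorem degree_topExp (i j : Fin 3) : (topExp m i j).degree = 2 * m := by
  rw [topExp, map_add, Finsupp.degree_single, Finsupp.degree_single, two_mul]

theorem topMap_of_mem_vecPart {d : ℤ} (hd : d ≠ 2 * m) {w : Fin 3 → MvPolynomial (Fin 3) K}
    (hw : w ∈ vecPart K 3 (Fin 3) d) : topMap K m w = 0 :=
  topMap_eq_zero fun l i j => hw l _ (by rw [degree_topExp]; push_cast; exact hd.symm)

theorem coeff_topExp_mul_self (i j : Fin 3) (f : MvPolynomial (Fin 3) K) :
    coeff (topExp m i j) (X i ^ m * f) = coeff (Finsupp.single j m) f := by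
  rw [X_pow_eq_monomial, topExp, coeff_monomial_mul, one_mul]

theorem coeff_topExp_mul_of_ne (hm : m ≠ 0) {i j k : Fin 3} (hi : i ≠ k) (hj : j ≠ k)
    (f : MvPolynomial (Fin 3) K) : coeff (topExp m i j) (X k ^ m * f) = 0 := by
  rw [X_pow_eq_monomial, coeff_monomial_mul', if_neg]
  intro h
  have := h k
  simp [topExp, hi, hj, hm] at this

theorem topMap_X_pow_smul (hm : m ≠ 0) (i : Fin 3) (w : Fin 3 → MvPolynomial (Fin 3) K)
    (q : Fin 3) : topMap K m ((X i : MvPolynomial (Fin 3) K) ^ m • w) q =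
      ∑ t, coeff (Finsupp.single t m) (w (q + i + t)) := by
  rw [topMap_apply, Fin.sum_univ_three]
  simp only [Pi.smul_apply, smul_eq_mul]
  match i with
  | 0 =>
    rw [coeff_topExp_mul_self, coeff_topExp_mul_self, coeff_topExp_mul_self,
      coeff_topExp_mul_of_ne hm (i := 1) (j := 1) (by decide) (by decide),
      coeff_topExp_mul_of_ne hm (i := 2) (j := 2) (by decide) (by decide),
      coeff_topExp_mul_of_ne hm (i := 1) (j := 2) (by decide) (by decide)]
    ring
  | 1 =>
    rw [coeff_topExp_mul_self, coeff_topExp_mul_self, topExp_comm 0 1, coeff_topExp_mul_self,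
      coeff_topExp_mul_of_ne hm (i := 0) (j := 0) (by decide) (by decide),
      coeff_topExp_mul_of_ne hm (i := 2) (j := 2) (by decide) (by decide),
      coeff_topExp_mul_of_ne hm (i := 0) (j := 2) (by decide) (by decide), add_right_comm q 0 1]
    ring
  | 2 =>
    rw [coeff_topExp_mul_self, topExp_comm 0 2, coeff_topExp_mul_self, topExp_comm 1 2,
      coeff_topExp_mul_self,
      coeff_topExp_mul_of_ne hm (i := 0) (j := 0) (by decide) (by decide),
      coeff_topExp_mul_of_ne hm (i := 1) (j := 1) (by decide) (by decide),
      coeff_topExp_mul_of_ne hm (i := 0) (j := 1) (by decide) (by decide), add_right_comm q 0 2,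
      add_right_comm q 1 2]
    ring

theorem topMap_topExp (hm : m ≠ 0) (i j : Fin 3) (v : Fin 3 → K) (q : Fin 3) :
    topMap K m (monomial (topExp m i j) (1 : K) • constVec 3 v) q = v (q + i + j) := by
  have e : monomial (topExp m i j) (1 : K) = X i ^ m * X j ^ m := by
    rw [X_pow_eq_monomial, X_pow_eq_monomial, monomial_mul, one_mul, topExp]
  rw [e, mul_smul, topMap_X_pow_smul hm, Finset.sum_eq_single j]
  · rw [Pi.smul_apply, constVec, smul_eq_mul, coeff_mul_C_apply, coeff_X_pow, if_pos rfl, one_mul]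
  · intro t _ ht
    rw [Pi.smul_apply, constVec, smul_eq_mul, coeff_mul_C_apply, coeff_X_pow, if_neg, zero_mul]
    rw [Finsupp.single_left_inj hm]
    exact ht.symm
  · simp

theorem topMap_monomial_of_ne {ν : Fin 3 →₀ ℕ} (h : ∀ i j, ν ≠ topExp m i j) (v : Fin 3 → K) :
    topMap K m (monomial ν (1 : K) • constVec 3 v) = 0 :=
  topMap_eq_zero fun l i j => by
    rw [Pi.smul_apply, constVec, smul_eq_mul, coeff_mul_C_apply, coeff_monomial, if_neg (h i j), zero_mul]

/-- No monomial `x_i^m x_j^m` involves all three variables, so `xyz` contributes nothing. For the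
power sum, the index `q + i + t` runs through all of `ℤ/3` and the coordinates of `v` add up to
zero. In the third family the translation by `j - i` compensates the change of index. -/
theorem topMap_smul_relation (hm : m ≠ 0) {w : Fin 3 → MvPolynomial (Fin 3) K}
    (hw : IsRelation K m w) (f : MvPolynomial (Fin 3) K) : topMap K m (f • w) = 0 := by
  have hpow : ∀ i v q, topMap K m (f • powVec i m v) q =
      ∑ t, coeff (Finsupp.single t m) f * v (q + i + t) := by
    intro i v q
    rw [powVec, smul_comm, topMap_X_pow_smul hm]
    refine Finset.sum_congr rfl fun t _ => ?_
    rw [Pi.smul_apply, constVec, smul_eq_mul, coeff_mul_C_apply]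
  cases hw with
  | prod v hv =>
    refine topMap_eq_zero fun l i j => ?_
    obtain ⟨k, hk⟩ := exists_topExp_apply_eq_zero (m := m) i j
    have hd : ∃ r, f * (prodX K * C (v l)) = X k * r := by
      match k with
      | 0 => exact ⟨f * (X 1 * X 2 * C (v l)), by rw [prodX]; ring⟩
      | 1 => exact ⟨f * (X 0 * X 2 * C (v l)), by rw [prodX]; ring⟩
      | 2 => exact ⟨f * (X 0 * X 1 * C (v l)), by rw [prodX]; ring⟩
    obtain ⟨r, hr⟩ := hd
    change coeff (topExp m i j) (f * (prodX K * C (v l))) = 0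
    rw [hr, coeff_X_mul', if_neg]
    simpa using hk
  | psum v hv =>
    have e : f • psumX K m • constVec 3 v = ∑ i, f • powVec i m v := by
      rw [psumX_eq_sum, Finset.sum_smul, Finset.smul_sum]; rfl
    funext q
    rw [e, map_sum, Finset.sum_apply]
    simp only [hpow]
    rw [Finset.sum_comm, Pi.zero_apply]
    refine Finset.sum_eq_zero fun t _ => ?_
    rw [← Finset.mul_sum, ← Equiv.sum_comp (Equiv.subRight (q + t))]
    have : ∀ i, q + Equiv.subRight (q + t) i + t = i := fun i => by
      rw [Equiv.subRight_apply]; abel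
    simp only [this, hv, mul_zero]
  | pow i j v hv =>
    funext q
    rw [smul_sub, map_sub, Pi.sub_apply, hpow, hpow, Pi.zero_apply, sub_eq_zero]
    refine Finset.sum_congr rfl fun t _ => ?_
    rw [shift]
    congr 2
    abel

theorem topMap_relSub (hm : m ≠ 0) {w : Fin 3 → MvPolynomial (Fin 3) K} (hw : w ∈ relSub K m) :
    topMap K m w = 0 := by
  suffices h : ∀ f : MvPolynomial (Fin 3) K, topMap K m (f • w) = 0 by simpa using h 1
  induction hw using Submodule.span_induction with
  | mem x hx => exact topMap_smul_relation hm hx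
  | zero => simp
  | add x y _ _ hx hy => intro f; rw [smul_add, map_add, hx, hy, add_zero]
  | smul g x _ hx => intro f; rw [smul_smul]; exact hx _

/-! ### The normal monomials -/

/-- The indices of the normal monomials. -/
abbrev NormalIdx (m : ℕ) : Type := Fin 3 ⊕ (Fin 3 × Fin (m - 1) × Fin (m + 1))

/-- The exponents of the normal monomials: `x_0 ^ (m s)` for `s ≤ 2` and `x_i ^ k * x_{i+1} ^ l` for
`0 < k < m` and `l ≤ m`. -/
def normalExp : NormalIdx m → (Fin 3 →₀ ℕ)
  | .inl s => Finsupp.single 0 (m * s)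
  | .inr (i, k, l) => Finsupp.single i (k + 1 : ℕ) + Finsupp.single (i + 1) (l : ℕ)

/-- The exponents of the dual monomials. -/
def dualExp : NormalIdx m → (Fin 3 →₀ ℕ)
  | .inl s => Finsupp.single 0 (m * (2 - s))
  | .inr (i, k, l) => Finsupp.single i (m - 1 - k : ℕ) + Finsupp.single (i + 1) (m - l : ℕ)

/-- The translation of indices that belongs to a normal monomial. -/
def normalShift : NormalIdx m → Fin 3
  | .inl _ => 0
  | .inr (i, _, _) => i + (i + 1)

theorem normalExp_add_dualExp (ω : NormalIdx m) :
    ∃ i j, normalExp ω + dualExp ω = topExp m i j ∧ i + j = normalShift ω := by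
  rcases ω with s | ⟨i, k, l⟩
  · refine ⟨0, 0, ?_, rfl⟩
    rw [normalExp, dualExp, topExp, ← Finsupp.single_add, ← Finsupp.single_add, ← mul_add,
      show (s : ℕ) + (2 - s) = 2 by omega, mul_two]
  · refine ⟨i, i + 1, ?_, rfl⟩
    have h1 := k.2
    have h2 := l.2
    rw [normalExp, dualExp, topExp, add_add_add_comm, ← Finsupp.single_add, ← Finsupp.single_add]
    congr 2 <;> omega

theorem degree_normalExp_add_dualExp (ω : NormalIdx m) :
    (normalExp ω).degree + (dualExp ω).degree = 2 * m := by
  obtain ⟨i, j, h, -⟩ := normalExp_add_dualExp ω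
  rw [← map_add, h, degree_topExp]

theorem dvd_topExp (i j x : Fin 3) : m ∣ topExp m i j x := by
  rw [topExp, Finsupp.add_apply]
  refine Nat.dvd_add ?_ ?_ <;> rw [Finsupp.single_apply] <;> split_ifs <;> simp

/-- Every exponent of the product must be a multiple of `m`. If the two leading indices differ, some
variable has an exponent strictly between `0` and `m`; if they agree, that variable has an exponent
strictly between `0` and `2 m`, so it equals `m` and the two values of `k` agree, and the degree
determines the rest. -/
theorem eq_of_normalExp_add_dualExp (hm : m ≠ 0) {ω ω' : NormalIdx m} {i j : Fin 3}
    (h : normalExp ω + dualExp ω' = topExp m i j) : ω = ω' := by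
  have hdvd : ∀ x, m ∣ normalExp ω x + dualExp ω' x := fun x => by
    rw [← Finsupp.add_apply, h]; exact dvd_topExp i j x
  have hdeg : (normalExp ω).degree + (dualExp ω').degree = 2 * m := by
    rw [← map_add, h, degree_topExp]
  have hdeg' := degree_normalExp_add_dualExp ω'
  have n1 : ∀ i : Fin 3, i + 1 ≠ i := by decide
  have n2 : ∀ i : Fin 3, i + 1 + 1 ≠ i := by decide
  have n3 : ∀ i : Fin 3, i + 1 + 1 + 1 = i := by decide
  have hlt : ∀ a, 0 < a → a < m → ¬ m ∣ a := fun a h1 h2 => Nat.not_dvd_of_pos_of_lt h1 h2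
  rcases ω with s | ⟨i, k, l⟩ <;> rcases ω' with s' | ⟨i', k', l'⟩
  · simp only [normalExp, dualExp, Finsupp.degree_single] at hdeg hdeg'
    have : m * (s : ℕ) = m * s' := by omega
    rw [Sum.inl.injEq]
    exact Fin.ext (Nat.eq_of_mul_eq_mul_left (Nat.pos_of_ne_zero hm) this)
  · exfalso
    have hk := k'.2
    have h1 := hdvd i'
    simp only [normalExp, dualExp, Finsupp.add_apply, Finsupp.single_apply, if_true,
      if_neg (n1 i'), add_zero] at h1
    have h2 : m ∣ if 0 = i' then m * (s : ℕ) else 0 := by split_ifs <;> simp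
    exact hlt _ (by omega) (by omega) ((Nat.dvd_add_right h2).1 h1)
  · exfalso
    have hk := k.2
    have h1 := hdvd i
    simp only [normalExp, dualExp, Finsupp.add_apply, Finsupp.single_apply, if_true,
      if_neg (n1 i), add_zero] at h1
    have h2 : m ∣ if 0 = i then m * (2 - (s' : ℕ)) else 0 := by split_ifs <;> simp
    exact hlt _ (by omega) (by omega) ((Nat.dvd_add_left h2).1 h1)
  · have hk := k.2
    have hk' := k'.2
    have hi : i' = i ∨ i' = i + 1 ∨ i' = i + 1 + 1 := by clear * -; revert i i'; decide
    rcases hi with rfl | rfl | rfl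
    · have h1 := hdvd i'
      simp only [normalExp, dualExp, Finsupp.add_apply, Finsupp.single_apply, if_true,
        if_neg (n1 i'), add_zero] at h1
      have h2 : (k : ℕ) = k' := by
        obtain ⟨a, ha⟩ := h1
        have ha1 : a = 1 := by
          have : 0 < a := by
            rcases Nat.eq_zero_or_pos a with rfl | h
            · omega
            · exact h
          have : a < 2 := by
            by_contra! h2
            have := Nat.mul_le_mul_left m h2
            omega
          omega
        subst ha1
        omega
      have h3 : (l : ℕ) = l' := by
        have hl := l.2
        have hl' := l'.2
        simp only [normalExp, dualExp, map_add, Finsupp.degree_single] at hdeg hdeg'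
        omega
      rw [Fin.ext h2, Fin.ext h3]
    · exfalso
      have h1 := hdvd i
      simp only [normalExp, dualExp, Finsupp.add_apply, Finsupp.single_apply, if_true,
        if_neg (n1 i), if_neg (n2 i), add_zero] at h1
      exact hlt _ (by omega) (by omega) h1
    · exfalso
      have h1 := hdvd (i + 1 + 1)
      simp only [normalExp, dualExp, Finsupp.add_apply, Finsupp.single_apply, if_true,
        if_neg (n2 i).symm, if_neg (n1 (i + 1)).symm, n3, add_zero, zero_add] at h1
      exact hlt _ (by omega) (by omega) h1

end Top

/-! ### Normal forms modulo the relations -/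

section Normal

variable {K : Type*} [Field K] {m : ℕ}

/-- The coordinates with respect to the normal monomials, up to translations of the indices. -/
def normalCoord (K : Type*) [Field K] (m : ℕ) :
    (Fin 3 → MvPolynomial (Fin 3) K) →ₗ[K] (NormalIdx m → Fin 3 → K) :=
  LinearMap.pi fun ω => topMap K m ∘ₗ
    (Algebra.lsmul K K (Fin 3 → MvPolynomial (Fin 3) K) (monomial (dualExp ω) (1 : K)))

theorem normalCoord_apply (w : Fin 3 → MvPolynomial (Fin 3) K) (ω : NormalIdx m) :
    normalCoord K m w ω = topMap K m (monomial (dualExp ω) (1 : K) • w) := rfl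

theorem normalCoord_relSub (hm : m ≠ 0) {w : Fin 3 → MvPolynomial (Fin 3) K}
    (hw : w ∈ relSub K m) : normalCoord K m w = 0 := by
  funext ω
  rw [normalCoord_apply, topMap_relSub hm (Submodule.smul_mem _ _ hw)]
  rfl

theorem monomial_smul_mem_vecPart (μ : Fin 3 →₀ ℕ) {d : ℤ} {w : Fin 3 → MvPolynomial (Fin 3) K}
    (hw : w ∈ vecPart K 3 (Fin 3) d) :
    monomial μ (1 : K) • w ∈ vecPart K 3 (Fin 3) (d + μ.degree) := by
  induction μ using finsupp_nat_induction with
  | h0 => simpa using hw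
  | hs μ i ih =>
    rw [monomial_add_single_smul, map_add, Finsupp.degree_single, Nat.cast_add, Nat.cast_one,
      ← add_assoc]
    exact X_smul_mem_vecPart ih i

theorem normalCoord_of_mem_vecPart {d : ℤ} {ω : NormalIdx m} (hd : d ≠ (normalExp ω).degree)
    {w : Fin 3 → MvPolynomial (Fin 3) K} (hw : w ∈ vecPart K 3 (Fin 3) d) :
    normalCoord K m w ω = 0 := by
  refine topMap_of_mem_vecPart ?_ (monomial_smul_mem_vecPart (dualExp ω) hw)
  have := degree_normalExp_add_dualExp ω
  omega

/-- The combination of the normal monomials with given coefficients. -/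
def normalVec (K : Type*) [Field K] (m : ℕ) :
    (NormalIdx m → sumZero K 3) →ₗ[K] (Fin 3 → MvPolynomial (Fin 3) K) where
  toFun v := ∑ ω, monomial (normalExp ω) (1 : K) • constVec 3 (v ω).1
  map_add' u v := by
    simp only [Pi.add_apply, Submodule.coe_add, constVec_add, smul_add, Finset.sum_add_distrib]
  map_smul' a v := by
    simp only [Pi.smul_apply, Submodule.coe_smul, constVec_smul, RingHom.id_apply, Finset.smul_sum]
    exact Finset.sum_congr rfl fun ω _ => smul_comm _ _ _

theorem normalVec_apply (v : NormalIdx m → sumZero K 3) :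
    normalVec K m v = ∑ ω, monomial (normalExp ω) (1 : K) • constVec 3 (v ω).1 := rfl

theorem normalVec_single (ω : NormalIdx m) (v : sumZero K 3) :
    normalVec K m (Pi.single ω v) = monomial (normalExp ω) (1 : K) • constVec 3 v.1 := by
  rw [normalVec_apply, Finset.sum_eq_single ω]
  · rw [Pi.single_eq_same]
  · intro ω' _ h
    rw [Pi.single_eq_of_ne h]
    ext1 l
    simp [constVec]
  · simp

/-- Normal and dual monomials are dual to each other under `(f, w) ↦ topMap (f • w)`, up to a
translation of indices. As this pairing vanishes on the relations, the normal monomials are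
independent modulo them. -/
theorem normalCoord_normal_smul (hm : m ≠ 0) (ω ω' : NormalIdx m) (v : Fin 3 → K) :
    normalCoord K m (monomial (normalExp ω) (1 : K) • constVec 3 v) ω' =
      if ω = ω' then fun q => v (q + normalShift ω) else 0 := by
  rw [normalCoord_apply, smul_smul, monomial_mul, one_mul, add_comm]
  split_ifs with h
  · subst h
    obtain ⟨i, j, h, h'⟩ := normalExp_add_dualExp ω
    funext q
    rw [h, topMap_topExp hm, ← h', add_assoc]
  · exact topMap_monomial_of_ne (fun i j h' => h (eq_of_normalExp_add_dualExp hm h')) v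

theorem normalCoord_normalVec (hm : m ≠ 0) (v : NormalIdx m → sumZero K 3) (ω : NormalIdx m)
    (q : Fin 3) : normalCoord K m (normalVec K m v) ω q = (v ω).1 (q + normalShift ω) := by
  rw [normalVec_apply, map_sum, Finset.sum_apply, Finset.sum_eq_single ω]
  · rw [normalCoord_normal_smul hm, if_pos rfl]
  · intro ω' _ h
    rw [normalCoord_normal_smul hm, if_neg h]
  · simp

theorem normalVec_eq_zero (hm : m ≠ 0) {v : NormalIdx m → sumZero K 3}
    (h : normalCoord K m (normalVec K m v) = 0) : v = 0 := by
  funext ω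
  ext l
  have := normalCoord_normalVec hm v ω (l - normalShift ω)
  rw [h, sub_add_cancel] at this
  exact this.symm

/-- The polynomial vectors that are congruent to combinations of normal monomials. -/
def normalSub (K : Type*) [Field K] (m : ℕ) : Submodule K (Fin 3 → MvPolynomial (Fin 3) K) :=
  (relSub K m).restrictScalars K ⊔ LinearMap.range (normalVec K m)

theorem relSub_le_normalSub {w : Fin 3 → MvPolynomial (Fin 3) K} (hw : w ∈ relSub K m) :
    w ∈ normalSub K m := Submodule.mem_sup_left hw

theorem normal_smul_mem (ω : NormalIdx m) {v : Fin 3 → K} (hv : ∑ i, v i = 0) :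
    monomial (normalExp ω) (1 : K) • constVec 3 v ∈ normalSub K m :=
  Submodule.mem_sup_right ⟨Pi.single ω ⟨v, hv⟩, normalVec_single ω ⟨v, hv⟩⟩

theorem X_pow_smul_sub_mem (i j : Fin 3) (f : MvPolynomial (Fin 3) K) {v : Fin 3 → K}
    (hv : ∑ i, v i = 0) : (X i ^ m * f) • constVec 3 v - (X j ^ m * f) • constVec 3 (shift (j - i) v)
      ∈ relSub K m := by
  have := (relSub K m).smul_mem f (IsRelation.pow (m := m) i j v hv).mem
  rwa [smul_sub, powVec, powVec, smul_smul, smul_smul, mul_comm f, mul_comm f] at this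

/-- A factor `X i ^ m` may be traded for `X j ^ m`, the price being a translation of `v`. All
reductions to normal form come from this and from the vanishing of `xyz`. -/
theorem X_pow_smul_mem {S : Submodule K (Fin 3 → MvPolynomial (Fin 3) K)}
    (hS : (relSub K m).restrictScalars K ≤ S) {i : Fin 3} (j : Fin 3) {f : MvPolynomial (Fin 3) K}
    {v : Fin 3 → K} (hv : ∑ i, v i = 0)
    (h : ∀ v' : Fin 3 → K, ∑ i, v' i = 0 → (X j ^ m * f) • constVec 3 v' ∈ S) :
    (X i ^ m * f) • constVec 3 v ∈ S := by
  have h1 := hS (X_pow_smul_sub_mem i j f hv)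
  have h2 := add_mem h1 (h _ (sum_shift hv (j - i)))
  rwa [sub_add_cancel] at h2

theorem monomial_normalExp_inl (s : Fin 3) :
    monomial (normalExp (m := m) (.inl s)) (1 : K) = X 0 ^ (m * s : ℕ) := by
  rw [normalExp, X_pow_eq_monomial]

theorem monomial_normalExp_inr (i : Fin 3) (k : Fin (m - 1)) (l : Fin (m + 1)) :
    monomial (normalExp (.inr (i, k, l))) (1 : K) = X i ^ (k + 1 : ℕ) * X (i + 1) ^ (l : ℕ) := by
  rw [normalExp, X_pow_eq_monomial, X_pow_eq_monomial, monomial_mul, one_mul]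

theorem one_smul_mem_normalSub {v : Fin 3 → K} (hv : ∑ i, v i = 0) :
    constVec 3 v ∈ normalSub K m := by
  have := normal_smul_mem (m := m) (.inl 0) hv
  rwa [monomial_normalExp_inl, Fin.val_zero, mul_zero, pow_zero, one_smul] at this

theorem X_pow_max_mem_normalSub (i : Fin 3) {v : Fin 3 → K} (hv : ∑ i, v i = 0) :
    (X i ^ m : MvPolynomial (Fin 3) K) • constVec 3 v ∈ normalSub K m := by
  rw [← mul_one (X i ^ m)]
  refine X_pow_smul_mem le_sup_left 0 hv fun v' hv' => ?_
  have := normal_smul_mem (m := m) (.inl 1) hv'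
  rwa [monomial_normalExp_inl, Fin.val_one, mul_one, ← mul_one (X 0 ^ m)] at this

theorem X_pow_mul_X_pow_mem_normalSub_of_lt (i : Fin 3) {k l : ℕ} (hk0 : 0 < k) (hk : k < m)
    (hl : l ≤ m) {v : Fin 3 → K} (hv : ∑ i, v i = 0) :
    (X i ^ k * X (i + 1) ^ l : MvPolynomial (Fin 3) K) • constVec 3 v ∈ normalSub K m := by
  have := normal_smul_mem (m := m) (.inr (i, ⟨k - 1, by omega⟩, ⟨l, by omega⟩)) hv
  rwa [monomial_normalExp_inr, show k - 1 + 1 = k by omega] at this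

theorem X_pow_mem_normalSub (i : Fin 3) {k : ℕ} (hk : k ≤ m) {v : Fin 3 → K}
    (hv : ∑ i, v i = 0) :
    (X i ^ k : MvPolynomial (Fin 3) K) • constVec 3 v ∈ normalSub K m := by
  rcases Nat.eq_zero_or_pos k with rfl | hk0
  · rw [pow_zero, one_smul]; exact one_smul_mem_normalSub hv
  rcases hk.eq_or_lt with rfl | hk
  · exact X_pow_max_mem_normalSub i hv
  · have := X_pow_mul_X_pow_mem_normalSub_of_lt i hk0 hk (Nat.zero_le m) hv
    rwa [pow_zero, mul_one] at this

/-- If both exponents are `m`, both powers are moved to `X 0`. If only the first is `m` and the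
second is positive, the first is moved to the third variable, giving the normal monomial with
leading index `i + 1`. -/
theorem X_pow_mul_X_pow_mem_normalSub (i : Fin 3) {k l : ℕ} (hk : k ≤ m) (hl : l ≤ m)
    {v : Fin 3 → K} (hv : ∑ i, v i = 0) :
    (X i ^ k * X (i + 1) ^ l : MvPolynomial (Fin 3) K) • constVec 3 v ∈ normalSub K m := by
  rcases Nat.eq_zero_or_pos k with rfl | hk0
  · rw [pow_zero, one_mul]; exact X_pow_mem_normalSub _ hl hv
  rcases hk.eq_or_lt with rfl | hk
  · rcases Nat.eq_zero_or_pos l with rfl | hl0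
    · rw [pow_zero, mul_one]; exact X_pow_mem_normalSub _ le_rfl hv
    rcases hl.eq_or_lt with rfl | hl
    · refine X_pow_smul_mem le_sup_left 0 hv fun v' hv' => ?_
      rw [mul_comm]
      refine X_pow_smul_mem le_sup_left 0 hv' fun v'' hv'' => ?_
      have := normal_smul_mem (m := l) (.inl 2) hv''
      rwa [monomial_normalExp_inl, Fin.val_two, pow_mul, sq, ← mul_pow, mul_pow] at this
    · refine X_pow_smul_mem le_sup_left (i + 1 + 1) hv fun v' hv' => ?_
      rw [mul_comm]
      exact X_pow_mul_X_pow_mem_normalSub_of_lt (i + 1) hl0 hl le_rfl hv'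
  · exact X_pow_mul_X_pow_mem_normalSub_of_lt i hk0 hk hl hv

end Normal

/-! ### Reduction to normal monomials -/

section NormalForm

variable {K : Type*} [Field K] {m : ℕ} [NeZero m]

/-- A product that leaves the normal range is made divisible by `xyz` by moving `m`-th powers: in
`x_j x_0^(2m)` the two powers go to the two variables other than `x_j`, and in `x_i^(k+1)
x_(i+1)^(m+1)` one power goes to the third variable. -/
theorem X_mul_normal_mem (j : Fin 3) (ω : NormalIdx m) {v : Fin 3 → K} (hv : ∑ i, v i = 0) :
    (X j * monomial (normalExp ω) (1 : K)) • constVec 3 v ∈ normalSub K m := by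
  have hm : 1 ≤ m := NeZero.one_le
  obtain ⟨r, hr⟩ : ∃ r, m = r + 1 := ⟨m - 1, by omega⟩
  have hi : ∀ i : Fin 3, j = i ∨ j = i + 1 ∨ i = j + 1 := by clear * -; revert j; decide
  have hd1 : ∀ i : Fin 3, i ≠ i + 1 := by decide
  have hd2 : ∀ i : Fin 3, i ≠ i + 1 + 1 := by decide
  rcases ω with s | ⟨i, k, l⟩
  · rw [monomial_normalExp_inl]
    match s with
    | 0 =>
      have := X_pow_mul_X_pow_mem_normalSub j hm (Nat.zero_le m) hv
      simpa using this
    | 1 =>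
      rw [Fin.val_one, mul_one, mul_comm]
      rcases hi 0 with rfl | rfl | h
      · refine X_pow_smul_mem le_sup_left (0 + 1) hv fun v' hv' => ?_
        have := X_pow_mul_X_pow_mem_normalSub 0 hm (le_refl m) hv'
        rwa [pow_one, mul_comm] at this
      · have := X_pow_mul_X_pow_mem_normalSub 0 (le_refl m) hm hv
        rwa [pow_one] at this
      · have := X_pow_mul_X_pow_mem_normalSub j hm (le_refl m) hv
        rwa [pow_one, ← h, mul_comm] at this
    | 2 =>
      refine relSub_le_normalSub ?_
      rw [Fin.val_two, mul_two, pow_add, mul_left_comm]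
      refine X_pow_smul_mem (S := (relSub K m).restrictScalars K) le_rfl (j + 1) hv
        fun v' hv' => ?_
      rw [← mul_assoc, mul_comm]
      refine X_pow_smul_mem (S := (relSub K m).restrictScalars K) le_rfl (j + 1 + 1) hv'
        fun v'' hv'' => ?_
      rw [Submodule.restrictScalars_mem]
      have := X_mul_X_mul_X_smul_mem (m := m) (hd1 j) (hd2 j) (hd1 (j + 1)) hv''
        (X (j + 1) ^ r * X (j + 1 + 1) ^ r)
      convert this using 2
      rw [hr]
      ring
  · have hk := k.2
    have hl := l.2
    rw [monomial_normalExp_inr]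
    rcases hi i with rfl | rfl | rfl
    · rw [← mul_assoc, ← pow_succ']
      exact X_pow_mul_X_pow_mem_normalSub j (by omega) (by omega) hv
    · rw [mul_left_comm, ← pow_succ']
      rcases (show (l : ℕ) + 1 ≤ m ∨ (l : ℕ) = m by omega) with h | h
      · exact X_pow_mul_X_pow_mem_normalSub i (by omega) h hv
      · refine relSub_le_normalSub ?_
        rw [h, mul_comm, pow_succ, mul_assoc]
        refine X_pow_smul_mem (S := (relSub K m).restrictScalars K) le_rfl (i + 1 + 1) hv
          fun v' hv' => ?_
        rw [Submodule.restrictScalars_mem]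
        have := X_mul_X_mul_X_smul_mem (m := m) (hd1 i) (hd2 i) (hd1 (i + 1)) hv'
          (X (i + 1 + 1) ^ r * X i ^ (k : ℕ))
        convert this using 2
        have e : (X (i + 1 + 1) : MvPolynomial (Fin 3) K) ^ m = X (i + 1 + 1) * X (i + 1 + 1) ^ r := by
          rw [hr, pow_succ']
        rw [e]
        ring
    · rcases Nat.eq_zero_or_pos (l : ℕ) with h | h
      · rw [h, pow_zero, mul_one]
        have := X_pow_mul_X_pow_mem_normalSub (m := m) j hm (l := k + 1) (by omega) hv
        rwa [pow_one] at this
      · refine relSub_le_normalSub ?_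
        have := X_mul_X_mul_X_smul_mem (m := m) (hd1 j) (hd2 j) (hd1 (j + 1)) hv
          (X (j + 1) ^ (k : ℕ) * X (j + 1 + 1) ^ (l - 1 : ℕ))
        convert this using 2
        obtain ⟨t, ht⟩ : ∃ t, (l : ℕ) = t + 1 := ⟨l - 1, by omega⟩
        rw [ht, Nat.add_sub_cancel]
        ring

theorem X_smul_mem_normalSub (j : Fin 3) {w : Fin 3 → MvPolynomial (Fin 3) K}
    (hw : w ∈ normalSub K m) : (X j : MvPolynomial (Fin 3) K) • w ∈ normalSub K m := by
  obtain ⟨r, hr, _, ⟨v, rfl⟩, rfl⟩ := Submodule.mem_sup.1 hw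
  rw [smul_add]
  refine add_mem (relSub_le_normalSub ((relSub K m).smul_mem _ hr)) ?_
  rw [normalVec_apply, Finset.smul_sum]
  refine sum_mem fun ω _ => ?_
  rw [smul_smul]
  exact X_mul_normal_mem j ω (v ω).2

theorem smul_mem_normalSub (f : MvPolynomial (Fin 3) K) {w : Fin 3 → MvPolynomial (Fin 3) K}
    (hw : w ∈ normalSub K m) : f • w ∈ normalSub K m := by
  induction f using MvPolynomial.induction_on with
  | C a => rw [← algebraMap_eq, algebraMap_smul]; exact Submodule.smul_mem _ _ hw
  | add f g hf hg => rw [add_smul]; exact add_mem hf hg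
  | mul_X f i hf => rw [mul_comm, mul_smul]; exact X_smul_mem_normalSub i hf

theorem colVec_mem_normalSub (u : Fin 2 → MvPolynomial (Fin 3) K) :
    colVec K u ∈ normalSub K m := by
  rw [colVec_eq_sum]
  exact sum_mem fun i _ => smul_mem_normalSub _ (one_smul_mem_normalSub (sum_gamma0Basis i))

theorem exists_normalVec_sub_mem (u : Fin 2 → MvPolynomial (Fin 3) K) :
    ∃ v, colVec K u - normalVec K m v ∈ relSub K m := by
  obtain ⟨r, hr, _, ⟨v, rfl⟩, h⟩ := Submodule.mem_sup.1 (colVec_mem_normalSub (m := m) u)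
  exact ⟨v, by rw [← h, add_sub_cancel_right]; exact hr⟩

/-- Every column is a combination of normal monomials modulo the relations, and the coordinates
vanish on relations and determine the combination. -/
theorem colVec_mem_relSub_iff (u : Fin 2 → MvPolynomial (Fin 3) K) :
    colVec K u ∈ relSub K m ↔ normalCoord K m (colVec K u) = 0 := by
  refine ⟨normalCoord_relSub (NeZero.ne m), fun h => ?_⟩
  obtain ⟨v, hv⟩ := exists_normalVec_sub_mem (m := m) u
  have h1 := normalCoord_relSub (NeZero.ne m) hv
  rw [map_sub, h, zero_sub, neg_eq_zero] at h1
  rw [normalVec_eq_zero (NeZero.ne m) h1, map_zero, sub_zero] at hv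
  exact hv

end NormalForm

/-! ### Stable submodules that contain the relations -/

section Stable

variable {K : Type*} [Field K] {m : ℕ} [NeZero m]

omit [NeZero m] in
theorem dualExp_inl_two : dualExp (m := m) (.inl 2) = 0 := by
  rw [dualExp, Fin.val_two, Nat.sub_self, mul_zero, Finsupp.single_zero]

theorem degree_dualExp_pos {ω : NormalIdx m} (h : ω ≠ .inl 2) : 0 < (dualExp ω).degree := by
  rcases ω with s | ⟨i, k, l⟩
  · rw [dualExp, Finsupp.degree_single]
    have hs : (s : ℕ) ≠ 2 := fun e => h (by rw [show s = 2 from Fin.ext e])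
    exact Nat.mul_pos (NeZero.pos m) (by omega)
  · have := k.2
    rw [dualExp, map_add, Finsupp.degree_single, Finsupp.degree_single]
    omega

/-- Every polynomial vector that is not a relation has a multiple in the socle. -/
theorem exists_smul_sub_mem {u : Fin 2 → MvPolynomial (Fin 3) K} (hu : colVec K u ∉ relSub K m) :
    ∃ (f : MvPolynomial (Fin 3) K) (v : Fin 3 → K), ∑ i, v i = 0 ∧ v ≠ 0 ∧
      f • colVec K u - powVec 0 (m * 2) v ∈ relSub K m := by
  have hm := NeZero.ne m
  obtain ⟨v, hv⟩ := exists_normalVec_sub_mem (m := m) u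
  have hv0 : ∃ ω, v ω ≠ 0 := by
    by_contra! h
    rw [show v = 0 from funext h, map_zero, sub_zero] at hv
    exact hu hv
  -- With `ω` of lowest degree among the terms present, multiplication by its dual monomial puts
  -- every term in degree at least `2 m`, the top degree of the normal monomials.
  obtain ⟨ω, hω, hmin⟩ := exists_minimalFor_of_wellFoundedLT (fun ω => v ω ≠ 0)
    (fun ω => (normalExp ω).degree) hv0
  obtain ⟨v', hv'⟩ := exists_normalVec_sub_mem (m := m) (monomial (dualExp ω) (1 : K) • u)
  rw [map_smul] at hv'
  have hc : normalCoord K m (normalVec K m v') =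
      normalCoord K m (monomial (dualExp ω) (1 : K) • normalVec K m v) := by
    have h1 := normalCoord_relSub hm hv'
    have h2 := normalCoord_relSub hm ((relSub K m).smul_mem (monomial (dualExp ω) (1 : K)) hv)
    rw [map_sub, sub_eq_zero] at h1
    rw [smul_sub, map_sub, sub_eq_zero] at h2
    rw [← h1, h2]
  -- Only `.inl 2`, that is `x_0^(2m)`, has dual monomial `1`. For any other `ω'`, multiplying by
  -- the dual monomial raises all degrees above `2 m`, where `topMap` vanishes.
  have hz : ∀ ω', ω' ≠ .inl 2 → v' ω' = 0 := by
    intro ω' hω'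
    ext l
    have h1 := normalCoord_normalVec hm v' ω' (l - normalShift ω')
    rw [sub_add_cancel, hc, normalCoord_apply, normalVec_apply, Finset.smul_sum, Finset.smul_sum,
      map_sum, Finset.sum_eq_zero] at h1
    · exact h1.symm
    intro ω'' _
    by_cases h0 : v ω'' = 0
    · rw [h0]
      have : constVec 3 ((0 : sumZero K 3).1) = 0 := by ext1 l; simp [constVec]
      rw [this, smul_zero, smul_zero, smul_zero, map_zero]
    · rw [smul_smul, smul_smul, monomial_mul, monomial_mul, one_mul, one_mul]
      refine topMap_monomial_of_ne (fun i j e => ?_) _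
      have e' := congrArg Finsupp.degree e
      rw [degree_topExp, map_add, map_add] at e'
      have h2 := degree_dualExp_pos hω'
      have h3 := degree_normalExp_add_dualExp ω
      have h4 : (normalExp ω).degree ≤ (normalExp ω'').degree := by
        rcases le_total (normalExp ω).degree (normalExp ω'').degree with h | h
        · exact h
        · exact hmin h0 h
      omega
  refine ⟨monomial (dualExp ω) 1, (v' (.inl 2)).1, (v' (.inl 2)).2, ?_, ?_⟩
  · intro h
    refine hω ?_
    ext l
    have h1 := normalCoord_normalVec hm v ω (l - normalShift ω)
    have h2 := fun q => normalCoord_normalVec hm v' (.inl 2) q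
    rw [hc] at h2
    simp only [normalCoord_apply, dualExp_inl_two, monomial_zero', C_1, one_smul, h] at h2
    rw [sub_add_cancel, normalCoord_apply, h2] at h1
    exact h1.symm
  · have e : normalVec K m v' = powVec 0 (m * 2) (v' (.inl 2)).1 := by
      have : v' = Pi.single (.inl 2) (v' (.inl 2)) := by
        funext ω'
        by_cases h : ω' = .inl 2
        · subst h; rw [Pi.single_eq_same]
        · rw [Pi.single_eq_of_ne h, hz ω' h]
      rw [this, normalVec_single, monomial_normalExp_inl, Pi.single_eq_same]
      rfl
    rwa [e] at hv'

variable {S : Submodule (MvPolynomial (Fin 3) K) (Fin 3 → MvPolynomial (Fin 3) K)}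

theorem mem_of_K_smul_mem {a : K} (ha : a ≠ 0) {w : Fin 3 → MvPolynomial (Fin 3) K}
    (hw : a • w ∈ S) : w ∈ S := by
  have := K_smul_mem a⁻¹ hw
  rwa [inv_smul_smul₀ ha] at this

/-- Applied to `x_0^(k+1) ⊗ v`, the operator `D_0` gives, modulo the relations, `x_0^k` times a
reflected `v`, with factor `c₀ m` if `k < m` and `-c₀ m` otherwise. Neither factor vanishes, so one
can descend to degree zero. -/
theorem exists_constVec_mem (c : ReflectionClass (groupMM3 K m) → K) {c₀ : K}
    (hc : ∀ s : Reflection (groupMM3 K m), c s.conjClass = c₀)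
    {ξ : K} (hξ : IsPrimitiveRoot ξ m) (hc₀ : c₀ * m ≠ 0) (hR : relSub K m ≤ S)
    (hD : ∀ w ∈ S, dunkl (underlyingPermHom K m m 3) c 0 w ∈ S) {k : ℕ} (hk : k ≤ m * 2)
    {v : Fin 3 → K} (hv : ∑ i, v i = 0) (hv0 : v ≠ 0) (h : powVec 0 k v ∈ S) :
    ∃ v' : Fin 3 → K, ∑ i, v' i = 0 ∧ v' ≠ 0 ∧ constVec 3 v' ∈ S := by
  have hflip : ∀ v : Fin 3 → K, v ≠ 0 → flip 0 0 v ≠ 0 := by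
    intro v hv0 h
    refine hv0 (funext fun l => ?_)
    have := congrFun h (0 + 0 - l)
    simpa [flip] using this
  induction k generalizing v with
  | zero => exact ⟨v, hv, hv0, by rwa [powVec_zero] at h⟩
  | succ k ih =>
    refine ih (by omega) (sum_flip hv 0 0) (hflip v hv0) ?_
    have h1 := hD _ h
    rcases lt_or_ge k m with hkm | hkm
    · rw [dunkl_self_powVec_le c hc hξ 0 hv hkm] at h1
      exact mem_of_K_smul_mem hc₀ h1
    · obtain ⟨a, rfl⟩ := Nat.exists_eq_add_of_le hkm
      rw [dunkl_self_powVec_ge c hc hξ 0 hv (show a < m by omega), ← smul_sub] at h1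
      have h2 := mem_of_K_smul_mem hc₀ h1
      -- Each of the two correction terms is congruent to the main term `x_0^(m+a) ⊗ flip 0 0 v`, so
      -- one copy minus two copies leaves its negative.
      have h3 : ∀ j, (X 0 : MvPolynomial (Fin 3) K) ^ a • powVec j m (flip 0 j v) -
          powVec 0 (m + a) (flip 0 0 v) ∈ S := by
        intro j
        have := hR ((relSub K m).smul_mem (X 0 ^ a)
          (IsRelation.pow (m := m) j 0 _ (sum_flip hv 0 j)).mem)
        rwa [shift_flip, smul_sub, powVec, powVec, smul_smul _ (X 0 ^ m), ← pow_add,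
          add_comm a m] at this
      have h4 : (Finset.univ.erase (0 : Fin 3)) = {1, 2} := by decide
      rw [h4, Finset.sum_pair (by decide)] at h2
      have h5 := neg_mem (add_mem (add_mem h2 (h3 1)) (h3 2))
      convert h5 using 1
      abel

/-- This is the irreducibility of `γ₀`. As `3 ≠ 0`, a nonzero vector of coordinate sum zero has two
different coordinates; subtracting its image under their transposition gives a multiple of `a_i -
a_j`, whose permutations span. -/
theorem constVec_mem_of_constVec_mem (h3 : (3 : K) ≠ 0)
    (hA : ∀ (g : groupMM3 K m), ∀ w ∈ S, actOp (underlyingPermHom K m m 3) g w ∈ S)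
    {v : Fin 3 → K} (hv : ∑ i, v i = 0) (hv0 : v ≠ 0) (h : constVec 3 v ∈ S) {w : Fin 3 → K}
    (hw : ∑ i, w i = 0) : constVec 3 w ∈ S := by
  have hperm : ∀ (σ : Equiv.Perm (Fin 3)) (v : Fin 3 → K), constVec 3 v ∈ S →
      constVec 3 (fun l => v (σ⁻¹ l)) ∈ S := by
    intro σ v hv
    have := hA (monoElt σ (fun _ => 1) (by simp) (NeZero.ne m) (by simp)) _ hv
    rwa [actOp_constVec, underlyingPermHom_monoElt] at this
  have hadd : ∀ v v' : Fin 3 → K, constVec 3 v ∈ S → constVec 3 v' ∈ S →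
      constVec 3 (v + v') ∈ S := fun v v' hv hv' => by rw [constVec_add]; exact add_mem hv hv'
  have hsmul : ∀ (a : K) (v : Fin 3 → K), constVec 3 v ∈ S →
      constVec 3 (a • v) ∈ S := fun a v hv => by rw [constVec_smul]; exact K_smul_mem a hv
  let e : Fin 3 → Fin 3 → Fin 3 → K := fun i j => Pi.single i 1 - Pi.single j 1
  obtain ⟨i, j, hij, hvij⟩ : ∃ i j, i ≠ j ∧ v i ≠ v j := by
    by_contra! H
    have h' : ∀ i, v i = v 0 := fun i => by
      by_cases hi : i = 0
      · rw [hi]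
      · exact H i 0 hi
    have : v 0 = 0 := by
      simp only [h', Finset.sum_const, Finset.card_univ, Fintype.card_fin, nsmul_eq_mul] at hv
      exact (mul_eq_zero.1 hv).resolve_left (by exact_mod_cast h3)
    exact hv0 (funext fun i => by rw [h' i, this]; rfl)
  have he : constVec 3 (e i j) ∈ S := by
    have h1 := hadd _ _ h (hsmul (-1) _ (hperm (Equiv.swap i j) v h))
    have h2 := hsmul (v i - v j)⁻¹ _ h1
    convert h2 using 2
    funext l
    have h0 := sub_ne_zero.2 hvij
    by_cases hli : l = i
    · subst hli
      simp only [e, Pi.sub_apply, Pi.single_eq_same, Pi.single_eq_of_ne hij, Pi.smul_apply,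
        Pi.add_apply, Equiv.swap_inv, Equiv.swap_apply_left, smul_eq_mul]
      field_simp
      ring
    by_cases hlj : l = j
    · subst hlj
      simp only [e, Pi.sub_apply, Pi.single_eq_same, Pi.single_eq_of_ne hli, Pi.smul_apply,
        Pi.add_apply, Equiv.swap_inv, Equiv.swap_apply_right, smul_eq_mul]
      field_simp
      ring
    · simp [e, hli, hlj, Equiv.swap_apply_of_ne_of_ne hli hlj]
  have he' : ∀ a b, a ≠ b → constVec 3 (e a b) ∈ S := by
    intro a b hab
    obtain ⟨σ, hσi, hσj⟩ : ∃ σ : Equiv.Perm (Fin 3), σ i = a ∧ σ j = b := by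
      clear * - hij hab; revert i j a b; decide
    convert hperm σ _ he using 2
    funext l
    simp only [e, Pi.sub_apply, Pi.single_apply, Equiv.Perm.inv_eq_iff_eq, hσi, hσj]
  have := hadd _ _ (hsmul (w 0) _ (he' 0 2 (by decide))) (hsmul (w 1) _ (he' 1 2 (by decide)))
  convert this using 2
  have hw2 : w 2 = -w 0 - w 1 := by rw [Fin.sum_univ_three] at hw; linear_combination hw
  funext l
  match l with
  | 0 => simp [e]
  | 1 => simp [e]
  | 2 => simp [e, hw2]; ring

/-- A stable submodule that strictly contains the relations contains all vectors of degree zero. -/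
theorem constVec_mem_of_notMem (h3 : (3 : K) ≠ 0) (c : ReflectionClass (groupMM3 K m) → K) {c₀ : K}
    (hc : ∀ s : Reflection (groupMM3 K m), c s.conjClass = c₀)
    {ξ : K} (hξ : IsPrimitiveRoot ξ m) (hc₀ : c₀ * m ≠ 0) (hR : relSub K m ≤ S)
    (hA : ∀ (g : groupMM3 K m), ∀ w ∈ S, actOp (underlyingPermHom K m m 3) g w ∈ S)
    (hD : ∀ w ∈ S, dunkl (underlyingPermHom K m m 3) c 0 w ∈ S)
    {u : Fin 2 → MvPolynomial (Fin 3) K} (hu : colVec K u ∈ S) (hu' : colVec K u ∉ relSub K m)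
    {w : Fin 3 → K} (hw : ∑ i, w i = 0) : constVec 3 w ∈ S := by
  obtain ⟨f, v, hv, hv0, h⟩ := exists_smul_sub_mem hu'
  have h1 : powVec 0 (m * 2) v ∈ S := by
    have := sub_mem (S.smul_mem f hu) (hR h)
    rwa [sub_sub_cancel] at this
  obtain ⟨v', hv', hv0', h2⟩ := exists_constVec_mem c hc hξ hc₀ hR hD le_rfl hv hv0 h1
  exact constVec_mem_of_constVec_mem h3 hA hv' hv0' h2 hw

end Stable

/-! ### The Verma module of `γ₀` -/

section VermaGamma

variable {K : Type*} [Field K] {m : ℕ} (c : ReflectionClass (groupMM3 K m) → K)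

theorem polyTensor_eq_smul (f : MvPolynomial (Fin 3) K) (v : sumZero K 3) :
    polyTensor (groupMM3 K m) 0 c (gamma0 K m) f v =
      f • vermaMk (groupMM3 K m) 0 c (gamma0 K m) 1 v := by
  rw [polyTensor, vermaMk_eq_smul, poly_smul_eq]

/-- The map `colElement` as a homomorphism of modules over the polynomial ring. -/
def colHom : (Fin 2 → MvPolynomial (Fin 3) K) →ₗ[MvPolynomial (Fin 3) K]
    Verma (groupMM3 K m) 0 c (gamma0 K m) :=
  Fintype.linearCombination (MvPolynomial (Fin 3) K)
    fun i => vermaMk (groupMM3 K m) 0 c (gamma0 K m) 1 (gamma0Basis K i)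

theorem colHom_apply (u : Fin 2 → MvPolynomial (Fin 3) K) : colHom c u = colElement K m c u := by
  rw [colHom, Fintype.linearCombination_apply, colElement]
  exact Finset.sum_congr rfl fun i _ => (polyTensor_eq_smul c _ _).symm

theorem vermaMk_one_eq_colElement (v : sumZero K 3) :
    vermaMk (groupMM3 K m) 0 c (gamma0 K m) 1 v = colElement K m c ![C (v.1 0), -C (v.1 1)] := by
  have hv : v = v.1 0 • gamma0Basis K 0 + (-v.1 1) • gamma0Basis K 1 := by
    have h2 : ∑ i, v.1 i = 0 := v.2
    rw [Fin.sum_univ_three] at h2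
    ext l
    match l with
    | 0 => simp [gamma0Basis]
    | 1 => simp [gamma0Basis]
    | 2 => simp [gamma0Basis]; linear_combination h2
  have hC : ∀ (a : K) (u : Verma (groupMM3 K m) 0 c (gamma0 K m)),
      (C a : MvPolynomial (Fin 3) K) • u = a • u := by
    intro a u
    rw [poly_smul_eq, ← algebraMap_eq, AlgHom.commutes, algebraMap_smul]
  rw [← colHom_apply, colHom, Fintype.linearCombination_apply, Fin.sum_univ_two]
  simp only [Matrix.cons_val_zero, Matrix.cons_val_one, ← C_neg, hC]
  conv_lhs => rw [hv]
  simp only [vermaMk, TensorProduct.tmul_add, TensorProduct.tmul_smul]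
  rfl

theorem gamma0_apply (g : groupMM3 K m) (v : sumZero K 3) (l : Fin 3) :
    (sumZero K 3).subtype (gamma0 K m g v) l =
      (sumZero K 3).subtype v ((underlyingPermHom K m m 3 g)⁻¹ l) := rfl

variable [NeZero m]

theorem colHom_surjective : Function.Surjective (colHom (m := m) c) := by
  rw [← LinearMap.range_eq_top, eq_top_iff, ← span_vermaMk_one, Submodule.span_le]
  rintro _ ⟨v, rfl⟩
  exact ⟨_, (colHom_apply c _).trans (vermaMk_one_eq_colElement c v).symm⟩

/-- The Verma module of `γ₀` as a space of polynomial vectors. -/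
def gammaVec : Verma (groupMM3 K m) 0 c (gamma0 K m) →ₛₗ[(dunklHom (underlyingPermHom K m m 3)
    c).toRingHom] (Fin 3 → MvPolynomial (Fin 3) K) :=
  vermaVec (underlyingPermHom K m m 3) c (gamma0 K m) (sumZero K 3).subtype gamma0_apply

theorem gammaVec_smul (f : MvPolynomial (Fin 3) K) (u : Verma (groupMM3 K m) 0 c (gamma0 K m)) :
    gammaVec c (f • u) = f • gammaVec c u := vermaVec_poly_smul _ _ _ _ _ f u

theorem gammaVec_K_smul (a : K) (u : Verma (groupMM3 K m) 0 c (gamma0 K m)) :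
    gammaVec c (a • u) = a • gammaVec c u := vermaVec_K_smul _ _ _ _ _ a u

theorem gammaVec_gen_smul (h : Gen (groupMM3 K m)) (u : Verma (groupMM3 K m) 0 c (gamma0 K m)) :
    gammaVec c (gen (groupMM3 K m) 0 c h • u) =
      genOp (underlyingPermHom K m m 3) c h (gammaVec c u) := by
  rw [gammaVec, vermaVec_smul, dunklHom_gen]

theorem gammaVec_vermaMk_one (v : sumZero K 3) :
    gammaVec c (vermaMk (groupMM3 K m) 0 c (gamma0 K m) 1 v) = constVec 3 v.1 := by
  rw [gammaVec, vermaVec_vermaMk, map_one]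
  rfl

theorem gammaVec_colHom (u : Fin 2 → MvPolynomial (Fin 3) K) :
    gammaVec c (colHom c u) = colVec K u := by
  rw [colHom, Fintype.linearCombination_apply, map_sum, colVec_eq_sum]
  exact Finset.sum_congr rfl fun i _ => by rw [gammaVec_smul, gammaVec_vermaMk_one]

/-- `colHom` is surjective and its composite with `gammaVec` is the injective map `colVec`. Thus the
Verma module is free of rank two over the polynomial ring, and no separate PBW theorem is needed. -/
theorem gammaVec_injective : Function.Injective (gammaVec (m := m) c) := by
  intro u w h
  obtain ⟨u, rfl⟩ := colHom_surjective c u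
  obtain ⟨w, rfl⟩ := colHom_surjective c w
  rw [gammaVec_colHom, gammaVec_colHom] at h
  rw [colVec_injective h]

omit [NeZero m] in
theorem colHom_mem_vermaPart {d : ℤ} {u : Fin 2 → MvPolynomial (Fin 3) K}
    (h : colVec K u ∈ vecPart K 3 (Fin 3) d) :
    colHom c u ∈ vermaPart (groupMM3 K m) 0 c (gamma0 K m) d := by
  have hu : ∀ i (μ : Fin 3 →₀ ℕ), (μ.degree : ℤ) ≠ d → coeff μ (u i) = 0 := by
    intro i μ hμ
    match i with
    | 0 => exact h 0 μ hμ
    | 1 =>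
      have : coeff μ (-u 1) = 0 := h 1 μ hμ
      rwa [coeff_neg, neg_eq_zero] at this
  rw [colHom_apply, colElement]
  refine Submodule.sum_mem _ fun i _ => Submodule.subset_span
    ⟨polyHom (groupMM3 K m) 0 c (u i), ?_, gamma0Basis K i, rfl⟩
  rw [(u i).as_sum, map_sum]
  refine Submodule.sum_mem _ fun μ hμ => ?_
  have hd : ((Finsupp.degree μ : ℕ) : ℤ) = d := by
    by_contra h'
    exact (mem_support_iff.1 hμ) (hu i μ h')
  rw [← mul_one (coeff μ (u i)), ← smul_eq_mul, ← smul_monomial, map_smul, ← hd]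
  exact Submodule.smul_mem _ _ (polyHom_monomial_mem μ)

theorem mem_vermaPart_iff {d : ℤ} {u : Verma (groupMM3 K m) 0 c (gamma0 K m)} :
    u ∈ vermaPart (groupMM3 K m) 0 c (gamma0 K m) d ↔
      gammaVec c u ∈ vecPart K 3 (Fin 3) d := by
  refine ⟨vermaVec_mem_vecPart _ _ _ _ _, fun h => ?_⟩
  obtain ⟨u, rfl⟩ := colHom_surjective c u
  rw [gammaVec_colHom] at h
  exact colHom_mem_vermaPart c h

theorem eq_top_of_vermaMk_mem
    {U : Submodule (CherednikAlgebra (groupMM3 K m) 0 c) (Verma (groupMM3 K m) 0 c (gamma0 K m))}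
    (h : ∀ v, vermaMk (groupMM3 K m) 0 c (gamma0 K m) 1 v ∈ U) : U = ⊤ := by
  rw [eq_top_iff]
  rintro u -
  have hu : u ∈ Submodule.span (MvPolynomial (Fin 3) K)
      (Set.range (vermaMk (groupMM3 K m) 0 c (gamma0 K m) 1)) := by
    rw [span_vermaMk_one]; trivial
  induction hu using Submodule.span_induction with
  | mem x hx => obtain ⟨v, rfl⟩ := hx; exact h v
  | zero => exact zero_mem _
  | add x y _ _ hx hy => exact add_mem hx hy
  | smul f x _ hx => rw [poly_smul_eq]; exact U.smul_mem _ hx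

/-! ### The relations form the maximal graded submodule -/

section Radical

variable {c₀ : K} (hc : ∀ s : Reflection (groupMM3 K m), c s.conjClass = c₀)
  {ξ : K} (hξ : IsPrimitiveRoot ξ m)

/-- The submodule of the Verma module that is given by the relations. -/
def radical : Submodule (CherednikAlgebra (groupMM3 K m) 0 c)
    (Verma (groupMM3 K m) 0 c (gamma0 K m)) where
  carrier := {u | gammaVec c u ∈ relSub K m}
  zero_mem' := by rw [Set.mem_ofPred_eq, map_zero]; exact zero_mem _
  add_mem' := by
    intro u w hu hw
    rw [Set.mem_ofPred_eq, map_add]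
    exact add_mem hu hw
  smul_mem' := by
    intro h u hu
    let R : Submodule K (Verma (groupMM3 K m) 0 c (gamma0 K m)) :=
      { carrier := {u | gammaVec c u ∈ relSub K m}
        zero_mem' := by rw [Set.mem_ofPred_eq, map_zero]; exact zero_mem _
        add_mem' := by
          intro u w hu hw
          rw [Set.mem_ofPred_eq, map_add]
          exact add_mem hu hw
        smul_mem' := by
          intro a u hu
          rw [Set.mem_ofPred_eq, gammaVec_K_smul]
          exact K_smul_mem a hu }
    refine smul_mem_of_gen_smul_mem R (fun x w hw => ?_) h (w := u) hu
    change gammaVec c (gen (groupMM3 K m) 0 c x • w) ∈ relSub K m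
    rw [gammaVec_gen_smul]
    cases x with
    | x i => exact Submodule.smul_mem _ _ hw
    | y j => exact dunkl_mem_relSub c hc hξ j hw
    | g a => exact actOp_mem_relSub a hw

theorem mem_radical {u : Verma (groupMM3 K m) 0 c (gamma0 K m)} :
    u ∈ radical c hc hξ ↔ gammaVec c u ∈ relSub K m := Iff.rfl

theorem colHom_mem_radical {u : Fin 2 → MvPolynomial (Fin 3) K} :
    colHom c u ∈ radical c hc hξ ↔ colVec K u ∈ relSub K m := by
  rw [mem_radical, gammaVec_colHom]

theorem constVec_notMem_relSub {v : Fin 3 → K} (hv : ∑ i, v i = 0) (hv0 : v ≠ 0) :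
    constVec 3 v ∉ relSub K m := by
  intro h
  have hn : normalVec K m (Pi.single (.inl 0) ⟨v, hv⟩) = constVec 3 v := by
    rw [normalVec_single, monomial_normalExp_inl, Fin.val_zero, mul_zero, pow_zero, one_smul]
  have h1 := normalVec_eq_zero (NeZero.ne m) (v := Pi.single (.inl 0) ⟨v, hv⟩)
    (by rw [hn]; exact normalCoord_relSub (NeZero.ne m) h)
  rw [Pi.single_eq_zero_iff] at h1
  exact hv0 (congrArg Subtype.val h1)

theorem gamma0Basis_ne_zero (i : Fin 2) : (gamma0Basis K i).1 ≠ 0 := by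
  intro h
  match i with
  | 0 => simpa [gamma0Basis] using congrFun h 0
  | 1 => simpa [gamma0Basis] using congrFun h 1

theorem radical_ne_top : radical c hc hξ ≠ ⊤ := by
  intro h
  have h1 : vermaMk (groupMM3 K m) 0 c (gamma0 K m) 1 (gamma0Basis K 0) ∈ radical c hc hξ := by
    rw [h]; trivial
  rw [mem_radical, gammaVec_vermaMk_one] at h1
  exact constVec_notMem_relSub (sum_gamma0Basis 0) (gamma0Basis_ne_zero 0) h1

/-- Maximality holds among all submodules, graded or not, which gives simplicity of the quotient as
well as the description of `J`. -/
theorem isCoatom_radical (h3 : (3 : K) ≠ 0) (hc₀ : c₀ * m ≠ 0) : IsCoatom (radical c hc hξ) := by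
  refine ⟨radical_ne_top c hc hξ, fun U hU => ?_⟩
  obtain ⟨hle, u, huU, hu⟩ := SetLike.lt_iff_le_and_exists.1 hU
  obtain ⟨u, rfl⟩ := colHom_surjective c u
  rw [colHom_mem_radical] at hu
  let S : Submodule (MvPolynomial (Fin 3) K) (Fin 3 → MvPolynomial (Fin 3) K) :=
    { carrier := {w | ∃ x ∈ U, gammaVec c x = w}
      zero_mem' := ⟨0, zero_mem _, map_zero _⟩
      add_mem' := by
        rintro _ _ ⟨x, hx, rfl⟩ ⟨y, hy, rfl⟩
        exact ⟨x + y, add_mem hx hy, map_add _ _ _⟩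
      smul_mem' := by
        rintro f _ ⟨x, hx, rfl⟩
        exact ⟨f • x, U.smul_mem (polyHom (groupMM3 K m) 0 c f) hx, gammaVec_smul c f x⟩ }
  have hS : ∀ w, w ∈ S ↔ ∃ x ∈ U, gammaVec c x = w := fun _ => Iff.rfl
  have hgen : ∀ h, ∀ w ∈ S, genOp (underlyingPermHom K m m 3) c h w ∈ S := by
    rintro h _ ⟨x, hx, rfl⟩
    exact ⟨_, U.smul_mem _ hx, gammaVec_gen_smul c h x⟩
  have hR : relSub K m ≤ S := by
    intro w hw
    obtain ⟨a, -, rfl⟩ := relSub_le_map_range hw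
    exact ⟨colHom c a, hle ((colHom_mem_radical c hc hξ).2 hw), gammaVec_colHom c a⟩
  refine eq_top_of_vermaMk_mem c fun v => ?_
  obtain ⟨x, hx, h⟩ := (hS _).1 (constVec_mem_of_notMem (S := S) h3 c hc hξ hc₀ hR
    (fun g w hw => hgen (.g g) w hw) (fun w hw => hgen (.y 0) w hw)
    ⟨_, huU, gammaVec_colHom c u⟩ hu (w := v.1) v.2)
  rw [← gammaVec_vermaMk_one c v] at h
  rwa [← gammaVec_injective c h]

/-- The homogeneous components of a column. -/
def columnPart (d : ℕ) (u : Fin 2 → MvPolynomial (Fin 3) K) : Fin 2 → MvPolynomial (Fin 3) K :=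
  fun i => homogeneousComponent d (u i)

omit [NeZero m] in
theorem colVec_columnPart_mem (d : ℕ) (u : Fin 2 → MvPolynomial (Fin 3) K) :
    colVec K (columnPart d u) ∈ vecPart K 3 (Fin 3) d := by
  have h : ∀ i μ, ((Finsupp.degree μ : ℕ) : ℤ) ≠ d → coeff μ (columnPart d u i) = 0 := by
    intro i μ hμ
    rw [columnPart, coeff_homogeneousComponent, if_neg (by exact_mod_cast hμ)]
  intro l μ hμ
  match l with
  | 0 => exact h 0 μ hμ
  | 1 => change coeff μ (-columnPart d u 1) = 0; rw [coeff_neg, h 1 μ hμ, neg_zero]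
  | 2 =>
    change coeff μ (columnPart d u 1 - columnPart d u 0) = 0
    rw [coeff_sub, h 1 μ hμ, h 0 μ hμ, sub_zero]

omit [NeZero m] in
theorem exists_sum_columnPart (u : Fin 2 → MvPolynomial (Fin 3) K) :
    ∃ N, ∑ d ∈ Finset.range N, columnPart d u = u := by
  refine ⟨max (u 0).totalDegree (u 1).totalDegree + 1, funext fun i => ?_⟩
  rw [Finset.sum_apply]
  conv_rhs => rw [← sum_homogeneousComponent (u i)]
  symm
  refine Finset.sum_subset (fun d hd => ?_) fun d _ hd => ?_
  · rw [Finset.mem_range] at hd ⊢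
    match i with
    | 0 => omega
    | 1 => omega
  · refine homogeneousComponent_eq_zero _ _ ?_
    rw [Finset.mem_range] at hd
    omega

/-- Membership means that all normal coordinates vanish, and the coordinate at `ω` sees only the
component of degree `(normalExp ω).degree`. -/
theorem columnPart_mem_relSub {u : Fin 2 → MvPolynomial (Fin 3) K} (hu : colVec K u ∈ relSub K m)
    (d : ℕ) : colVec K (columnPart d u) ∈ relSub K m := by
  rw [colVec_mem_relSub_iff] at hu ⊢
  obtain ⟨N, hN⟩ := exists_sum_columnPart u
  have hz : ∀ (e : ℕ) (ω : NormalIdx m), e ≠ (normalExp ω).degree →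
      normalCoord K m (colVec K (columnPart e u)) ω = 0 := fun e ω he =>
    normalCoord_of_mem_vecPart (by exact_mod_cast he) (colVec_columnPart_mem e u)
  funext ω
  by_cases hd : d = (normalExp ω).degree
  · rw [← hN, map_sum, map_sum] at hu
    have h1 := congrFun hu ω
    rw [Finset.sum_apply] at h1
    by_cases hdN : d < N
    · rwa [Finset.sum_eq_single d] at h1
      · intro e _ he
        exact hz e ω (hd ▸ he)
      · intro h
        exact absurd (Finset.mem_range.2 hdN) h
    · have h0 : columnPart d u = 0 := by
        rw [← hN]
        funext i
        rw [columnPart, Finset.sum_apply, map_sum]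
        refine Finset.sum_eq_zero fun e he => ?_
        rw [columnPart, homogeneousComponent_of_mem (homogeneousComponent_mem e (u i)), if_neg]
        rintro rfl
        exact hdN (Finset.mem_range.1 he)
      rw [h0, map_zero, map_zero]
  · exact hz d ω hd

theorem isGradedSubmodule_radical :
    IsGradedSubmodule (groupMM3 K m) 0 c (gamma0 K m) (radical c hc hξ) := by
  intro u hu
  obtain ⟨u, rfl⟩ := colHom_surjective c u
  rw [Submodule.restrictScalars_mem, colHom_mem_radical] at hu
  obtain ⟨N, hN⟩ := exists_sum_columnPart u
  rw [← hN, map_sum]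
  refine Submodule.sum_mem _ fun d _ => Submodule.mem_iSup_of_mem (d : ℤ) ⟨?_, ?_⟩
  · exact (colHom_mem_radical c hc hξ).2 (columnPart_mem_relSub hu d)
  · exact colHom_mem_vermaPart c (colVec_columnPart_mem d u)

theorem constantCoeff_of_mem_relSub {w : Fin 3 → MvPolynomial (Fin 3) K} (hw : w ∈ relSub K m)
    (l : Fin 3) : constantCoeff (w l) = 0 := by
  have hm := NeZero.ne m
  induction hw using Submodule.span_induction with
  | mem x hx =>
    cases hx with
    | prod v hv => simp [prodX, constVec]
    | psum v hv => simp [psumX, constVec, hm]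
    | pow i j v hv => simp [powVec, constVec, hm]
  | zero => simp
  | add x y _ _ hx hy => rw [Pi.add_apply, map_add, hx, hy, add_zero]
  | smul f x _ hx => rw [Pi.smul_apply, smul_eq_mul, map_mul, hx, mul_zero]

/-- A graded submodule contains the degree zero component of each of its elements, and that
component is the vector of constant terms. -/
theorem exists_gammaVec_eq_constVec
    {U : Submodule (CherednikAlgebra (groupMM3 K m) 0 c) (Verma (groupMM3 K m) 0 c (gamma0 K m))}
    (hU : IsGradedSubmodule (groupMM3 K m) 0 c (gamma0 K m) U)
    {u : Verma (groupMM3 K m) 0 c (gamma0 K m)} (hu : u ∈ U) :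
    ∃ x ∈ U, gammaVec c x = constVec 3 fun l => constantCoeff (gammaVec c u l) := by
  have h := hU hu
  refine Submodule.iSup_induction _ (motive := fun u => ∃ x ∈ U, gammaVec c x =
    constVec 3 fun l => constantCoeff (gammaVec c u l)) h ?_ ?_ ?_
  · rintro d x ⟨hx, hd⟩
    have hd' := (mem_vermaPart_iff c).1 hd
    by_cases h0 : d = 0
    · subst h0
      refine ⟨x, hx, ?_⟩
      ext l μ
      rw [constVec, coeff_C]
      split_ifs with h
      · rw [← h]; rfl
      · refine hd' l μ ?_
        rw [Ne, Nat.cast_eq_zero, Finsupp.degree_eq_zero_iff]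
        exact fun e => h e.symm
    · refine ⟨0, zero_mem _, ?_⟩
      ext1 l
      rw [map_zero, constVec, constantCoeff_eq, hd' l 0 (by simpa using Ne.symm h0), C_0]
      rfl
  · refine ⟨0, zero_mem _, ?_⟩
    ext1 l
    rw [map_zero]
    simp [constVec]
  · rintro x y ⟨x', hx', hx⟩ ⟨y', hy', hy⟩
    refine ⟨x' + y', add_mem hx' hy', ?_⟩
    rw [map_add, hx, hy, ← constVec_add, map_add]
    congr 1

/-- The maximal proper graded submodule is given by the relations. -/
theorem maxSubmodule_eq_radical (h3 : (3 : K) ≠ 0) (hc₀ : c₀ * m ≠ 0) :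
    maxSubmodule (groupMM3 K m) 0 c (gamma0 K m) = radical c hc hξ := by
  refine le_antisymm (sSup_le ?_)
    (le_sSup ⟨isGradedSubmodule_radical c hc hξ, radical_ne_top c hc hξ⟩)
  rintro U ⟨hU, hne⟩
  by_contra hle
  -- If `U` is not contained in the relations, the two together span, so `1 ⊗ v = r + u`. Relations
  -- have no constant terms, hence the degree zero part of `u`, which lies in the graded `U`, is `1
  -- ⊗ v` itself.
  have htop := (isCoatom_radical c hc hξ h3 hc₀).2 _ (left_lt_sup.2 hle)
  refine hne (eq_top_of_vermaMk_mem c fun v => ?_)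
  have hv : vermaMk (groupMM3 K m) 0 c (gamma0 K m) 1 v ∈ radical c hc hξ ⊔ U := by
    rw [htop]; trivial
  obtain ⟨r, hr, u, hu, h⟩ := Submodule.mem_sup.1 hv
  obtain ⟨x, hx, hxu⟩ := exists_gammaVec_eq_constVec c hU hu
  have h1 : gammaVec c x = gammaVec c (vermaMk (groupMM3 K m) 0 c (gamma0 K m) 1 v) := by
    rw [hxu, gammaVec_vermaMk_one]
    congr 1
    funext l
    have h2 := congrArg (fun y => constantCoeff (gammaVec c y l)) h
    simp only [map_add, Pi.add_apply, constantCoeff_of_mem_relSub hr l, zero_add,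
      gammaVec_vermaMk_one, constVec, constantCoeff_C] at h2
    exact h2
  rwa [← gammaVec_injective c h1]

end Radical

end VermaGamma

/-! ### Gradings of function spaces -/

section Supported

variable {K V κ : Type*} [Field K] [AddCommGroup V] [Module K V] (deg : κ → ℤ)

/-- The functions that are supported on the indices of degree `d`. -/
def supportedPart (K V : Type*) [Field K] [AddCommGroup V] [Module K V] (deg : κ → ℤ) (d : ℤ) :
    Submodule K (κ → V) where
  carrier := {v | ∀ ω, deg ω ≠ d → v ω = 0}
  zero_mem' _ _ := rfl
  add_mem' := by
    intro u v hu hv ω h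
    rw [Pi.add_apply, hu ω h, hv ω h, add_zero]
  smul_mem' := by
    intro a v hv ω h
    rw [Pi.smul_apply, hv ω h, smul_zero]

theorem iSupIndep_supportedPart : iSupIndep (supportedPart K V deg) := by
  intro d
  let N : Submodule K (κ → V) :=
    { carrier := {v | ∀ ω, deg ω = d → v ω = 0}
      zero_mem' := fun _ _ => rfl
      add_mem' := by
        intro u v hu hv ω h
        rw [Pi.add_apply, hu ω h, hv ω h, add_zero]
      smul_mem' := by
        intro a v hv ω h
        rw [Pi.smul_apply, hv ω h, smul_zero] }
  have hN : ⨆ e, ⨆ (_ : e ≠ d), supportedPart K V deg e ≤ N :=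
    iSup₂_le fun e he v hv ω hω => hv ω (by rw [hω]; exact he.symm)
  rw [Submodule.disjoint_def]
  intro v hv hv'
  funext ω
  by_cases h : deg ω = d
  · exact hN hv' ω h
  · exact hv ω h

theorem iSup_supportedPart [Fintype κ] : ⨆ d, supportedPart K V deg d = ⊤ := by
  classical
  rw [eq_top_iff]
  rintro v -
  rw [← Finset.univ_sum_single v]
  refine Submodule.sum_mem _ fun ω _ => Submodule.mem_iSup_of_mem (deg ω) fun ω' h => ?_
  rw [Pi.single_eq_of_ne]
  rintro rfl
  exact h rfl

/-- Functions supported on the indices of degree `d` are functions on the set of these indices. -/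
def supportedPartEquiv (d : ℤ) : supportedPart K V deg d ≃ₗ[K] ({ω // deg ω = d} → V) where
  toFun v ω := v.1 ω.1
  map_add' _ _ := rfl
  map_smul' _ _ := rfl
  invFun f := ⟨fun ω => if h : deg ω = d then f ⟨ω, h⟩ else 0, fun ω h => dif_neg h⟩
  left_inv := by
    intro v
    ext ω
    change (if h : deg ω = d then v.1 ω else 0) = v.1 ω
    split_ifs with h
    · rfl
    · exact (v.2 ω h).symm
  right_inv := by
    intro f
    funext ω
    exact dif_pos ω.2

theorem finrank_supportedPart [Fintype κ] [Module.Finite K V] (d : ℤ) :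
    Module.finrank K (supportedPart K V deg d) =
      (Finset.univ.filter fun ω => deg ω = d).card * Module.finrank K V := by
  rw [(supportedPartEquiv deg d).finrank_eq, Module.finrank_pi_fintype, Finset.sum_const,
    smul_eq_mul, Finset.card_univ, Fintype.card_subtype]

variable {L : Type*} [AddCommGroup L] [Module K L]

/-- The Hilbert series of a space with a basis of homogeneous copies of `V`. -/
theorem hasHilbertSeries_of_equiv [Fintype κ] [Module.Finite K V] (deg : κ → ℕ)
    (e : (κ → V) ≃ₗ[K] L) {P : ℤ → Submodule K L}
    (hP : ∀ d, P d = (supportedPart K V (fun ω => (deg ω : ℤ)) d).map e.toLinearMap) :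
    HasHilbertSeries P
      ((Module.finrank K V : PowerSeries ℕ) * ∑ ω, (PowerSeries.X : PowerSeries ℕ) ^ deg ω) := by
  obtain rfl : P = fun d => (supportedPart K V (fun ω => (deg ω : ℤ)) d).map e.toLinearMap :=
    funext hP
  refine ⟨?_, fun d => ?_, fun d hd => ?_, fun d => ?_⟩
  · apply DirectSum.isInternal_submodule_of_iSupIndep_of_iSup_eq_top
    · exact (iSupIndep_supportedPart _).map_orderIso (Submodule.orderIsoMapComap e)
    · rw [← Submodule.map_iSup, iSup_supportedPart, Submodule.map_top, LinearEquiv.range]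
  · infer_instance
  · rw [eq_bot_iff]
    rintro _ ⟨v, hv, rfl⟩
    rw [Submodule.mem_bot]
    refine e.map_eq_zero_iff.2 ?_
    funext ω
    refine hv ω ?_
    change (deg ω : ℤ) ≠ d
    omega
  · rw [e.finrank_map_eq, finrank_supportedPart, ← nsmul_eq_mul, map_nsmul, map_sum,
      smul_eq_mul, mul_comm]
    congr 1
    simp only [PowerSeries.coeff_X_pow, Nat.cast_inj, Finset.sum_boole, Nat.cast_id]
    congr 1
    ext ω
    simp [eq_comm]

end Supported

/-! ### The Hilbert series of `L(γ₀)` -/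

section Hilbert

/-- With `S = 1 + X + ⋯ + X^(m-1)`, `T = S - 1` and `X S = T + X^m`, the count `1 + X^m + X^(2m) + 3
T (T + 1 + X^m)` regroups as `S² + (X S) S + (X S)²`. -/
theorem sum_X_pow_degree (m : ℕ) [NeZero m] :
    ∑ ω : NormalIdx m, (PowerSeries.X : PowerSeries ℕ) ^ (normalExp ω).degree =
      (1 + PowerSeries.X + PowerSeries.X ^ 2) * (∑ i ∈ Finset.range m, PowerSeries.X ^ i) ^ 2 := by
  obtain ⟨r, hr⟩ : ∃ r, m = r + 1 := ⟨m - 1, by have := NeZero.pos m; omega⟩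
  set T : PowerSeries ℕ := ∑ k ∈ Finset.range r, PowerSeries.X ^ (k + 1) with hT
  have hS : ∑ i ∈ Finset.range m, (PowerSeries.X : PowerSeries ℕ) ^ i = T + 1 := by
    rw [hr, Finset.sum_range_succ', pow_zero]
  have hXS : PowerSeries.X * ∑ i ∈ Finset.range m, (PowerSeries.X : PowerSeries ℕ) ^ i =
      T + PowerSeries.X ^ m := by
    rw [Finset.mul_sum, hr, hT, ← Finset.sum_range_succ]
    exact Finset.sum_congr rfl fun i _ => (pow_succ' _ _).symm
  have h1 : ∑ s : Fin 3, (PowerSeries.X : PowerSeries ℕ) ^ (normalExp (m := m) (.inl s)).degree =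
      1 + PowerSeries.X ^ m + (PowerSeries.X ^ m) ^ 2 := by
    simp only [normalExp, Finsupp.degree_single, Fin.sum_univ_three, Fin.val_zero, Fin.val_one,
      Fin.val_two, pow_zero, pow_one, pow_mul]
  have h2 : ∑ x : Fin 3 × Fin (m - 1) × Fin (m + 1),
      (PowerSeries.X : PowerSeries ℕ) ^ (normalExp (m := m) (.inr x)).degree =
      3 * (T * (T + 1 + PowerSeries.X ^ m)) := by
    have e : ∀ (i : Fin 3) (k : Fin (m - 1)) (l : Fin (m + 1)),
        (PowerSeries.X : PowerSeries ℕ) ^ (normalExp (m := m) (.inr (i, k, l))).degree =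
        PowerSeries.X ^ (k + 1 : ℕ) * PowerSeries.X ^ (l : ℕ) := by
      intro i k l
      rw [normalExp, map_add, Finsupp.degree_single, Finsupp.degree_single, pow_add]
    simp only [Fintype.sum_prod_type, e]
    rw [Finset.sum_const, Finset.card_univ, Fintype.card_fin, nsmul_eq_mul]
    simp only [← Finset.mul_sum]
    rw [← Finset.sum_mul, Fin.sum_univ_eq_sum_range (fun k => (PowerSeries.X : PowerSeries ℕ) ^ k),
      Fin.sum_univ_eq_sum_range (fun k => (PowerSeries.X : PowerSeries ℕ) ^ (k + 1)),
      Finset.sum_range_succ, hS, hT, show m - 1 = r by omega]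
    rfl
  rw [Fintype.sum_sum_type, h1, h2]
  calc _ = (T + 1) ^ 2 + (T + PowerSeries.X ^ m) * (T + 1) + (T + PowerSeries.X ^ m) ^ 2 := by ring
    _ = _ := by rw [← hXS, ← hS]; ring

variable {K : Type*} [Field K]

/-- The vectors of `γ₀` in terms of their first two coordinates. -/
def sumZeroEquiv (K : Type*) [Field K] : sumZero K 3 ≃ₗ[K] (Fin 2 → K) where
  toFun v := ![v.1 0, v.1 1]
  map_add' u v := by ext i; fin_cases i <;> rfl
  map_smul' a v := by ext i; fin_cases i <;> rfl
  invFun f := ⟨![f 0, f 1, -f 0 - f 1], by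
    change ∑ i, ![f 0, f 1, -f 0 - f 1] i = 0
    simp [Fin.sum_univ_three]⟩
  left_inv v := by
    have h : ∑ i, v.1 i = 0 := v.2
    rw [Fin.sum_univ_three] at h
    ext i
    match i with
    | 0 => rfl
    | 1 => rfl
    | 2 => change -v.1 0 - v.1 1 = v.1 2; linear_combination -h
  right_inv f := by ext i; fin_cases i <;> rfl

theorem finrank_sumZero : Module.finrank K (sumZero K 3) = 2 := by
  rw [(sumZeroEquiv K).finrank_eq, Module.finrank_fin_fun]

variable {m : ℕ} [NeZero m] (c : ReflectionClass (groupMM3 K m) → K)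

theorem gammaVec_sum_normal (v : NormalIdx m → sumZero K 3) :
    gammaVec c (∑ ω, monomial (normalExp ω) (1 : K) •
      vermaMk (groupMM3 K m) 0 c (gamma0 K m) 1 (v ω)) = normalVec K m v := by
  rw [map_sum, normalVec_apply]
  exact Finset.sum_congr rfl fun ω _ => by rw [gammaVec_smul, gammaVec_vermaMk_one]

/-- The combinations of normal monomials in `L(γ₀)`. -/
def normalHom : (NormalIdx m → sumZero K 3) →ₗ[K] LModule (groupMM3 K m) 0 c (gamma0 K m) :=
  (maxSubmodule (groupMM3 K m) 0 c (gamma0 K m)).mkQ.restrictScalars K ∘ₗ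
    { toFun := fun v => ∑ ω, monomial (normalExp ω) (1 : K) •
        vermaMk (groupMM3 K m) 0 c (gamma0 K m) 1 (v ω)
      map_add' := fun u v => gammaVec_injective c (by
        rw [map_add, gammaVec_sum_normal, gammaVec_sum_normal, gammaVec_sum_normal, map_add])
      map_smul' := fun a v => gammaVec_injective c (by
        rw [RingHom.id_apply, gammaVec_K_smul, gammaVec_sum_normal, gammaVec_sum_normal,
          map_smul]) }

theorem normalHom_apply (v : NormalIdx m → sumZero K 3) :
    normalHom c v = (maxSubmodule (groupMM3 K m) 0 c (gamma0 K m)).mkQ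
      (∑ ω, monomial (normalExp ω) (1 : K) •
        vermaMk (groupMM3 K m) 0 c (gamma0 K m) 1 (v ω)) := rfl

variable (hJ : ∀ u, u ∈ maxSubmodule (groupMM3 K m) 0 c (gamma0 K m) ↔
  gammaVec c u ∈ relSub K m)
include hJ

theorem mkQ_colHom_eq_normalHom {u : Fin 2 → MvPolynomial (Fin 3) K}
    {v : NormalIdx m → sumZero K 3} (h : colVec K u - normalVec K m v ∈ relSub K m) :
    (maxSubmodule (groupMM3 K m) 0 c (gamma0 K m)).mkQ (colHom c u) = normalHom c v := by
  rw [normalHom_apply, ← sub_eq_zero, ← map_sub, Submodule.mkQ_apply, Submodule.Quotient.mk_eq_zero,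
    hJ, map_sub, gammaVec_sum_normal, gammaVec_colHom]
  exact h

theorem normalHom_bijective : Function.Bijective (normalHom (m := m) c) := by
  constructor
  · rw [injective_iff_map_eq_zero]
    intro v hv
    rw [normalHom_apply, Submodule.mkQ_apply, Submodule.Quotient.mk_eq_zero, hJ,
      gammaVec_sum_normal] at hv
    exact normalVec_eq_zero (NeZero.ne m) (normalCoord_relSub (NeZero.ne m) hv)
  · intro x
    obtain ⟨y, rfl⟩ := Submodule.mkQ_surjective _ x
    obtain ⟨u, rfl⟩ := colHom_surjective c y
    obtain ⟨v, hv⟩ := exists_normalVec_sub_mem (m := m) u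
    exact ⟨v, (mkQ_colHom_eq_normalHom c hJ hv).symm⟩

/-- The coordinates are homogeneous, so the normal form of an element of degree `d` only involves
normal monomials of degree `d`. -/
theorem lPart_eq (d : ℤ) : lPart (groupMM3 K m) 0 c (gamma0 K m) d =
    (supportedPart K (sumZero K 3) (fun ω : NormalIdx m => ((normalExp ω).degree : ℤ)) d).map
      (normalHom c) := by
  apply le_antisymm
  · rintro _ ⟨y, hy, rfl⟩
    obtain ⟨u, rfl⟩ := colHom_surjective c y
    obtain ⟨v, hv⟩ := exists_normalVec_sub_mem (m := m) u
    refine ⟨v, fun ω hω => ?_, (mkQ_colHom_eq_normalHom c hJ hv).symm⟩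
    have h1 := normalCoord_relSub (NeZero.ne m) hv
    have h2 := (mem_vermaPart_iff c).1 hy
    rw [gammaVec_colHom] at h2
    have h3 := normalCoord_of_mem_vecPart (Ne.symm hω) h2
    ext l
    have h4 := normalCoord_normalVec (NeZero.ne m) v ω (l - normalShift ω)
    rw [sub_add_cancel] at h4
    rw [map_sub, sub_eq_zero] at h1
    rw [← h4, ← h1, h3]
    rfl
  · rintro _ ⟨v, hv, rfl⟩
    refine ⟨_, ?_, rfl⟩
    refine Submodule.sum_mem _ fun ω _ => ?_
    by_cases h : ((normalExp ω).degree : ℤ) = d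
    · rw [SetLike.mem_coe.symm, SetLike.mem_coe, mem_vermaPart_iff, gammaVec_smul,
        gammaVec_vermaMk_one, ← h]
      exact monomial_smul_constVec_mem _ _
    · rw [hv ω h]
      rw [mem_vermaPart_iff, gammaVec_smul, gammaVec_vermaMk_one]
      have : constVec 3 ((0 : sumZero K 3).1) = 0 := by ext1 l; simp [constVec]
      rw [this, smul_zero]
      exact zero_mem _

theorem hasHilbertSeries_lPart : HasHilbertSeries (lPart (groupMM3 K m) 0 c (gamma0 K m))
    (2 * (1 + PowerSeries.X + PowerSeries.X ^ 2) *
      (∑ i ∈ Finset.range m, PowerSeries.X ^ i) ^ 2) := by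
  have := hasHilbertSeries_of_equiv (fun ω : NormalIdx m => (normalExp ω).degree)
    (LinearEquiv.ofBijective (normalHom c) (normalHom_bijective c hJ)) (lPart_eq c hJ)
  rwa [finrank_sumZero, sum_X_pow_degree, ← mul_assoc, Nat.cast_ofNat] at this

end Hilbert

/-! ### The resolution of `L(γ₀)` -/

section Resolution

variable {K : Type*} [Field K] {m : ℕ}

theorem range_koszul₁ {A : Type*} [CommRing A] {ι : Type*} [Fintype ι]
    (Q : Fin 3 → Matrix ι ι A) : LinearMap.range (koszul₁ Q) =
      Submodule.span A (Set.range fun kj : Fin 3 × ι => fun i => Q kj.1 i kj.2) := by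
  classical
  apply le_antisymm
  · rintro _ ⟨u, rfl⟩
    rw [koszul₁, LinearMap.sum_apply]
    refine Submodule.sum_mem _ fun k _ => ?_
    rw [LinearMap.comp_apply, Matrix.mulVecLin_apply, Matrix.mulVec_eq_sum]
    refine Submodule.sum_mem _ fun j _ => ?_
    rw [op_smul_eq_smul]
    exact Submodule.smul_mem _ _ (Submodule.subset_span ⟨(k, j), rfl⟩)
  · rw [Submodule.span_le]
    rintro _ ⟨⟨k, j⟩, rfl⟩
    refine ⟨Pi.single k (Pi.single j 1), ?_⟩
    rw [koszul₁, LinearMap.sum_apply, Finset.sum_eq_single k]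
    · simp only [LinearMap.comp_apply, LinearMap.proj_apply, Pi.single_eq_same,
        Matrix.mulVecLin_apply, Matrix.mulVec_single_one]
      rfl
    · intro k' _ h
      simp [Pi.single_eq_of_ne h]
    · simp

theorem colVec_mem_relSub_iff_mem_range (u : Fin 2 → MvPolynomial (Fin 3) K) :
    colVec K u ∈ relSub K m ↔ u ∈ LinearMap.range (koszul₁ (matrixSeq K m)) := by
  constructor
  · intro h
    obtain ⟨w, hw, e⟩ := relSub_le_map_range h
    rwa [colVec_injective e] at hw
  · rintro ⟨w, rfl⟩
    exact koszul₁_mem_relSub w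

variable [NeZero m] (c : ReflectionClass (groupMM3 K m) → K)

theorem colHom_injective : Function.Injective (colHom (m := m) c) := fun u w h =>
  colVec_injective (by rw [← gammaVec_colHom c, h, gammaVec_colHom])

theorem colHom_mem_span_iff (u : Fin 2 → MvPolynomial (Fin 3) K) :
    colHom c u ∈ Submodule.span (MvPolynomial (Fin 3) K)
      (Set.range fun kj : Fin 3 × Fin 2 => colElement K m c fun i => matrixSeq K m kj.1 i kj.2) ↔
    colVec K u ∈ relSub K m := by
  have e : (Set.range fun kj : Fin 3 × Fin 2 =>
      colElement K m c fun i => matrixSeq K m kj.1 i kj.2) =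
      colHom c '' Set.range fun kj : Fin 3 × Fin 2 => fun i => matrixSeq K m kj.1 i kj.2 := by
    rw [← Set.range_comp]
    exact congrArg Set.range (funext fun kj => (colHom_apply c _).symm)
  rw [e, Submodule.span_image, ← range_koszul₁, colVec_mem_relSub_iff_mem_range]
  exact ⟨fun ⟨w, hw, h⟩ => colHom_injective c h ▸ hw, fun h => ⟨u, h, rfl⟩⟩

end Resolution

end Cherednik

end

theorem mainTheorem10 (K : Type*) [Field K] (p : ℕ) [CharP K p] (m : ℕ)
    (hm : ¬ p ∣ m) (hp3 : p ≠ 3) (h3 : ¬ 3 ∣ m)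
    (hroot : ∃ ξ : K, IsPrimitiveRoot ξ m)
    (c : Cherednik.ReflectionClass (Cherednik.groupMM3 K m) → K)
    (hc : AlgebraicIndependent (⊥ : Subfield K) c) :
    -- `J` is generated over the polynomial ring by the six columns
    (∀ u : Cherednik.Verma (Cherednik.groupMM3 K m) 0 c (Cherednik.gamma0 K m),
      u ∈ Cherednik.maxSubmodule (Cherednik.groupMM3 K m) 0 c (Cherednik.gamma0 K m) ↔
        u ∈ Submodule.span (MvPolynomial (Fin 3) K)
          (Set.range fun kj : Fin 3 × Fin 2 =>
            Cherednik.colElement K m c fun i => Cherednik.matrixSeq K m kj.1 i kj.2)) ∧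
    -- the matrices commute and their determinants form a regular sequence
    (∀ k l, Commute (Cherednik.matrixSeq K m k) (Cherednik.matrixSeq K m l)) ∧
    RingTheory.Sequence.IsRegular (MvPolynomial (Fin 3) K)
      (List.ofFn fun k => (Cherednik.matrixSeq K m k).det) ∧
    -- their Koszul complex is a minimal free resolution of `L(γ₀)`
    (Function.Injective (Cherednik.koszul₃ (Cherednik.matrixSeq K m)) ∧
      Function.Exact (Cherednik.koszul₃ (Cherednik.matrixSeq K m))
        (Cherednik.koszul₂ (Cherednik.matrixSeq K m)) ∧
      Function.Exact (Cherednik.koszul₂ (Cherednik.matrixSeq K m))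
        (Cherednik.koszul₁ (Cherednik.matrixSeq K m)) ∧
      Function.Exact (Cherednik.koszul₁ (Cherednik.matrixSeq K m))
        (fun u => (Cherednik.maxSubmodule (Cherednik.groupMM3 K m) 0 c
          (Cherednik.gamma0 K m)).mkQ (Cherednik.colElement K m c u)) ∧
      Function.Surjective
        (fun u => (Cherednik.maxSubmodule (Cherednik.groupMM3 K m) 0 c
          (Cherednik.gamma0 K m)).mkQ (Cherednik.colElement K m c u)) ∧
      ∀ k i j, MvPolynomial.constantCoeff (Cherednik.matrixSeq K m k i j) = 0) ∧
    -- the Hilbert series of `L(γ₀)`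
    Cherednik.HasHilbertSeries
      (Cherednik.lPart (Cherednik.groupMM3 K m) 0 c (Cherednik.gamma0 K m))
      (2 * (1 + PowerSeries.X + PowerSeries.X ^ 2) *
        (∑ i ∈ Finset.range m, PowerSeries.X ^ i) ^ 2) ∧
    -- `L(γ₀)` is irreducible
    IsSimpleModule
      (Cherednik.CherednikAlgebra (Cherednik.groupMM3 K m) 0 c)
      (Cherednik.LModule (Cherednik.groupMM3 K m) 0 c (Cherednik.gamma0 K m)) := by
  classical
  have hm0 : m ≠ 0 := by
    rintro rfl
    exact hm (dvd_zero p)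
  have : NeZero m := ⟨hm0⟩
  obtain ⟨ξ, hξ⟩ := hroot
  let s₀ : Cherednik.Reflection (Cherednik.groupMM3 K m) := Cherednik.reflEquiv K m (0, 1)
  -- All reflections are conjugate, so the parameter is a single scalar. Algebraic independence
  -- makes it nonzero, and `p ∤ m` does the same for `m` in `K`.
  have hc' : ∀ s : Cherednik.Reflection (Cherednik.groupMM3 K m),
      c s.conjClass = c s₀.conjClass := fun s => by rw [Cherednik.conjClass_eq s s₀]
  have hc₀ : c s₀.conjClass * m ≠ 0 :=
    mul_ne_zero (hc.ne_zero _) fun h => hm ((CharP.cast_eq_zero_iff K p m).1 h)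
  have hK3 : (3 : K) ≠ 0 := fun h => by
    have h' : p ∣ 3 := (CharP.cast_eq_zero_iff K p 3).1 (by exact_mod_cast h)
    rcases (Nat.dvd_prime Nat.prime_three).1 h' with h1 | h1
    · exact CharP.char_ne_one K p h1
    · exact hp3 h1
  have hmax := Cherednik.maxSubmodule_eq_radical c hc' hξ hK3 hc₀
  have hJ : ∀ u, u ∈ Cherednik.maxSubmodule (Cherednik.groupMM3 K m) 0 c (Cherednik.gamma0 K m) ↔
      Cherednik.gammaVec c u ∈ Cherednik.relSub K m := fun u => by
    rw [hmax, Cherednik.mem_radical]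
  have h0 := Cherednik.matrixSeq_zero_mulVec (K := K) (m := m)
  have h1 := Cherednik.matrixSeq_one_mulVec (K := K) (m := m)
  have hp : ∀ a, Cherednik.prodX K * a = 0 → a = 0 := fun a h =>
    (mul_eq_zero.1 h).resolve_left Cherednik.prodX_ne_zero
  have hq : ∀ a, Cherednik.prodX K ∣ Cherednik.psumX K m * a → Cherednik.prodX K ∣ a :=
    Cherednik.prodX_dvd_of_dvd_psumX_mul hm0
  refine ⟨fun u => ?_, Cherednik.matrixSeq_commute, Cherednik.matrixSeq_det_isRegular hm0,
    ⟨Cherednik.koszul₃_injective h0 hp, Cherednik.koszul₃_koszul₂_exact h0 h1 hp hq,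
      Cherednik.koszul₂_koszul₁_exact h0 h1 hp hq
        (Cherednik.mem_span_of_matrixSeq_two_mulVec_mem hm0), fun u => ?_, ?_,
      Cherednik.constantCoeff_matrixSeq hm0⟩, Cherednik.hasHilbertSeries_lPart c hJ, ?_⟩
  · obtain ⟨u, rfl⟩ := Cherednik.colHom_surjective c u
    rw [hJ, Cherednik.gammaVec_colHom, Cherednik.colHom_mem_span_iff]
  · beta_reduce
    rw [Submodule.mkQ_apply, Submodule.Quotient.mk_eq_zero, hJ, ← Cherednik.colHom_apply,
      Cherednik.gammaVec_colHom, Cherednik.colVec_mem_relSub_iff_mem_range]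
    rfl
  · refine (Submodule.mkQ_surjective _).comp fun u => ?_
    obtain ⟨u, rfl⟩ := Cherednik.colHom_surjective c u
    exact ⟨u, (Cherednik.colHom_apply c u).symm⟩
  · rw [isSimpleModule_iff_isCoatom, hmax]
    exact Cherednik.isCoatom_radical c hc' hξ hK3 hc₀
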